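/- **Setting.** Let $n\ge 1$, $p\ge 0$. The plant is the strict-feedback system $$\dot x_i=x_{i+1}+\varphi_i(x_1,\dots,x_i)^{T}\theta\ (1\le i\le n-1),\qquad \dot x_n=u+\varphi_n(x)^{T}\theta,\qquad y=x_1,$$ with smooth $\varphi_i$ ($\mathbb R^p$-valued) and an unknown constant $\theta\in\mathbb R^p$; write $\dot x=f(x,u)+F(x)^T\theta$ with $f(x,u)=(x_2,\dots,x_n,u)^T$ and $F=[\varphi_1,\dots,\varphi_n]\in\mathbb R^{p\times n}$. The function $r$ on $[0,\infty)$ and its first $n$ derivatives are bounded, and $r^{(n)}$ is piecewise continuous (at a jump of $r^{(n)}$ the derivative of $r^{(n-1)}$ need not exist). Let $c_i,\kappa_i,g_i>0$ $(1\le i\le n)$, $\sigma>0$, $\nu\ge 0$, $\Gamma=\Gamma^T>0$. Put $\alpha_0=0$, and for $i=1,\dots,n$ $$h_i=x_i-\alpha_{i-1}-r^{(i-1)},\qquad w_i=\varphi_i-\sum_{j=1}^{i-1}\frac{\partial\alpha_{i-1}}{\partial x_j}\varphi_j,\qquad s_i=c_i+\kappa_i|w_i|^2+g_i\Big|\frac{\partial\alpha_{i-1}}{\partial\hat\theta}\Big|^2,$$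 $$\alpha_i=-s_ih_i-w_i^T\hat\theta+\sum_{k=1}^{i-1}\Big(\frac{\partial\alpha_{i-1}}{\partial x_k}x_{k+1}+\frac{\partial\alpha_{i-1}}{\partial r^{(k-1)}}r^{(k)}\Big),$$ where $\hat\theta$ is the estimate of $\theta$ and $\tilde\theta=\theta-\hat\theta$. The controller is $u=\alpha_n+r^{(n)}$. Let $A_0$ be the $n\times n$ upper bidiagonal matrix with diagonal $-c_1,\dots,-c_n$ and superdiagonal entries $1$, and let $P=P^T>0$ solve $A_0^TP+PA_0=-I$. The filters, with $\Omega\in\mathbb R^{p\times n}$, $\Omega_0\in\mathbb R^n$, and the update law are $$\dot\Omega^T=(A_0-\sigma F(x)^TF(x)P)\,\Omega^T+F(x)^T,\qquad \dot\Omega_0=(A_0-\sigma F(x)^TF(x)P)(\Omega_0+x)-f(x,u),$$ $$\dot{\hat\theta}=\Gamma\,\frac{\Omega\epsilon}{1+\nu|\Omega|_F^2},\qquad \epsilon=x+\Omega_0-\Omega^T\hat\theta .$$ Solutions $(x,\Omega,\Omega_0,\hat\theta)$ are continuous and satisfy the equations except at the discontinuities of $r^{(n)}$. **Theorem 4 ($x$-Swapping).**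 For this closed-loop system: (i) All signals are globally uniformly bounded and global asymptotic tracking is achieved. That is, for every initial time $t_0\ge0$ and every initial state there is a solution on $[t_0,\infty)$; for every $R$ there is a $B$ such that for every $t_0\ge 0$, along every solution on an interval with first point $t_0$ whose initial values $x(t_0),\Omega(t_0),\Omega_0(t_0),\hat\theta(t_0)$ have norm at most $R$, the signals $x,\Omega,\Omega_0,\hat\theta,h_1,\dots,h_n,\epsilon,\tilde\theta,u,\dot{\hat\theta}$ are bounded by $B$ on that interval; and $y(t)-r(t)\to0$ as $t\to\infty$ along every solution on $[t_0,\infty)$. (ii) Let $\nu>0$, $\Gamma=\gamma I$ with $\gamma>0$, and consider a solution on $[0,\infty)$ with $h_1(0)\ge0$, $\Omega(0)=0$, $\Omega_0(0)=-x(0)$. For $1\le i\le n-1$ let $$b_i=x_{i+1}-r^{(i)}+w_i^T\hat\theta-\sum_{j=1}^{i-1}\Big(\frac{\partial\alpha_{i-1}}{\partial x_j}x_{j+1}+\frac{\partial\alpha_{i-1}}{\partial r^{(j-1)}}r^{(j)}\Big)\ \text{ at } t=0,\qquad \underline c_i=-h_i(0)^{-1}b_i,$$ and suppose that $c_i\ge\max\{\underline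 c_i,0\}$ for $1\le i\le n-1$, where for $h_i(0)=0$ this is read as $b_i\ge0$. Then for all $t\ge0$ $$-h_1^*\le h_1(t)\le e^{-\underline c t}\sum_{i=1}^n\frac{t^{i-1}}{(i-1)!}h_i(0)+h_1^*,$$ $$h_1^*=\frac{\underline c^{\,n}-1}{2\,\underline c^{\,n-1}(\underline c-1)}\Big(\frac1{\sqrt{\underline c\,\underline\kappa}}+\frac{\gamma}{\nu\sqrt{\underline c\,\underline g}}\Big)|\tilde\theta(0)|,$$ where $\underline c=\min_{1\le i\le n}c_i$, $\underline\kappa=\min_{1\le i\le n}\kappa_i$, $\underline g=\min_{2\le i\le n}g_i$. For $\underline c=1$ the quotient $(\underline c^{\,n}-1)/(\underline c^{\,n-1}(\underline c-1))$ means $n$, and for $n=1$ the term with $\underline g$ is absent. -/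

import Mathlib

open Set Filter Topology
open scoped ContDiff Matrix

noncomputable section

namespace AdaptiveOverride

/-! Indices are shifted: the mathematical index `i = 1, …, n` is `i - 1 : Fin n` here.
A generic argument `ρ : Fin n → ℝ` stands for the list `(r, r', …, r⁽ⁿ⁻¹⁾)`. -/

/-- The parameter space `ℝᵖ` with the Euclidean norm. -/
abbrev Par (p : ℕ) := EuclideanSpace ℝ (Fin p)

/-- Scalar functions of `(x, (r, …, r⁽ⁿ⁻¹⁾), θ̂)`. -/
abbrev ScalarFn (n p : ℕ) := (Fin n → ℝ) → (Fin n → ℝ) → Par p → ℝ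

/-- The regressors: `φ i` is a smooth `ℝᵖ`-valued function of the state that depends only on the
coordinates of index at most `i` (strict-feedback form). -/
structure IsStrictFeedback {n p : ℕ} (φ : Fin n → (Fin n → ℝ) → Par p) : Prop where
  smooth : ∀ i, ContDiff ℝ ∞ (φ i)
  strict : ∀ i x y, (∀ j ≤ i, x j = y j) → φ i x = φ i y

/-- `f` is piecewise continuous on `[0, ∞)`: finitely many discontinuities on every bounded
interval, and finite one-sided limits everywhere. -/
structure PiecewiseContinuous (f : ℝ → ℝ) : Prop where
  finite_disc : ∀ T : ℝ, {t | t ∈ Icc 0 T ∧ ¬ ContinuousWithinAt f (Ici 0) t}.Finite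
  right_lim : ∀ t, 0 ≤ t → ∃ l, Tendsto f (𝓝[>] t) (𝓝 l)
  left_lim : ∀ t, 0 < t → ∃ l, Tendsto f (𝓝[<] t) (𝓝 l)

/-- `r 0` is a boundary function on `[0, ∞)` with derivatives `r 1, …, r n`, all bounded; the last
derivative is piecewise continuous, and it is the derivative of the (continuous) `r (n - 1)` at
each of its points of continuity. -/
structure IsBoundarySignal (n : ℕ) (r : ℕ → ℝ → ℝ) : Prop where
  hasDeriv : ∀ k, k + 1 < n → ∀ t, 0 ≤ t → HasDerivWithinAt (r k) (r (k + 1) t) (Ici 0) t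
  continuous_pred : ContinuousOn (r (n - 1)) (Ici 0)
  hasDeriv_last : ∀ t, 0 ≤ t → ContinuousWithinAt (r n) (Ici 0) t →
    HasDerivWithinAt (r (n - 1)) (r n t) (Ici 0) t
  piecewise : PiecewiseContinuous (r n)
  bounded : ∃ M, ∀ k ≤ n, ∀ t, 0 ≤ t → |r k t| ≤ M

/-- The upper bidiagonal matrix `A₀` with diagonal `-c₁, …, -cₙ` and superdiagonal `1`. -/
def stableMatrix {n : ℕ} (c : Fin n → ℝ) : Matrix (Fin n) (Fin n) ℝ :=
  Matrix.of fun i j => if i = j then -c i else if (i : ℕ) + 1 = j then 1 else 0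

/-- The design parameters: the gains `cᵢ, κᵢ, gᵢ, σ > 0`, `ν ≥ 0`, the adaptation matrix
`Γ = Γᵀ > 0`, and the solution `P = Pᵀ > 0` of `A₀ᵀ P + P A₀ = -I`. -/
structure Design (n p : ℕ) where
  c : Fin n → ℝ
  κ : Fin n → ℝ
  g : Fin n → ℝ
  σ : ℝ
  ν : ℝ
  Γ : Matrix (Fin p) (Fin p) ℝ
  P : Matrix (Fin n) (Fin n) ℝ
  c_pos : ∀ i, 0 < c i
  κ_pos : ∀ i, 0 < κ i
  g_pos : ∀ i, 0 < g i
  σ_pos : 0 < σ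
  ν_nonneg : 0 ≤ ν
  Γ_posDef : Γ.PosDef
  P_posDef : P.PosDef
  lyapunov : (stableMatrix c)ᵀ * P + P * stableMatrix c = -1

section Backstepping

variable {n p : ℕ}

/-- `∂a/∂xₖ`. -/
def partialX (a : ScalarFn n p) (k : Fin n) : ScalarFn n p := fun x ρ ϑ =>
  fderiv ℝ (fun ξ => a ξ ρ ϑ) x (Pi.single k 1)

/-- `∂a/∂r⁽ᵏ⁾`. -/
def partialR (a : ScalarFn n p) (k : Fin n) : ScalarFn n p := fun x ρ ϑ =>
  fderiv ℝ (fun ξ => a x ξ ϑ) ρ (Pi.single k 1)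

/-- `(∂a/∂θ̂)ᵀ`. -/
def gradPar (a : ScalarFn n p) (x ρ : Fin n → ℝ) (ϑ : Par p) : Par p :=
  gradient (fun η => a x ρ η) ϑ

/-- `xᵢ - a - r⁽ⁱ⁻¹⁾` (1-based), for `a` the preceding virtual control. -/
def errStep (i : Fin n) (a : ScalarFn n p) : ScalarFn n p := fun x ρ ϑ =>
  x i - a x ρ ϑ - ρ i

/-- `φᵢ - ∑_{j<i} (∂a/∂xⱼ) φⱼ`, for `a` the preceding virtual control. -/
def wStep (φ : Fin n → (Fin n → ℝ) → Par p) (i : Fin n) (a : ScalarFn n p)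
    (x ρ : Fin n → ℝ) (ϑ : Par p) : Par p :=
  φ i x - ∑ j ∈ Finset.Iio i, partialX a j x ρ ϑ • φ j x

/-- `cᵢ + κᵢ |wᵢ|² + gᵢ |∂a/∂θ̂|²`, for `a` the preceding virtual control. -/
def sStep (φ : Fin n → (Fin n → ℝ) → Par p) (D : Design n p) (i : Fin n) (a : ScalarFn n p) :
    ScalarFn n p := fun x ρ ϑ =>
  D.c i + D.κ i * ‖wStep φ i a x ρ ϑ‖ ^ 2 + D.g i * ‖gradPar a x ρ ϑ‖ ^ 2

/-- `∑_{k<i} ((∂a/∂xₖ) xₖ₊₁ + (∂a/∂r⁽ᵏ⁻¹⁾) r⁽ᵏ⁾)` (1-based), for `a` the preceding virtual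
control. -/
def driftStep (i : Fin n) (a : ScalarFn n p) : ScalarFn n p := fun x ρ ϑ =>
  ∑ k : Fin (i : ℕ),
    (partialX a ⟨k, k.2.trans i.2⟩ x ρ ϑ * x ⟨k + 1, Nat.lt_of_le_of_lt k.2 i.2⟩ +
      partialR a ⟨k, k.2.trans i.2⟩ x ρ ϑ * ρ ⟨k + 1, Nat.lt_of_le_of_lt k.2 i.2⟩)

/-- The virtual controls `α₀ = 0, α₁, …, αₙ`. -/
def virtualControl (φ : Fin n → (Fin n → ℝ) → Par p) (D : Design n p) :
    Fin (n + 1) → ScalarFn n p :=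
  Fin.induction (motive := fun _ => ScalarFn n p) (fun _ _ _ => 0)
    (fun i a x ρ ϑ =>
      -(sStep φ D i a x ρ ϑ * errStep i a x ρ ϑ) - inner ℝ (wStep φ i a x ρ ϑ) ϑ
        + driftStep i a x ρ ϑ)

/-- The error coordinates `h₁ = y - r`, `hᵢ = xᵢ - αᵢ₋₁ - r⁽ⁱ⁻¹⁾`. -/
def err (φ : Fin n → (Fin n → ℝ) → Par p) (D : Design n p) (i : Fin n) : ScalarFn n p :=
  errStep i (virtualControl φ D i.castSucc)

/-- `x_{i+1} - r⁽ⁱ⁾ + wᵢᵀ θ̂ - ∑_{j<i} ((∂αᵢ₋₁/∂xⱼ) xⱼ₊₁ + (∂αᵢ₋₁/∂r⁽ʲ⁻¹⁾) r⁽ʲ⁾)` for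
`1 ≤ i ≤ n - 1` (1-based). -/
def gainBracket (φ : Fin n → (Fin n → ℝ) → Par p) (D : Design n p) (i : Fin n)
    (hi : (i : ℕ) + 1 < n) : ScalarFn n p := fun x ρ ϑ =>
  x ⟨i + 1, hi⟩ - ρ ⟨i + 1, hi⟩
    + inner ℝ (wStep φ i (virtualControl φ D i.castSucc) x ρ ϑ) ϑ
    - driftStep i (virtualControl φ D i.castSucc) x ρ ϑ

/-- The lower bound `c̲ᵢ = -hᵢ⁻¹ · [bracket]` at given initial values (meaningful if `hᵢ ≠ 0`). -/
def gainLowerBound (φ : Fin n → (Fin n → ℝ) → Par p) (D : Design n p) (i : Fin n)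
    (hi : (i : ℕ) + 1 < n) : ScalarFn n p := fun x ρ ϑ =>
  -(err φ D i x ρ ϑ)⁻¹ * gainBracket φ D i hi x ρ ϑ

/-- The gain choice `cᵢ ≥ max {c̲ᵢ, 0}` for `1 ≤ i ≤ n - 1` at given initial values (positivity of
all gains is part of `Design`). Where `hᵢ = 0`, so that `c̲ᵢ` is a quotient by zero, the
requirement is that the bracket be nonnegative. -/
def GainChoice (φ : Fin n → (Fin n → ℝ) → Par p) (D : Design n p)
    (x ρ : Fin n → ℝ) (ϑ : Par p) : Prop :=
  ∀ (i : Fin n) (hi : (i : ℕ) + 1 < n),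
    (err φ D i x ρ ϑ ≠ 0 → max (gainLowerBound φ D i hi x ρ ϑ) 0 ≤ D.c i) ∧
    (err φ D i x ρ ϑ = 0 → 0 ≤ gainBracket φ D i hi x ρ ϑ)

end Backstepping

section ClosedLoop

variable {n p : ℕ}

/-- `(r(t), r'(t), …, r⁽ⁿ⁻¹⁾(t))`. -/
def refVec (n : ℕ) (r : ℕ → ℝ → ℝ) (t : ℝ) : Fin n → ℝ := fun k => r k t

/-- The Frobenius norm. -/
def frobNorm (M : Matrix (Fin p) (Fin n) ℝ) : ℝ := √(∑ j, ∑ i, M j i ^ 2)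

/-- `f(x, u) = (x₂, …, xₙ, u)`. -/
def shiftField (x : Fin n → ℝ) (u : ℝ) : Fin n → ℝ := fun i =>
  if hi : (i : ℕ) + 1 < n then x ⟨i + 1, hi⟩ else u

/-- The `p × n` matrix `F(x)` whose columns are `φ₁, …, φₙ`. -/
def regressor (φ : Fin n → (Fin n → ℝ) → Par p) (x : Fin n → ℝ) : Matrix (Fin p) (Fin n) ℝ :=
  Matrix.of fun j i => φ i x j

/-- `A₀ - σ F(x)ᵀ F(x) P`. -/
def filterMatrix (φ : Fin n → (Fin n → ℝ) → Par p) (D : Design n p) (x : Fin n → ℝ) :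
    Matrix (Fin n) (Fin n) ℝ :=
  stableMatrix D.c - D.σ • ((regressor φ x)ᵀ * regressor φ x * D.P)

/-- The time functions that form the closed-loop state. -/
structure Trajectory (n p : ℕ) where
  x : ℝ → Fin n → ℝ
  Ω : ℝ → Matrix (Fin p) (Fin n) ℝ
  Ω₀ : ℝ → Fin n → ℝ
  θhat : ℝ → Par p

namespace Trajectory

/-- The applied control `u = ū = αₙ + r⁽ⁿ⁾`. -/
def control (φ : Fin n → (Fin n → ℝ) → Par p) (D : Design n p) (r : ℕ → ℝ → ℝ)
    (S : Trajectory n p) (t : ℝ) : ℝ :=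
  virtualControl φ D (Fin.last n) (S.x t) (refVec n r t) (S.θhat t) + r n t

/-- The signal `hᵢ(t)`. -/
def h (φ : Fin n → (Fin n → ℝ) → Par p) (D : Design n p) (r : ℕ → ℝ → ℝ)
    (S : Trajectory n p) (i : Fin n) (t : ℝ) : ℝ :=
  err φ D i (S.x t) (refVec n r t) (S.θhat t)

/-- The estimation error `ε = x + Ω₀ - Ωᵀ θ̂`. -/
def ε (S : Trajectory n p) (t : ℝ) : Fin n → ℝ :=
  S.x t + S.Ω₀ t - (S.Ω t)ᵀ *ᵥ (S.θhat t).ofLp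

/-- The normalized gradient direction `Γ Ω ε / (1 + ν |Ω|_F²)`. -/
def updateLaw (D : Design n p) (S : Trajectory n p) (t : ℝ) : Par p :=
  (1 + D.ν * frobNorm (S.Ω t) ^ 2)⁻¹ • WithLp.toLp 2 (D.Γ *ᵥ (S.Ω t *ᵥ S.ε t))

/-- `S` solves the closed loop (plant, controller, filters, update law) on the time interval `J`:
all components are continuous and the differential equations hold at each `t ∈ J` at which the
right-hand side is not discontinuous through a jump of `r⁽ⁿ⁾`. -/
structure IsSolution (φ : Fin n → (Fin n → ℝ) → Par p) (θ : Par p) (D : Design n p)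
    (r : ℕ → ℝ → ℝ) (J : Set ℝ) (S : Trajectory n p) : Prop where
  x_cont : ContinuousOn S.x J
  Ω_cont : ContinuousOn S.Ω J
  Ω₀_cont : ContinuousOn S.Ω₀ J
  θhat_cont : ContinuousOn S.θhat J
  plant : ∀ t ∈ J, ContinuousWithinAt (r n) (Ici 0) t →
    HasDerivWithinAt S.x
      (shiftField (S.x t) (S.control φ D r t) + (regressor φ (S.x t))ᵀ *ᵥ θ.ofLp) J t
  filter : ∀ t ∈ J, ContinuousWithinAt (r n) (Ici 0) t → ∀ i j,
    HasDerivWithinAt (fun s => (S.Ω s)ᵀ i j)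
      ((filterMatrix φ D (S.x t) * (S.Ω t)ᵀ + (regressor φ (S.x t))ᵀ) i j) J t
  filter₀ : ∀ t ∈ J, ContinuousWithinAt (r n) (Ici 0) t →
    HasDerivWithinAt S.Ω₀
      (filterMatrix φ D (S.x t) *ᵥ (S.Ω₀ t + S.x t) - shiftField (S.x t) (S.control φ D r t)) J t
  update : ∀ t ∈ J, ContinuousWithinAt (r n) (Ici 0) t →
    HasDerivWithinAt S.θhat (S.updateLaw D t) J t

/-- The closed-loop state at time `t` is of size at most `R`. -/
def StateBound (S : Trajectory n p) (R t : ℝ) : Prop :=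
  ‖S.x t‖ ≤ R ∧ frobNorm (S.Ω t) ≤ R ∧ ‖S.Ω₀ t‖ ≤ R ∧ ‖S.θhat t‖ ≤ R

/-- All closed-loop signals at time `t` (state, error coordinates, estimation error, parameter
error, control, and update rate) are of size at most `B`. -/
def SignalBound (φ : Fin n → (Fin n → ℝ) → Par p) (θ : Par p) (D : Design n p)
    (r : ℕ → ℝ → ℝ) (S : Trajectory n p) (B t : ℝ) : Prop :=
  S.StateBound B t ∧ (∀ i, |S.h φ D r i t| ≤ B) ∧ ‖S.ε t‖ ≤ B ∧ ‖θ - S.θhat t‖ ≤ B ∧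
    |S.control φ D r t| ≤ B ∧ ‖S.updateLaw D t‖ ≤ B

end Trajectory

/-- `c̲ = min_{1≤i≤n} cᵢ`. -/
def Design.cMin (D : Design n p) : ℝ := ⨅ i, D.c i

/-- `κ̲ = min_{1≤i≤n} κᵢ`. -/
def Design.κMin (D : Design n p) : ℝ := ⨅ i, D.κ i

/-- `g̲ = min_{2≤i≤n} gᵢ` (used for `n ≥ 2`). -/
def Design.gMin (D : Design n p) : ℝ := ⨅ i : {i : Fin n // 0 < (i : ℕ)}, D.g i

/-- `(cⁿ - 1) / (cⁿ⁻¹ (c - 1)) = 1 + c⁻¹ + ⋯ + c⁻⁽ⁿ⁻¹⁾`, with its value `n` at `c = 1`. -/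
def geomFactor (n : ℕ) (c : ℝ) : ℝ :=
  if c = 1 then n else (c ^ n - 1) / (c ^ (n - 1) * (c - 1))

/-- The violation bound `h₁*` for `Γ = γ I` and initial parameter error of size `e`. For `n = 1`
there is no `g̲`, and the term containing it is absent. -/
def violationBound (D : Design n p) (γ e : ℝ) : ℝ :=
  geomFactor n D.cMin / 2 *
    (1 / √(D.cMin * D.κMin) + if n = 1 then 0 else γ / (D.ν * √(D.cMin * D.gMin))) * e

end ClosedLoop

end AdaptiveOverride

end

open AdaptiveOverride

/-! ### Differential inequalities with finitely many exceptional times -/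

/-! The controller turns the plant into a cascade `ḣᵢ = -sᵢ hᵢ + hᵢ₊₁ + wᵢᵀθ̃ - (∂αᵢ₋₁/∂θ̂)·dθ̂/dt`
with `hₙ₊₁ = 0` (`DynamicsAt.hasDerivAt_h`). The perturbations may grow with the state, but the
gains `sᵢ` grow with the squares of `wᵢ` and `∂αᵢ₋₁/∂θ̂`. So it suffices to bound `θ̃` and `dθ̂/dt`
without any knowledge of `x`.

The filters achieve this. The vector `εTrue = x + Ω₀ - Ωᵀθ` solves the homogeneous filter equation,
and its `P`-energy decreases. The damping term `-σFᵀFP` absorbs the forcing `Fᵀ` of `Ω` by Young's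
inequality, whatever `x` is, so `Ω` is bounded. With `η = Ωᵀθ̃` one has `ε = εTrue + η`, and
`θ̃ᵀΓ⁻¹θ̃ + εTrueᵀ P εTrue` has derivative at most `-|ε|²/(1 + ν|Ω|²)`; hence `θ̃`, `ε` and the
update rate are bounded. Nonlinear damping then bounds `hₙ, …, h₁` in turn, and the triangular
structure of the `αᵢ` recovers `x`. All these bounds are independent of the length of the interval
(`exists_signalBound`), so they also exclude blow-up and give global existence.

For tracking, the energy inequalities and a Barbalat argument give `εTrue → 0` and `ε → 0`, hence `η
→ 0` and `dθ̂/dt → 0`. Since `η̇` equals `Fᵀθ̃` up to vanishing terms and `Fᵀθ̃` is Lipschitz in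
time, a second Barbalat argument gives `Fᵀθ̃ → 0`. Each `wᵢ` is a combination of regressors with
bounded coefficients, so every perturbation vanishes and the cascade converges from the last
coordinate to the first.

For the explicit bounds, the filter initialization makes `εTrue` vanish identically. Then `|θ̃|`
never exceeds its initial value and `|dθ̂/dt| ≤ (γ/ν)|θ̃(0)|`, so each perturbation is at most the
gain times a constant `m`. Comparison along the cascade produces a geometric sum in `m` and the
exact solution of the linear cascade with all rates equal to `c̲`. The gain choice makes every
`hᵢ(0)` nonnegative, as this comparison requires. -/

/-- Each exceptional point splits the interval in two; continuity across it is enough to chain the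
two inequalities. This is how the jumps of `r⁽ⁿ⁾` are handled throughout. -/
theorem le_of_hasDerivAt_nonpos_off_finset {f : ℝ → ℝ} (s : Finset ℝ) : ∀ {a b : ℝ}, a ≤ b →
    ContinuousOn f (Icc a b) →
    (∀ t ∈ Ioo a b, t ∉ s → ∃ f', HasDerivAt f f' t ∧ f' ≤ 0) → f b ≤ f a := by
  classical
  induction s using Finset.induction_on with
  | empty =>
    intro a b hab hc hd
    have h : AntitoneOn f (Icc a b) := by
      refine antitoneOn_of_deriv_nonpos (convex_Icc a b) hc ?_ ?_
      · intro t ht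
        rw [interior_Icc] at ht
        obtain ⟨f', h1, -⟩ := hd t ht (by simp)
        exact h1.differentiableAt.differentiableWithinAt
      · intro t ht
        rw [interior_Icc] at ht
        obtain ⟨f', h1, h2⟩ := hd t ht (by simp)
        rwa [h1.deriv]
    exact h (left_mem_Icc.2 hab) (right_mem_Icc.2 hab) hab
  | insert c s _ ih =>
    intro a b hab hc hd
    by_cases hcm : c ∈ Ioo a b
    · have h1 : f c ≤ f a := by
        refine ih hcm.1.le (hc.mono (Icc_subset_Icc_right hcm.2.le)) fun t ht hts =>
          hd t ⟨ht.1, ht.2.trans hcm.2⟩ ?_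
        simp only [Finset.mem_insert, not_or]
        exact ⟨ht.2.ne, hts⟩
      have h2 : f b ≤ f c := by
        refine ih hcm.2.le (hc.mono (Icc_subset_Icc_left hcm.1.le)) fun t ht hts =>
          hd t ⟨hcm.1.trans ht.1, ht.2⟩ ?_
        simp only [Finset.mem_insert, not_or]
        exact ⟨ht.1.ne', hts⟩
      exact h2.trans h1
    · refine ih hab hc fun t ht hts => hd t ht ?_
      simp only [Finset.mem_insert, not_or]
      exact ⟨fun h => hcm (h ▸ ht), hts⟩

theorem le_of_hasDerivAt_nonpos_off_finite {f : ℝ → ℝ} {N : Set ℝ} {a b : ℝ} (hab : a ≤ b)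
    (hN : (N ∩ Icc a b).Finite) (hc : ContinuousOn f (Icc a b))
    (hd : ∀ t ∈ Ioo a b, t ∉ N → ∃ f', HasDerivAt f f' t ∧ f' ≤ 0) : f b ≤ f a :=
  le_of_hasDerivAt_nonpos_off_finset hN.toFinset hab hc fun t ht hts =>
    hd t ht fun h => hts (hN.mem_toFinset.2 ⟨h, Ioo_subset_Icc_self ht⟩)

/-- A function that is nonpositive initially and does not increase while it is positive stays
nonpositive. -/
theorem nonpos_of_hasDerivAt_nonpos_of_pos {y : ℝ → ℝ} {N : Set ℝ} {a b : ℝ} (hab : a ≤ b)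
    (hN : (N ∩ Icc a b).Finite) (hc : ContinuousOn y (Icc a b)) (ha : y a ≤ 0)
    (hd : ∀ t ∈ Ioo a b, t ∉ N → 0 < y t → ∃ y', HasDerivAt y y' t ∧ y' ≤ 0) : y b ≤ 0 := by
  by_contra! hb
  -- `sSup K` is the last time at which `y ≤ 0`; after it `y` is positive, so it cannot have
  -- increased.
  set K := Icc a b ∩ y ⁻¹' Iic 0 with hK
  have hKc : IsCompact K :=
    isCompact_Icc.of_isClosed_subset (hc.preimage_isClosed_of_isClosed isClosed_Icc isClosed_Iic)
      inter_subset_left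
  have hτ : sSup K ∈ K := hKc.sSup_mem ⟨a, left_mem_Icc.2 hab, ha⟩
  set τ := sSup K
  have hpos : ∀ t ∈ Ioc τ b, 0 < y t := by
    intro t ht
    by_contra! hle
    exact absurd (le_csSup hKc.bddAbove (⟨⟨hτ.1.1.trans ht.1.le, ht.2⟩, hle⟩ : t ∈ K))
      (not_le.2 ht.1)
  have hsub : Icc τ b ⊆ Icc a b := Icc_subset_Icc_left hτ.1.1
  have := le_of_hasDerivAt_nonpos_off_finite hτ.1.2 (hN.subset (inter_subset_inter_right _ hsub))
    (hc.mono hsub) fun t ht htN => hd t ⟨hτ.1.1.trans_lt ht.1, ht.2⟩ htN (hpos t ⟨ht.1, ht.2.le⟩)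
  exact absurd (this.trans hτ.2) (not_le.2 hb)

theorem abs_sub_le_of_hasDerivAt_off_finite {f : ℝ → ℝ} {N : Set ℝ} {a b K : ℝ} (hab : a ≤ b)
    (hN : (N ∩ Icc a b).Finite) (hc : ContinuousOn f (Icc a b))
    (hd : ∀ t ∈ Ioo a b, t ∉ N → ∃ f', HasDerivAt f f' t ∧ |f'| ≤ K) :
    |f b - f a| ≤ K * (b - a) := by
  have h1 := le_of_hasDerivAt_nonpos_off_finite (f := fun t => f t - K * t) hab hN
    (hc.sub (by fun_prop)) (fun t ht htN => by
      obtain ⟨f', h1, h2⟩ := hd t ht htN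
      exact ⟨_, h1.sub ((hasDerivAt_id t).const_mul K), by
        have := (abs_le.1 h2).2; simp; linarith⟩)
  have h2 := le_of_hasDerivAt_nonpos_off_finite (f := fun t => -f t - K * t) hab hN
    (hc.neg.sub (by fun_prop)) (fun t ht htN => by
      obtain ⟨f', h1, h2⟩ := hd t ht htN
      exact ⟨_, h1.neg.sub ((hasDerivAt_id t).const_mul K), by
        have := (abs_le.1 h2).1; simp; linarith⟩)
  rw [abs_le]
  constructor <;> linarith

theorem eventually_le_of_damped {y s e : ℝ → ℝ} {N : Set ℝ} {t₀ c : ℝ}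
    (hN : ∀ T, (N ∩ Icc t₀ T).Finite) (hcont : ContinuousOn y (Ici t₀)) (hc : 0 < c)
    (hs : ∀ t, t₀ ≤ t → c ≤ s t)
    (hd : ∀ t, t₀ < t → t ∉ N → HasDerivAt y (-(s t * y t) + e t) t)
    (he : Tendsto e atTop (𝓝 0)) {δ : ℝ} (hδ : 0 < δ) : ∀ᶠ t in atTop, y t ≤ δ := by
  have h1 : ∀ᶠ t in atTop, e t < c * (δ / 2) :=
    he.eventually (gt_mem_nhds (by positivity))
  obtain ⟨T, hT⟩ := (h1.and (eventually_ge_atTop t₀)).exists_forall_of_atTop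
  have hT0 : t₀ ≤ T := (hT T le_rfl).2
  -- After time `T` the forcing is below `c * (δ / 2)`, so `δ / 2 + |y T| e^{-c (t - T)}` is a
  -- supersolution. Where `y` exceeds it, `y` is positive and the gain `s` may be replaced by its
  -- lower bound `c`.
  have key : ∀ t, T ≤ t → y t - (δ / 2 + |y T| * Real.exp (-c * (t - T))) ≤ 0 := by
    intro t ht
    refine nonpos_of_hasDerivAt_nonpos_of_pos
      (y := fun t => y t - (δ / 2 + |y T| * Real.exp (-c * (t - T)))) (N := N) ht
      ((hN t).subset (inter_subset_inter_right _ (Icc_subset_Icc_left hT0)))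
      ((hcont.mono (Icc_subset_Ici_self.trans (Ici_subset_Ici.2 hT0))).sub (by fun_prop)) ?_ ?_
    · have := le_abs_self (y T)
      simp; linarith
    · intro τ hτ hτN hpos
      have hexp : HasDerivAt (fun t => Real.exp (-c * (t - T)))
          (Real.exp (-c * (τ - T)) * (-c)) τ := by
        have : HasDerivAt (fun t => -c * (t - T)) (-c) τ := by
          simpa using ((hasDerivAt_id τ).sub_const T).const_mul (-c)
        exact this.exp
      refine ⟨_, (hd τ (hT0.trans_lt hτ.1) hτN).sub ((hexp.const_mul |y T|).const_add (δ / 2)), ?_⟩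
      have h2 := (hT τ hτ.1.le).1
      have h3 := hs τ (hT0.trans hτ.1.le)
      have hE : 0 ≤ |y T| * Real.exp (-c * (τ - T)) := by positivity
      have h4 : c * y τ ≤ s τ * y τ := mul_le_mul_of_nonneg_right h3 (by linarith)
      have h5 : c * (δ / 2 + |y T| * Real.exp (-c * (τ - T))) ≤ c * y τ :=
        mul_le_mul_of_nonneg_left (by linarith) hc.le
      linarith
  have hlim : Tendsto (fun t => δ / 2 + |y T| * Real.exp (-c * (t - T))) atTop (𝓝 (δ / 2)) := by
    have h2 : Tendsto (fun t => -c * (t - T)) atTop atBot :=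
      (tendsto_atTop_add_const_right atTop (-T) tendsto_id).const_mul_atTop_of_neg (by linarith)
    simpa using ((Real.tendsto_exp_atBot.comp h2).const_mul |y T|).const_add (δ / 2)
  filter_upwards [hlim.eventually (gt_mem_nhds (show δ / 2 < δ by linarith)),
    eventually_ge_atTop T] with t h2 h3
  have := key t h3
  linarith

/-- Solutions of `y' = -s y + e` with `s ≥ c > 0` and `e → 0` tend to `0`. -/
theorem tendsto_zero_of_damped {y s e : ℝ → ℝ} {N : Set ℝ} {t₀ c : ℝ}
    (hN : ∀ T, (N ∩ Icc t₀ T).Finite) (hcont : ContinuousOn y (Ici t₀)) (hc : 0 < c)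
    (hs : ∀ t, t₀ ≤ t → c ≤ s t)
    (hd : ∀ t, t₀ < t → t ∉ N → HasDerivAt y (-(s t * y t) + e t) t)
    (he : Tendsto e atTop (𝓝 0)) : Tendsto y atTop (𝓝 0) := by
  rw [Metric.tendsto_nhds]
  intro δ hδ
  have h1 := eventually_le_of_damped hN hcont hc hs hd he (half_pos hδ)
  have h2 := eventually_le_of_damped (y := fun t => -y t) (e := fun t => -e t) hN hcont.neg hc hs
    (fun t ht htN => (hd t ht htN).neg.congr_deriv (by ring)) (by simpa using he.neg)
    (half_pos hδ)
  filter_upwards [h1, h2] with t h1 h2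
  rw [Real.dist_eq, sub_zero, abs_lt]
  constructor <;> linarith

/-- A form of Barbalat's lemma. -/
theorem eventually_le_of_deriv_le_sub {G a b : ℝ → ℝ} {N : Set ℝ} {t₀ l L : ℝ}
    (hN : ∀ T, (N ∩ Icc t₀ T).Finite) (hcont : ContinuousOn G (Ici t₀))
    (hG : Tendsto G atTop (𝓝 l)) (ha : Tendsto a atTop (𝓝 0))
    (hb : ∀ s t, t₀ ≤ s → s ≤ t → |b t - b s| ≤ L * (t - s))
    (hd : ∀ t, t₀ < t → t ∉ N → ∃ G', HasDerivAt G G' t ∧ G' ≤ a t - b t)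
    {δ : ℝ} (hδ : 0 < δ) : ∀ᶠ t in atTop, b t ≤ δ := by
  set M := |L| + 1
  have hM : 0 < M := by positivity
  -- A window in which `b` changes by at most `δ / 4`. If `b t > δ`, then `b - a > δ / 2` on the
  -- whole window, so `G` drops by at least `δ / 2 * τ`. This contradicts the convergence of `G`.
  set τ := δ / (4 * M)
  have hτ : 0 < τ := by positivity
  have h1 : Tendsto (fun t => G (t + τ) - G t) atTop (𝓝 0) := by
    simpa using (hG.comp (tendsto_atTop_add_const_right atTop τ tendsto_id)).sub hG
  have h2 : ∀ᶠ t in atTop, -(δ / 2 * τ) < G (t + τ) - G t :=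
    h1.eventually (lt_mem_nhds (neg_neg_of_pos (by positivity)))
  obtain ⟨T, hT⟩ := (ha.eventually (gt_mem_nhds (show 0 < δ / 4 by positivity))).exists_forall_of_atTop
  filter_upwards [h2, eventually_ge_atTop T, eventually_ge_atTop t₀] with t h2 hTt ht0
  by_contra! hbt
  have hmono := le_of_hasDerivAt_nonpos_off_finite (f := fun s => G s + δ / 2 * s) (N := N)
    (show t ≤ t + τ by linarith)
    ((hN (t + τ)).subset (inter_subset_inter_right _ (Icc_subset_Icc_left ht0)))
    ((hcont.mono (Icc_subset_Ici_self.trans (Ici_subset_Ici.2 ht0))).add (by fun_prop))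
    (fun s hs hsN => by
      obtain ⟨G', h3, h4⟩ := hd s (ht0.trans_lt hs.1) hsN
      refine ⟨_, h3.add ((hasDerivAt_id s).const_mul (δ / 2)), ?_⟩
      have h5 := hT s (hTt.trans hs.1.le)
      have h6 := (abs_le.1 (hb t s ht0 hs.1.le)).1
      have h7 : L * (s - t) ≤ M * τ :=
        mul_le_mul ((le_abs_self L).trans (by simp [M])) (by linarith [hs.2])
          (by linarith [hs.1]) hM.le
      have h8 : M * τ = δ / 4 := by simp only [τ]; field_simp
      simp only [mul_one]
      linarith)
  linarith

/-! ### Global solutions for bounded, globally Lipschitz vector fields -/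

theorem exists_forall_hasDerivWithinAt_Ici_of_lipschitz {E : Type*} [NormedAddCommGroup E]
    [NormedSpace ℝ E] [CompleteSpace E] {v : ℝ → E → E} {K L : NNReal} (t₀ : ℝ) (x₀ : E)
    (hlip : ∀ t, LipschitzWith K (v t)) (hcont : ∀ x, Continuous fun t => v t x)
    (hbound : ∀ t x, ‖v t x‖ ≤ L) :
    ∃ z : ℝ → E, z t₀ = x₀ ∧ ∀ t, t₀ ≤ t → HasDerivWithinAt z (v t (z t)) (Ici t₀) t := by
  have hex : ∀ n : ℕ, ∃ z : ℝ → E, z t₀ = x₀ ∧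
      ∀ t ∈ Icc t₀ (t₀ + n), HasDerivWithinAt z (v t (z t)) (Icc t₀ (t₀ + n)) t := by
    intro n
    -- On an interval of length `n` a field bounded by `L` moves a point by at most `L * n`, so a
    -- ball of that radius is never left.
    have hpl : IsPicardLindelof v (tmin := t₀) (tmax := t₀ + n) ⟨t₀, by simp⟩ x₀ (L * n) 0 L K :=
      { lipschitzOnWith := fun t _ => (hlip t).lipschitzOnWith
        continuousOn := fun x _ => (hcont x).continuousOn
        norm_le := fun t _ x _ => hbound t x
        mul_max_le := by simp }
    exact hpl.exists_eq_forall_mem_Icc_hasDerivWithinAt₀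
  choose z hz0 hz using hex
  have huniq : ∀ m n : ℕ, m ≤ n → EqOn (z m) (z n) (Icc t₀ (t₀ + m)) := by
    intro m n hmn
    have hmn' : (m : ℝ) ≤ n := by exact_mod_cast hmn
    have key : ∀ k : ℕ, m ≤ k → ∀ t ∈ Ico t₀ (t₀ + m),
        HasDerivWithinAt (z k) (v t (z k t)) (Ici t) t := by
      intro k hk t ht
      have hk' : (m : ℝ) ≤ k := by exact_mod_cast hk
      refine ((hz k t ⟨ht.1, by linarith [ht.2]⟩).mono (s := Icc t (t₀ + k))
        (Icc_subset_Icc_left ht.1)).mono_of_mem_nhdsWithin ?_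
      exact Icc_mem_nhdsGE (by linarith [ht.2])
    have hc : ∀ k : ℕ, m ≤ k → ContinuousOn (z k) (Icc t₀ (t₀ + m)) := by
      intro k hk t ht
      have hk' : (m : ℝ) ≤ k := by exact_mod_cast hk
      exact (hz k t ⟨ht.1, by linarith [ht.2]⟩).continuousWithinAt.mono
        (Icc_subset_Icc_right (by linarith))
    exact ODE_solution_unique_of_mem_Icc_right (s := fun _ => univ)
      (fun t _ => (hlip t).lipschitzOnWith) (hc m le_rfl) (key m le_rfl) (fun _ _ => mem_univ _)
      (hc n hmn) (key n hmn) (fun _ _ => mem_univ _) ((hz0 m).trans (hz0 n).symm)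
  have hagree : ∀ (n : ℕ) t, t ∈ Icc t₀ (t₀ + n) → z (⌈t - t₀⌉₊ + 1) t = z n t := by
    intro n t ht
    have h1 : t - t₀ ≤ ⌈t - t₀⌉₊ := Nat.le_ceil _
    rcases le_total (⌈t - t₀⌉₊ + 1) n with h | h
    · exact huniq _ _ h ⟨ht.1, by push_cast; linarith⟩
    · exact (huniq _ _ h ht).symm
  refine ⟨fun t => z (⌈t - t₀⌉₊ + 1) t, (hagree 0 t₀ (by simp)).trans (hz0 0), fun t ht => ?_⟩
  obtain ⟨n, hn⟩ := exists_nat_gt (t - t₀)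
  have htn : t < t₀ + n := by linarith
  have h1 := (hz n t ⟨ht, htn.le⟩).congr (fun s hs => hagree n s hs) (hagree n t ⟨ht, htn.le⟩)
  rw [← hagree n t ⟨ht, htn.le⟩] at h1
  refine h1.mono_of_mem_nhdsWithin ?_
  have : Icc t₀ (t₀ + n) = Ici t₀ ∩ Iic (t₀ + n) := rfl
  rw [this]
  exact inter_mem self_mem_nhdsWithin (mem_nhdsWithin_of_mem_nhds (Iic_mem_nhds htn))

noncomputable section

namespace AdaptiveOverride

/-! ### Regularity and structure of the virtual controls -/

section Smoothness

variable {n p : ℕ}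

/-- Joint smoothness in `(x, ρ, ϑ)`. -/
def IsSmooth {F : Type*} [NormedAddCommGroup F] [NormedSpace ℝ F]
    (a : (Fin n → ℝ) → (Fin n → ℝ) → Par p → F) : Prop :=
  ContDiff ℝ ∞ fun q : (Fin n → ℝ) × (Fin n → ℝ) × Par p => a q.1 q.2.1 q.2.2

theorem IsSmooth.partialX {a : ScalarFn n p} (ha : IsSmooth a) (k : Fin n) :
    IsSmooth (partialX a k) := by
  unfold IsSmooth AdaptiveOverride.partialX
  refine ContDiff.clm_apply (ContDiff.fderiv (m := ∞) ?_ contDiff_fst (by simp)) contDiff_const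
  exact ContDiff.comp (g := fun q : (Fin n → ℝ) × (Fin n → ℝ) × Par p => a q.1 q.2.1 q.2.2) ha
    (f := fun z : ((Fin n → ℝ) × (Fin n → ℝ) × Par p) × (Fin n → ℝ) => (z.2, z.1.2.1, z.1.2.2))
    (by fun_prop)

theorem IsSmooth.partialR {a : ScalarFn n p} (ha : IsSmooth a) (k : Fin n) :
    IsSmooth (partialR a k) := by
  unfold IsSmooth AdaptiveOverride.partialR
  refine ContDiff.clm_apply (ContDiff.fderiv (m := ∞) ?_ (by fun_prop) (by simp)) contDiff_const
  exact ContDiff.comp (g := fun q : (Fin n → ℝ) × (Fin n → ℝ) × Par p => a q.1 q.2.1 q.2.2) ha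
    (f := fun z : ((Fin n → ℝ) × (Fin n → ℝ) × Par p) × (Fin n → ℝ) => (z.1.1, z.2, z.1.2.2))
    (by fun_prop)

theorem IsSmooth.gradPar {a : ScalarFn n p} (ha : IsSmooth a) : IsSmooth (gradPar a) := by
  unfold IsSmooth AdaptiveOverride.gradPar gradient
  refine (InnerProductSpace.toDual ℝ (Par p)).symm.toContinuousLinearEquiv.contDiff.comp
    (ContDiff.fderiv (m := ∞) ?_ (by fun_prop) (by simp))
  exact ContDiff.comp (g := fun q : (Fin n → ℝ) × (Fin n → ℝ) × Par p => a q.1 q.2.1 q.2.2) ha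
    (f := fun z : ((Fin n → ℝ) × (Fin n → ℝ) × Par p) × Par p => (z.1.1, z.1.2.1, z.2))
    (by fun_prop)

variable {φ : Fin n → (Fin n → ℝ) → Par p} {D : Design n p}

theorem IsSmooth.wStep (hφ : ∀ i, ContDiff ℝ ∞ (φ i)) {a : ScalarFn n p} (ha : IsSmooth a)
    (i : Fin n) : IsSmooth (wStep φ i a) := by
  unfold IsSmooth AdaptiveOverride.wStep
  refine ((hφ i).comp contDiff_fst).sub (ContDiff.sum fun j _ => ?_)
  exact (ha.partialX j).smul ((hφ j).comp contDiff_fst)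

theorem IsSmooth.errStep {a : ScalarFn n p} (ha : IsSmooth a) (i : Fin n) :
    IsSmooth (errStep i a) := by
  unfold IsSmooth at *
  unfold AdaptiveOverride.errStep
  fun_prop

theorem IsSmooth.sStep (hφ : ∀ i, ContDiff ℝ ∞ (φ i)) {a : ScalarFn n p} (ha : IsSmooth a)
    (i : Fin n) : IsSmooth (sStep φ D i a) := by
  have h1 := ha.wStep hφ i
  have h2 := ha.gradPar
  unfold IsSmooth at *
  unfold AdaptiveOverride.sStep
  exact (contDiff_const.add (contDiff_const.mul (h1.norm_sq ℝ))).add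
    (contDiff_const.mul (h2.norm_sq ℝ))

theorem IsSmooth.driftStep {a : ScalarFn n p} (ha : IsSmooth a) (i : Fin n) :
    IsSmooth (driftStep i a) := by
  unfold IsSmooth AdaptiveOverride.driftStep
  refine ContDiff.sum fun k _ => ContDiff.add ?_ ?_
  · exact (ha.partialX _).mul (by fun_prop)
  · exact (ha.partialR _).mul (by fun_prop)

theorem virtualControl_succ (i : Fin n) (x ρ : Fin n → ℝ) (ϑ : Par p) :
    virtualControl φ D i.succ x ρ ϑ =
      -(sStep φ D i (virtualControl φ D i.castSucc) x ρ ϑ * err φ D i x ρ ϑ)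
        - inner ℝ (wStep φ i (virtualControl φ D i.castSucc) x ρ ϑ) ϑ
        + driftStep i (virtualControl φ D i.castSucc) x ρ ϑ := by
  simp only [virtualControl, err, Fin.induction_succ]

theorem isSmooth_virtualControl (hφ : ∀ i, ContDiff ℝ ∞ (φ i)) (i : Fin (n + 1)) :
    IsSmooth (virtualControl φ D i) := by
  induction i using Fin.induction with
  | zero => exact contDiff_const
  | succ i ih =>
    have h1 : IsSmooth (sStep φ D i (virtualControl φ D i.castSucc)) := ih.sStep hφ i
    have h2 : IsSmooth (err φ D i) := ih.errStep i
    have h3 := ih.wStep hφ i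
    have h4 := ih.driftStep i
    unfold IsSmooth at *
    simp only [virtualControl_succ]
    exact ((h1.mul h2).neg.sub (h3.inner ℝ (by fun_prop))).add h4

/-- `a` depends on `x` and `ρ` only through the coordinates of index less than `m`. -/
def DependsBelow (m : ℕ) {F : Type*} (a : (Fin n → ℝ) → (Fin n → ℝ) → Par p → F) : Prop :=
  ∀ x x' ρ ρ' ϑ, (∀ j : Fin n, (j : ℕ) < m → x j = x' j) →
    (∀ j : Fin n, (j : ℕ) < m → ρ j = ρ' j) → a x ρ ϑ = a x' ρ' ϑ

/-- Replacing `x` by `x'` translates the argument in directions that `a` ignores. The function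
therefore coincides with its own translate, and so does its derivative. -/
theorem DependsBelow.partialX {m : ℕ} {a : ScalarFn n p} (ha : DependsBelow m a) (k : Fin n) :
    DependsBelow m (partialX a k) := by
  intro x x' ρ ρ' ϑ hx hρ
  have : (fun ξ => a ξ ρ ϑ) = fun ξ => (fun ξ => a ξ ρ' ϑ) (ξ + (x' - x)) := by
    funext ξ
    exact ha _ _ _ _ _ (fun j hj => by simp [hx j hj]) hρ
  have h := fderiv_comp_add_right (𝕜 := ℝ) (f := fun ξ => a ξ ρ' ϑ) (x := x) (x' - x)
  simp only [AdaptiveOverride.partialX]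
  rw [this, h, add_sub_cancel]

theorem DependsBelow.partialR {m : ℕ} {a : ScalarFn n p} (ha : DependsBelow m a) (k : Fin n) :
    DependsBelow m (partialR a k) := by
  intro x x' ρ ρ' ϑ hx hρ
  have : (fun ξ => a x ξ ϑ) = fun ξ => (fun ξ => a x' ξ ϑ) (ξ + (ρ' - ρ)) := by
    funext ξ
    exact ha _ _ _ _ _ hx (fun j hj => by simp [hρ j hj])
  have h := fderiv_comp_add_right (𝕜 := ℝ) (f := fun ξ => a x' ξ ϑ) (x := ρ) (ρ' - ρ)
  simp only [AdaptiveOverride.partialR]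
  rw [this, h, add_sub_cancel]

theorem DependsBelow.gradPar {m : ℕ} {a : ScalarFn n p} (ha : DependsBelow m a) :
    DependsBelow m (gradPar a) := by
  intro x x' ρ ρ' ϑ hx hρ
  have : (fun η => a x ρ η) = fun η => a x' ρ' η := funext fun η => ha _ _ _ _ _ hx hρ
  simp only [AdaptiveOverride.gradPar, this]

theorem DependsBelow.mono {m m' : ℕ} (h : m ≤ m') {F : Type*}
    {a : (Fin n → ℝ) → (Fin n → ℝ) → Par p → F} (ha : DependsBelow m a) : DependsBelow m' a :=
  fun x x' ρ ρ' ϑ hx hρ => ha x x' ρ ρ' ϑ (fun j hj => hx j (hj.trans_le h))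
    fun j hj => hρ j (hj.trans_le h)

theorem dependsBelow_virtualControl (hφ : IsStrictFeedback φ) (i : Fin (n + 1)) :
    DependsBelow i (virtualControl φ D i) := by
  induction i using Fin.induction with
  | zero => intro x x' ρ ρ' ϑ _ _; rfl
  | succ i ih =>
    have ih' := ih.mono (m' := (i.succ : Fin (n + 1))) (by simp)
    intro x x' ρ ρ' ϑ hx hρ
    have hX : ∀ j : Fin n, (j : ℕ) ≤ i → x j = x' j := fun j hj =>
      hx j (by simpa using Nat.lt_succ_of_le hj)
    have hR : ∀ j : Fin n, (j : ℕ) ≤ i → ρ j = ρ' j := fun j hj =>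
      hρ j (by simpa using Nat.lt_succ_of_le hj)
    have hP : ∀ j ≤ i, φ j x = φ j x' := fun j hj =>
      hφ.strict j x x' fun l hl => hX l (hl.trans hj)
    have hw : wStep φ i (virtualControl φ D i.castSucc) x ρ ϑ =
        wStep φ i (virtualControl φ D i.castSucc) x' ρ' ϑ := by
      simp only [wStep]
      rw [hP i le_rfl]
      congr 1
      refine Finset.sum_congr rfl fun j hj => ?_
      rw [hP j (Finset.mem_Iio.1 hj).le, ih'.partialX j x x' ρ ρ' ϑ hx hρ]
    have he : err φ D i x ρ ϑ = err φ D i x' ρ' ϑ := by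
      simp only [err, errStep]
      rw [hX i le_rfl, hR i le_rfl, ih' x x' ρ ρ' ϑ hx hρ]
    have hs : sStep φ D i (virtualControl φ D i.castSucc) x ρ ϑ =
        sStep φ D i (virtualControl φ D i.castSucc) x' ρ' ϑ := by
      simp only [sStep]
      rw [hw, ih'.gradPar x x' ρ ρ' ϑ hx hρ]
    have hd : driftStep i (virtualControl φ D i.castSucc) x ρ ϑ =
        driftStep i (virtualControl φ D i.castSucc) x' ρ' ϑ := by
      simp only [driftStep]
      refine Finset.sum_congr rfl fun k _ => ?_
      rw [ih'.partialX _ x x' ρ ρ' ϑ hx hρ, ih'.partialR _ x x' ρ ρ' ϑ hx hρ,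
        hX _ (show (k : ℕ) + 1 ≤ i from k.2), hR _ (show (k : ℕ) + 1 ≤ i from k.2)]
    rw [virtualControl_succ, virtualControl_succ, hw, he, hs, hd]

theorem fderiv_single_eq_zero {f : (Fin n → ℝ) → ℝ} {x : Fin n → ℝ} {k : Fin n}
    (hf : DifferentiableAt ℝ f x) (hc : ∀ s : ℝ, f (x + s • Pi.single k 1) = f x) :
    fderiv ℝ f x (Pi.single k 1) = 0 := by
  rw [← hf.lineDeriv_eq_fderiv]
  simp [lineDeriv, hc]

theorem IsSmooth.differentiable_left {a : ScalarFn n p} (ha : IsSmooth a) (ρ : Fin n → ℝ)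
    (ϑ : Par p) : Differentiable ℝ fun ξ => a ξ ρ ϑ :=
  (ContDiff.comp (g := fun q : (Fin n → ℝ) × (Fin n → ℝ) × Par p => a q.1 q.2.1 q.2.2) ha
    (f := fun ξ : Fin n → ℝ => (ξ, ρ, ϑ)) (by fun_prop)).differentiable (by simp)

theorem IsSmooth.differentiable_mid {a : ScalarFn n p} (ha : IsSmooth a) (x : Fin n → ℝ)
    (ϑ : Par p) : Differentiable ℝ fun ξ => a x ξ ϑ :=
  (ContDiff.comp (g := fun q : (Fin n → ℝ) × (Fin n → ℝ) × Par p => a q.1 q.2.1 q.2.2) ha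
    (f := fun ξ : Fin n → ℝ => (x, ξ, ϑ)) (by fun_prop)).differentiable (by simp)

theorem partialX_eq_zero {m : ℕ} {a : ScalarFn n p} (ha : IsSmooth a) (hm : DependsBelow m a)
    {k : Fin n} (hk : m ≤ k) (x ρ : Fin n → ℝ) (ϑ : Par p) : partialX a k x ρ ϑ = 0 :=
  fderiv_single_eq_zero (ha.differentiable_left ρ ϑ x) fun s =>
    hm _ _ _ _ _ (fun j hj => by
      have : j ≠ k := fun h => by subst h; omega
      simp [this]) fun _ _ => rfl

theorem partialR_eq_zero {m : ℕ} {a : ScalarFn n p} (ha : IsSmooth a) (hm : DependsBelow m a)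
    {k : Fin n} (hk : m ≤ k) (x ρ : Fin n → ℝ) (ϑ : Par p) : partialR a k x ρ ϑ = 0 :=
  fderiv_single_eq_zero (ha.differentiable_mid x ϑ ρ) fun s =>
    hm _ _ _ _ _ (fun _ _ => rfl) fun j hj => by
      have : j ≠ k := fun h => by subst h; omega
      simp [this]

theorem clm_apply_eq_sum_single (f : (Fin n → ℝ) →L[ℝ] ℝ) (v : Fin n → ℝ) :
    f v = ∑ k, f (Pi.single k 1) * v k := by
  conv_lhs => rw [pi_eq_sum_univ' v]
  rw [map_sum]
  refine Finset.sum_congr rfl fun k _ => ?_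
  rw [map_smul, smul_eq_mul, mul_comm]

/-- The chain rule along curves, in terms of the partial derivatives. -/
theorem hasDerivAt_of_isSmooth {a : ScalarFn n p} (ha : IsSmooth a) {x ρ : ℝ → Fin n → ℝ}
    {ϑ : ℝ → Par p} {x' ρ' : Fin n → ℝ} {ϑ' : Par p} {t : ℝ} (hx : HasDerivAt x x' t)
    (hρ : HasDerivAt ρ ρ' t) (hϑ : HasDerivAt ϑ ϑ' t) :
    HasDerivAt (fun s => a (x s) (ρ s) (ϑ s))
      (∑ k, partialX a k (x t) (ρ t) (ϑ t) * x' k + ∑ k, partialR a k (x t) (ρ t) (ϑ t) * ρ' k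
        + inner ℝ (gradPar a (x t) (ρ t) (ϑ t)) ϑ') t := by
  set F := fun q : (Fin n → ℝ) × (Fin n → ℝ) × Par p => a q.1 q.2.1 q.2.2
  have hF : HasFDerivAt F (fderiv ℝ F (x t, ρ t, ϑ t)) (x t, ρ t, ϑ t) :=
    (ContDiff.differentiable ha (by simp) _).hasFDerivAt
  set F' := fderiv ℝ F (x t, ρ t, ϑ t)
  have h := hF.comp_hasDerivAt t (hx.prodMk (hρ.prodMk hϑ))
  refine h.congr_deriv ?_
  have hsplit : (x', ρ', ϑ') = (x', (0 : Fin n → ℝ), (0 : Par p)) +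
      ((0 : Fin n → ℝ), ρ', (0 : Par p)) + ((0 : Fin n → ℝ), (0 : Fin n → ℝ), ϑ') := by simp
  rw [hsplit, map_add, map_add]
  congr 1
  · congr 1
    · have h1 : HasFDerivAt (fun ξ => a ξ (ρ t) (ϑ t))
          (F'.comp (ContinuousLinearMap.inl ℝ (Fin n → ℝ) ((Fin n → ℝ) × Par p))) (x t) :=
        HasFDerivAt.comp (g := F) (f := fun ξ => (ξ, ρ t, ϑ t)) (x t) hF
          (hasFDerivAt_prodMk_left _ _)
      simp only [AdaptiveOverride.partialX, h1.fderiv]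
      rw [← clm_apply_eq_sum_single]
      rfl
    · have h1 : HasFDerivAt (fun ξ => a (x t) ξ (ϑ t))
          (F'.comp ((ContinuousLinearMap.inr ℝ (Fin n → ℝ) ((Fin n → ℝ) × Par p)).comp
            (ContinuousLinearMap.inl ℝ (Fin n → ℝ) (Par p)))) (ρ t) :=
        HasFDerivAt.comp (g := F) (f := fun ξ => (x t, ξ, ϑ t)) (ρ t) hF
          ((hasFDerivAt_prodMk_right (x t) (ρ t, ϑ t)).comp (ρ t)
            (hasFDerivAt_prodMk_left _ _))
      simp only [AdaptiveOverride.partialR, h1.fderiv]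
      rw [← clm_apply_eq_sum_single]
      rfl
  · have h1 : HasFDerivAt (fun η => a (x t) (ρ t) η)
        (F'.comp ((ContinuousLinearMap.inr ℝ (Fin n → ℝ) ((Fin n → ℝ) × Par p)).comp
          (ContinuousLinearMap.inr ℝ (Fin n → ℝ) (Par p)))) (ϑ t) :=
      HasFDerivAt.comp (g := F) (f := fun η => (x t, ρ t, η)) (ϑ t) hF
        ((hasFDerivAt_prodMk_right (x t) (ρ t, ϑ t)).comp (ϑ t)
          (hasFDerivAt_prodMk_right _ _))
    simp only [AdaptiveOverride.gradPar, gradient, h1.fderiv]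
    rw [InnerProductSpace.toDual_symm_apply]
    rfl

theorem sum_univ_eq_sum_fin (i : Fin n) (G : Fin n → ℝ) (h : ∀ j : Fin n, (i : ℕ) ≤ j → G j = 0) :
    ∑ j, G j = ∑ k : Fin (i : ℕ), G ⟨k, k.2.trans i.2⟩ := by
  symm
  refine Fintype.sum_of_injective (fun k : Fin (i : ℕ) => (⟨k, k.2.trans i.2⟩ : Fin n))
    (fun a b hab => ?_) _ _ (fun j hj => h j ?_) fun _ => rfl
  · simpa [Fin.ext_iff] using hab
  · by_contra! hlt
    exact hj ⟨⟨j, hlt⟩, rfl⟩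

theorem IsSmooth.continuous {F : Type*} [NormedAddCommGroup F] [NormedSpace ℝ F]
    {a : (Fin n → ℝ) → (Fin n → ℝ) → Par p → F} (ha : IsSmooth a) :
    Continuous fun q : (Fin n → ℝ) × (Fin n → ℝ) × Par p => a q.1 q.2.1 q.2.2 :=
  ContDiff.continuous ha

theorem exists_bound_of_continuous {X : Type*} [NormedAddCommGroup X] [ProperSpace X]
    {F : Type*} [NormedAddCommGroup F] {f : X → F} (hf : Continuous f) (R : ℝ) :
    ∃ B, 0 ≤ B ∧ ∀ q, ‖q‖ ≤ R → ‖f q‖ ≤ B := by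
  obtain ⟨B, hB⟩ := (isCompact_closedBall (0 : X) R).exists_bound_of_continuousOn hf.continuousOn
  exact ⟨max B 0, le_max_right _ _, fun q hq => (hB q (by simpa using hq)).trans (le_max_left _ _)⟩

/-- The state is recovered from the error coordinates in a bounded fashion. -/
theorem exists_state_bound_of_err_bound (hφ : IsStrictFeedback φ) (H : ℝ) :
    ∃ B, 0 ≤ B ∧ ∀ (x ρ : Fin n → ℝ) (ϑ : Par p), (∀ i, |err φ D i x ρ ϑ| ≤ H) → ‖ρ‖ ≤ H → ‖ϑ‖ ≤ H →
      ‖x‖ ≤ B := by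
  have key : ∀ m : ℕ, m ≤ n → ∃ B, 0 ≤ B ∧ ∀ (x ρ : Fin n → ℝ) (ϑ : Par p),
      (∀ i, |err φ D i x ρ ϑ| ≤ H) → ‖ρ‖ ≤ H → ‖ϑ‖ ≤ H → ∀ j : Fin n, (j : ℕ) < m → |x j| ≤ B := by
    intro m
    induction m with
    | zero => exact fun _ => ⟨0, le_rfl, fun _ _ _ _ _ _ j hj => absurd hj (by simp)⟩
    | succ m ih =>
      intro hm
      obtain ⟨B, hB0, hB⟩ := ih (by omega)
      set i : Fin n := ⟨m, hm⟩
      obtain ⟨C, hC0, hC⟩ := exists_bound_of_continuous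
        (isSmooth_virtualControl (D := D) hφ.smooth i.castSucc).continuous (max B H)
      refine ⟨max B (H + C + H), hB0.trans (le_max_left _ _), fun x ρ ϑ hh hρ hϑ j hj => ?_⟩
      have hxb := hB x ρ ϑ hh hρ hϑ
      rcases Nat.lt_succ_iff_lt_or_eq.1 hj with hj | hj
      · exact (hxb j hj).trans (le_max_left _ _)
      · have hji : j = i := Fin.ext hj
        subst hji
        -- The coordinates not yet bounded are set to zero. The virtual control does not see them,
        -- and its whole argument now lies in a fixed compact ball.
        set x' : Fin n → ℝ := fun k => if (k : ℕ) < m then x k else 0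
        have hx' : ‖x'‖ ≤ B := by
          refine (pi_norm_le_iff_of_nonneg hB0).2 fun k => ?_
          by_cases hk : (k : ℕ) < m
          · simpa [x', hk] using hxb k hk
          · simpa [x', hk] using hB0
        have h1 : virtualControl φ D i.castSucc x ρ ϑ = virtualControl φ D i.castSucc x' ρ ϑ :=
          dependsBelow_virtualControl hφ i.castSucc _ _ _ _ _
            (fun k hk => by
              have : (k : ℕ) < m := hk
              simp [x', this]) fun _ _ => rfl
        have h2 : |virtualControl φ D i.castSucc x' ρ ϑ| ≤ C := by
          refine hC (x', ρ, ϑ) ?_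
          simp only [Prod.norm_def, sup_le_iff]
          exact ⟨hx'.trans (le_max_left _ _), hρ.trans (le_max_right _ _),
            hϑ.trans (le_max_right _ _)⟩
        have h3 := hh i
        have h4 : |ρ i| ≤ H := (norm_le_pi_norm ρ i).trans hρ
        simp only [err, errStep] at h3
        rw [h1] at h3
        refine le_trans ?_ (le_max_right _ _)
        rw [abs_le] at *
        constructor <;> linarith
  obtain ⟨B, hB0, hB⟩ := key n le_rfl
  exact ⟨B, hB0, fun x ρ ϑ hh hρ hϑ => (pi_norm_le_iff_of_nonneg hB0).2 fun j =>
    hB x ρ ϑ hh hρ hϑ j j.2⟩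

end Smoothness

/-! ### Matrix calculus -/

section MatrixCalculus

theorem hasDerivAt_dotProduct {m : Type*} [Fintype m] {v w : ℝ → m → ℝ} {v' w' : m → ℝ} {t : ℝ}
    (hv : HasDerivAt v v' t) (hw : HasDerivAt w w' t) :
    HasDerivAt (fun s => v s ⬝ᵥ w s) (v' ⬝ᵥ w t + v t ⬝ᵥ w') t := by
  rw [hasDerivAt_pi] at hv hw
  simp only [dotProduct, ← Finset.sum_add_distrib]
  exact HasDerivAt.fun_sum fun i _ => (hv i).mul (hw i)

theorem hasDerivAt_mulVec {m k : Type*} [Fintype m] [Fintype k] {M : ℝ → Matrix m k ℝ}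
    {M' : Matrix m k ℝ} {v : ℝ → k → ℝ} {v' : k → ℝ} {t : ℝ}
    (hM : ∀ i j, HasDerivAt (fun s => M s i j) (M' i j) t) (hv : HasDerivAt v v' t) :
    HasDerivAt (fun s => M s *ᵥ v s) (M' *ᵥ v t + M t *ᵥ v') t :=
  hasDerivAt_pi.2 fun i => hasDerivAt_dotProduct (hasDerivAt_pi.2 (hM i)) hv

theorem hasDerivAt_quadForm {m : Type*} [Fintype m] (Q : Matrix m m ℝ) {v : ℝ → m → ℝ}
    {v' : m → ℝ} {t : ℝ} (hv : HasDerivAt v v' t) :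
    HasDerivAt (fun s => v s ⬝ᵥ Q *ᵥ v s) (v' ⬝ᵥ Q *ᵥ v t + v t ⬝ᵥ Q *ᵥ v') t := by
  have h := hasDerivAt_mulVec (M := fun _ => Q) (M' := 0) (fun _ _ => hasDerivAt_const _ _) hv
  simpa using hasDerivAt_dotProduct hv h

theorem posDef_dotProduct_mulVec_comm {m : Type*} [Fintype m] {Q : Matrix m m ℝ}
    (hQ : Q.PosDef) (v w : m → ℝ) : v ⬝ᵥ Q *ᵥ w = (Q *ᵥ v) ⬝ᵥ w := by
  have h : Qᵀ = Q := by simpa using hQ.isHermitian.eq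
  rw [Matrix.dotProduct_mulVec, ← Matrix.mulVec_transpose, h]

/-- Extreme values on the unit sphere, extended by homogeneity. The norm is the supremum norm, so
even the identity matrix needs constants here. -/
theorem exists_quadForm_bounds {m : Type*} [Fintype m] [DecidableEq m] {Q : Matrix m m ℝ}
    (hQ : Q.PosDef) : ∃ l L : ℝ, 0 < l ∧ 0 < L ∧
      ∀ v : m → ℝ, l * ‖v‖ ^ 2 ≤ v ⬝ᵥ Q *ᵥ v ∧ v ⬝ᵥ Q *ᵥ v ≤ L * ‖v‖ ^ 2 := by
  have hcont : Continuous fun v : m → ℝ => v ⬝ᵥ Q *ᵥ v := by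
    simp only [dotProduct, Matrix.mulVec]
    fun_prop
  have hK : IsCompact (Metric.sphere (0 : m → ℝ) 1) := isCompact_sphere _ _
  have hscale : ∀ v : m → ℝ, v ≠ 0 → ∃ w ∈ Metric.sphere (0 : m → ℝ) 1,
      v ⬝ᵥ Q *ᵥ v = w ⬝ᵥ Q *ᵥ w * ‖v‖ ^ 2 := by
    intro v hv
    have hv' : ‖v‖ ≠ 0 := norm_ne_zero_iff.2 hv
    refine ⟨‖v‖⁻¹ • v, by simp [norm_smul, hv'], ?_⟩
    simp only [Matrix.mulVec_smul, smul_dotProduct, dotProduct_smul, smul_eq_mul]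
    field_simp
  -- The sphere is empty exactly when the space is trivial, which happens for an empty index type
  -- such as `Fin 0` when `p = 0`.
  rcases (Metric.sphere (0 : m → ℝ) 1).eq_empty_or_nonempty with hE | hE
  · have h0 : ∀ v : m → ℝ, v = 0 := by
      intro v
      by_contra hv
      obtain ⟨w, hw, -⟩ := hscale v hv
      rw [hE] at hw
      exact hw
    refine ⟨1, 1, one_pos, one_pos, fun v => ?_⟩
    rw [h0 v]
    simp
  · obtain ⟨w, hw, hmin⟩ := hK.exists_isMinOn hE hcont.continuousOn
    obtain ⟨w', hw', hmax⟩ := hK.exists_isMaxOn hE hcont.continuousOn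
    have hpos : ∀ w ∈ Metric.sphere (0 : m → ℝ) 1, 0 < w ⬝ᵥ Q *ᵥ w := by
      intro w hw
      have : w ≠ 0 := by
        rintro rfl
        simp at hw
      simpa using hQ.dotProduct_mulVec_pos this
    refine ⟨_, _, hpos w hw, hpos w' hw', fun v => ?_⟩
    by_cases hv : v = 0
    · simp [hv]
    · obtain ⟨z, hz, hzv⟩ := hscale v hv
      rw [hzv]
      exact ⟨mul_le_mul_of_nonneg_right (hmin hz) (by positivity),
        mul_le_mul_of_nonneg_right (hmax hz) (by positivity)⟩

theorem dotProduct_self_nonneg_real {m : Type*} [Fintype m] (v : m → ℝ) : 0 ≤ v ⬝ᵥ v :=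
  Finset.sum_nonneg fun i _ => mul_self_nonneg (v i)

theorem two_mul_dotProduct_le {m : Type*} [Fintype m] (v w : m → ℝ) :
    2 * v ⬝ᵥ w ≤ v ⬝ᵥ v + w ⬝ᵥ w := by
  have h := dotProduct_self_nonneg_real (v - w)
  simp only [sub_dotProduct, dotProduct_sub, dotProduct_comm w v] at h
  linarith

/-- Young's inequality, from expanding `|2 s v - w|² ≥ 0`. The weight is chosen to match the term `2
σ |F P v|²` produced by the filter damping. -/
theorem two_mul_dotProduct_le_weighted {m : Type*} [Fintype m] (v w : m → ℝ) {s : ℝ} (hs : 0 < s) :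
    2 * v ⬝ᵥ w ≤ 2 * s * v ⬝ᵥ v + 1 / (2 * s) * w ⬝ᵥ w := by
  have h := dotProduct_self_nonneg_real ((2 * s) • v - w)
  simp only [sub_dotProduct, dotProduct_sub, smul_dotProduct, dotProduct_smul, smul_eq_mul,
    dotProduct_comm w v] at h
  have h2 : 2 * s * v ⬝ᵥ v + 1 / (2 * s) * w ⬝ᵥ w - 2 * v ⬝ᵥ w =
      1 / (2 * s) * (2 * s * (2 * s * v ⬝ᵥ v - v ⬝ᵥ w) - (2 * s * v ⬝ᵥ w - w ⬝ᵥ w)) := by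
    field_simp
    ring
  have h3 : 0 ≤ 1 / (2 * s) * (2 * s * (2 * s * v ⬝ᵥ v - v ⬝ᵥ w) -
      (2 * s * v ⬝ᵥ w - w ⬝ᵥ w)) := mul_nonneg (by positivity) h
  linarith

end MatrixCalculus

/-! ### Closed-loop dynamics at a time without jump -/

section Dynamics

variable {n p : ℕ} {φ : Fin n → (Fin n → ℝ) → Par p} {θ : Par p} {D : Design n p}
  {r : ℕ → ℝ → ℝ} {S : Trajectory n p} {t : ℝ}

/-- The closed-loop equations hold at the interior time `t`. -/
structure DynamicsAt (φ : Fin n → (Fin n → ℝ) → Par p) (θ : Par p) (D : Design n p)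
    (r : ℕ → ℝ → ℝ) (S : Trajectory n p) (t : ℝ) : Prop where
  plant : HasDerivAt S.x
    (shiftField (S.x t) (S.control φ D r t) + (regressor φ (S.x t))ᵀ *ᵥ θ.ofLp) t
  filter : ∀ i j, HasDerivAt (fun s => (S.Ω s)ᵀ i j)
    ((filterMatrix φ D (S.x t) * (S.Ω t)ᵀ + (regressor φ (S.x t))ᵀ) i j) t
  filter₀ : HasDerivAt S.Ω₀
    (filterMatrix φ D (S.x t) *ᵥ (S.Ω₀ t + S.x t) - shiftField (S.x t) (S.control φ D r t)) t
  update : HasDerivAt S.θhat (S.updateLaw D t) t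
  ref : HasDerivAt (refVec n r) (fun k => r (k + 1) t) t

/-- The jump times of the highest reference derivative. -/
def jumps (n : ℕ) (r : ℕ → ℝ → ℝ) : Set ℝ := {t | ¬ ContinuousWithinAt (r n) (Ici 0) t}

theorem IsBoundarySignal.finite_jumps (hr : IsBoundarySignal n r) {a : ℝ} (ha : 0 ≤ a) (b : ℝ) :
    (jumps n r ∩ Icc a b).Finite :=
  (hr.piecewise.finite_disc b).subset fun _ h => ⟨⟨ha.trans h.2.1, h.2.2⟩, h.1⟩

theorem IsBoundarySignal.hasDerivAt_refVec (hr : IsBoundarySignal n r) (ht : 0 < t)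
    (htN : t ∉ jumps n r) : HasDerivAt (refVec n r) (fun k => r (k + 1) t) t := by
  have hmem : Ici (0 : ℝ) ∈ 𝓝 t := Ici_mem_nhds ht
  refine hasDerivAt_pi.2 fun k => ?_
  by_cases hk : (k : ℕ) + 1 < n
  · exact (hr.hasDeriv k hk t ht.le).hasDerivAt hmem
  · have h1 : (k : ℕ) = n - 1 := by omega
    have h2 : (k : ℕ) + 1 = n := by omega
    simp only [refVec, h2]
    rw [h1]
    exact (hr.hasDeriv_last t ht.le (not_not.1 htN)).hasDerivAt hmem

theorem IsBoundarySignal.continuousOn_refVec (hr : IsBoundarySignal n r) :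
    ContinuousOn (refVec n r) (Ici 0) := by
  refine continuousOn_pi.2 fun k => ?_
  by_cases hk : (k : ℕ) + 1 < n
  · exact fun t ht => (hr.hasDeriv k hk t ht).continuousWithinAt
  · have h1 : (k : ℕ) = n - 1 := by omega
    simp only [refVec, h1]
    exact hr.continuous_pred

theorem Trajectory.IsSolution.mono {J J' : Set ℝ} (h : S.IsSolution φ θ D r J) (hJ : J' ⊆ J) :
    S.IsSolution φ θ D r J' where
  x_cont := h.x_cont.mono hJ
  Ω_cont := h.Ω_cont.mono hJ
  Ω₀_cont := h.Ω₀_cont.mono hJ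
  θhat_cont := h.θhat_cont.mono hJ
  plant t ht hc := (h.plant t (hJ ht) hc).mono hJ
  filter t ht hc i j := (h.filter t (hJ ht) hc i j).mono hJ
  filter₀ t ht hc := (h.filter₀ t (hJ ht) hc).mono hJ
  update t ht hc := (h.update t (hJ ht) hc).mono hJ

theorem Trajectory.IsSolution.dynamicsAt {a b : ℝ} (hr : IsBoundarySignal n r) (ha : 0 ≤ a)
    (h : S.IsSolution φ θ D r (Icc a b)) (ht : t ∈ Ioo a b) (htN : t ∉ jumps n r) :
    DynamicsAt φ θ D r S t := by
  have hmem : Icc a b ∈ 𝓝 t := Icc_mem_nhds ht.1 ht.2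
  have hm := Ioo_subset_Icc_self ht
  have hc := not_not.1 htN
  exact
    { plant := (h.plant t hm hc).hasDerivAt hmem
      filter := fun i j => (h.filter t hm hc i j).hasDerivAt hmem
      filter₀ := (h.filter₀ t hm hc).hasDerivAt hmem
      update := (h.update t hm hc).hasDerivAt hmem
      ref := hr.hasDerivAt_refVec (ha.trans_lt ht.1) htN }

theorem inner_eq_dotProduct (v w : Par p) : inner ℝ v w = v.ofLp ⬝ᵥ w.ofLp := by
  simp [PiLp.inner_apply, dotProduct, mul_comm]

theorem regressor_transpose_mulVec (x : Fin n → ℝ) (v : Par p) (i : Fin n) :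
    ((regressor φ x)ᵀ *ᵥ v.ofLp) i = inner ℝ (φ i x) v := by
  rw [inner_eq_dotProduct]
  rfl

namespace Trajectory

/-- The error coordinate following `hᵢ`, which is `0` for the last one. -/
def hNext (φ : Fin n → (Fin n → ℝ) → Par p) (D : Design n p) (r : ℕ → ℝ → ℝ)
    (S : Trajectory n p) (i : Fin n) (t : ℝ) : ℝ :=
  if hi : (i : ℕ) + 1 < n then S.h φ D r ⟨i + 1, hi⟩ t else 0

/-- The nonlinear gain `sᵢ` along a trajectory. -/
def gain (φ : Fin n → (Fin n → ℝ) → Par p) (D : Design n p) (r : ℕ → ℝ → ℝ)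
    (S : Trajectory n p) (i : Fin n) (t : ℝ) : ℝ :=
  sStep φ D i (virtualControl φ D i.castSucc) (S.x t) (refVec n r t) (S.θhat t)

/-- The regressor `wᵢ` along a trajectory. -/
def w (φ : Fin n → (Fin n → ℝ) → Par p) (D : Design n p) (r : ℕ → ℝ → ℝ)
    (S : Trajectory n p) (i : Fin n) (t : ℝ) : Par p :=
  wStep φ i (virtualControl φ D i.castSucc) (S.x t) (refVec n r t) (S.θhat t)

/-- The sensitivity `∂αᵢ₋₁/∂θ̂` along a trajectory. -/
def q (φ : Fin n → (Fin n → ℝ) → Par p) (D : Design n p) (r : ℕ → ℝ → ℝ)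
    (S : Trajectory n p) (i : Fin n) (t : ℝ) : Par p :=
  gradPar (virtualControl φ D i.castSucc) (S.x t) (refVec n r t) (S.θhat t)

/-- The estimation error `x + Ω₀ - Ωᵀ θ` for the true parameter. -/
def εTrue (θ : Par p) (S : Trajectory n p) (t : ℝ) : Fin n → ℝ :=
  S.x t + S.Ω₀ t - (S.Ω t)ᵀ *ᵥ θ.ofLp

/-- The parametric part `Ωᵀ θ̃` of the estimation error. -/
def η (θ : Par p) (S : Trajectory n p) (t : ℝ) : Fin n → ℝ :=
  (S.Ω t)ᵀ *ᵥ (θ - S.θhat t).ofLp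

theorem ε_eq (θ : Par p) (S : Trajectory n p) (t : ℝ) : S.ε t = S.εTrue θ t + S.η θ t := by
  simp only [ε, εTrue, η, WithLp.ofLp_sub, Matrix.mulVec_sub]
  abel

theorem control_eq_virtualControl_succ (i : Fin n) (hi : ¬ (i : ℕ) + 1 < n) :
    S.control φ D r t =
      virtualControl φ D i.succ (S.x t) (refVec n r t) (S.θhat t) + r (i + 1) t := by
  have h1 : (i : ℕ) + 1 = n := by omega
  have h2 : Fin.last n = i.succ := by ext; simp [h1]
  rw [control, h2, h1]

/-- For `i < n` this is the definition of the next error coordinate. For the last index the control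
is chosen so that the residual vanishes, in agreement with the default value `0` of `hNext`. -/
theorem shiftField_sub_virtualControl (i : Fin n) :
    shiftField (S.x t) (S.control φ D r t) i
      - virtualControl φ D i.succ (S.x t) (refVec n r t) (S.θhat t) - r (i + 1) t =
      S.hNext φ D r i t := by
  by_cases hi : (i : ℕ) + 1 < n
  · simp only [shiftField, hNext, hi, dif_pos, h, err, errStep, refVec]
    rfl
  · simp only [shiftField, hNext, hi, dif_neg, not_false_eq_true]
    rw [control_eq_virtualControl_succ i hi]
    ring

end Trajectory

namespace DynamicsAt

/-- The error system `ḣᵢ = -sᵢ hᵢ + hᵢ₊₁ + wᵢᵀ θ̃ - (∂αᵢ₋₁/∂θ̂) dθ̂/dt`. -/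
theorem hasDerivAt_h (hφ : IsStrictFeedback φ) (H : DynamicsAt φ θ D r S t) (i : Fin n) :
    HasDerivAt (S.h φ D r i)
      (-(S.gain φ D r i t * S.h φ D r i t) + S.hNext φ D r i t
        + inner ℝ (S.w φ D r i t) (θ - S.θhat t) - inner ℝ (S.q φ D r i t) (S.updateLaw D t)) t := by
  set a := virtualControl φ D i.castSucc with ha_def
  have ha : IsSmooth a := isSmooth_virtualControl hφ.smooth _
  have hdep : DependsBelow (i : ℕ) a := dependsBelow_virtualControl hφ i.castSucc
  have hda := hasDerivAt_of_isSmooth ha H.plant H.ref H.update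
  have hx := hasDerivAt_pi.1 H.plant i
  have hρ := hasDerivAt_pi.1 H.ref i
  refine ((hx.sub hda).sub hρ).congr_deriv ?_
  -- Partial derivatives with index at least `i` vanish, so the full chain-rule sums shrink to the
  -- known drift compensated by the controller and the part linear in the unknown `θ`.
  have hX : ∑ k, partialX a k (S.x t) (refVec n r t) (S.θhat t) *
      (shiftField (S.x t) (S.control φ D r t) + (regressor φ (S.x t))ᵀ *ᵥ θ.ofLp) k
      + ∑ k, partialR a k (S.x t) (refVec n r t) (S.θhat t) * r (k + 1) t
      = driftStep i a (S.x t) (refVec n r t) (S.θhat t)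
        + ∑ j ∈ Finset.Iio i, partialX a j (S.x t) (refVec n r t) (S.θhat t) *
            inner ℝ (φ j (S.x t)) θ := by
    simp only [Pi.add_apply, regressor_transpose_mulVec, mul_add, Finset.sum_add_distrib]
    have h1 : ∑ j ∈ Finset.Iio i, partialX a j (S.x t) (refVec n r t) (S.θhat t) *
        inner ℝ (φ j (S.x t)) θ = ∑ j, partialX a j (S.x t) (refVec n r t) (S.θhat t) *
        inner ℝ (φ j (S.x t)) θ := by
      refine Finset.sum_subset (Finset.subset_univ _) fun j _ hj => ?_
      rw [partialX_eq_zero ha hdep (by simpa using hj), zero_mul]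
    rw [h1, driftStep, Finset.sum_add_distrib,
      sum_univ_eq_sum_fin i (fun k => partialX a k (S.x t) (refVec n r t) (S.θhat t) *
        shiftField (S.x t) (S.control φ D r t) k)
        (fun j hj => by rw [partialX_eq_zero ha hdep hj, zero_mul]),
      sum_univ_eq_sum_fin i (fun k => partialR a k (S.x t) (refVec n r t) (S.θhat t) *
        r (k + 1) t) (fun j hj => by rw [partialR_eq_zero ha hdep hj, zero_mul])]
    have h2 : ∀ k : Fin (i : ℕ), shiftField (S.x t) (S.control φ D r t)
        ⟨k, k.2.trans i.2⟩ = S.x t ⟨k + 1, Nat.lt_of_le_of_lt k.2 i.2⟩ := fun k => by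
      have : (k : ℕ) + 1 < n := Nat.lt_of_le_of_lt k.2 i.2
      simp [shiftField, this]
    simp only [h2, refVec]
    ring
  have hw : inner ℝ (S.w φ D r i t) θ = inner ℝ (φ i (S.x t)) θ -
      ∑ j ∈ Finset.Iio i, partialX a j (S.x t) (refVec n r t) (S.θhat t) *
        inner ℝ (φ j (S.x t)) θ := by
    simp only [Trajectory.w, wStep, inner_sub_left, sum_inner, inner_smul_left, ← ha_def]
    simp
  have hv := virtualControl_succ (φ := φ) (D := D) i (S.x t) (refVec n r t) (S.θhat t)
  have hs := Trajectory.shiftField_sub_virtualControl (φ := φ) (D := D) (r := r) (S := S) (t := t) i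
  rw [← ha_def] at hv
  rw [hX, ← hs, hv, inner_sub_right, hw]
  simp only [Pi.add_apply, regressor_transpose_mulVec, Trajectory.gain, Trajectory.h,
    Trajectory.w, Trajectory.q, ← ha_def]
  ring

theorem hasDerivAt_Ω_transpose_mulVec (H : DynamicsAt φ θ D r S t) (v : Fin p → ℝ) :
    HasDerivAt (fun s => (S.Ω s)ᵀ *ᵥ v)
      (filterMatrix φ D (S.x t) *ᵥ ((S.Ω t)ᵀ *ᵥ v) + (regressor φ (S.x t))ᵀ *ᵥ v) t := by
  have h := hasDerivAt_mulVec (M := fun s => (S.Ω s)ᵀ) H.filter (hasDerivAt_const t v)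
  simpa [Matrix.add_mulVec, Matrix.mulVec_mulVec] using h

/-- The field `f` cancels between plant and `Ω₀`, and `Fᵀθ` cancels between plant and `Ωᵀθ`. What
remains is homogeneous, even though `θ` is unknown. -/
theorem hasDerivAt_εTrue (H : DynamicsAt φ θ D r S t) :
    HasDerivAt (S.εTrue θ) (filterMatrix φ D (S.x t) *ᵥ S.εTrue θ t) t := by
  refine ((H.plant.add H.filter₀).sub (H.hasDerivAt_Ω_transpose_mulVec θ.ofLp)).congr_deriv ?_
  simp only [Trajectory.εTrue, Matrix.mulVec_sub, Matrix.mulVec_add]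
  abel

theorem hasDerivAt_θhat (H : DynamicsAt φ θ D r S t) :
    HasDerivAt (fun s => (S.θhat s).ofLp) (S.updateLaw D t).ofLp t :=
  (PiLp.continuousLinearEquiv 2 ℝ fun _ : Fin p => ℝ).toContinuousLinearMap.hasFDerivAt.comp_hasDerivAt
    t H.update

theorem hasDerivAt_θtilde (H : DynamicsAt φ θ D r S t) :
    HasDerivAt (fun s => (θ - S.θhat s).ofLp) (-(S.updateLaw D t).ofLp) t := by
  simpa using H.hasDerivAt_θhat.const_sub θ.ofLp

theorem hasDerivAt_η (H : DynamicsAt φ θ D r S t) :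
    HasDerivAt (S.η θ) (filterMatrix φ D (S.x t) *ᵥ S.η θ t
      + (regressor φ (S.x t))ᵀ *ᵥ (θ - S.θhat t).ofLp
      - (S.Ω t)ᵀ *ᵥ (S.updateLaw D t).ofLp) t := by
  have h := hasDerivAt_mulVec (M := fun s => (S.Ω s)ᵀ) H.filter H.hasDerivAt_θtilde
  refine h.congr_deriv ?_
  simp [Matrix.add_mulVec, Matrix.mulVec_mulVec, Trajectory.η, Matrix.mulVec_neg, sub_eq_add_neg]

end DynamicsAt

/-- The Lyapunov identity for the filter dynamics. -/
theorem quadForm_filter_deriv (D : Design n p) (x : Fin n → ℝ) (v : Fin n → ℝ) (e : Fin p → ℝ) :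
    (filterMatrix φ D x *ᵥ v + (regressor φ x)ᵀ *ᵥ e) ⬝ᵥ D.P *ᵥ v
      + v ⬝ᵥ D.P *ᵥ (filterMatrix φ D x *ᵥ v + (regressor φ x)ᵀ *ᵥ e) =
    -(v ⬝ᵥ v) - 2 * D.σ * (regressor φ x *ᵥ D.P *ᵥ v) ⬝ᵥ (regressor φ x *ᵥ D.P *ᵥ v)
      + 2 * (regressor φ x *ᵥ D.P *ᵥ v) ⬝ᵥ e := by
  set G := regressor φ x
  set u := G *ᵥ D.P *ᵥ v with hu
  -- With `u = F P v`, the filter damping acts as the input `-σ u` through the same matrix `Fᵀ` as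
  -- `e`, and this channel pairs with `P v` to give `u`.
  have h1 : filterMatrix φ D x *ᵥ v + Gᵀ *ᵥ e =
      stableMatrix D.c *ᵥ v + Gᵀ *ᵥ (e - D.σ • u) := by
    simp only [filterMatrix, Matrix.sub_mulVec, Matrix.smul_mulVec, Matrix.mulVec_sub,
      Matrix.mulVec_smul, hu, Matrix.mulVec_mulVec, Matrix.mul_assoc]
    abel
  have h2 : ∀ y : Fin p → ℝ, (Gᵀ *ᵥ y) ⬝ᵥ D.P *ᵥ v = u ⬝ᵥ y := fun y => by
    rw [Matrix.mulVec_transpose, ← Matrix.dotProduct_mulVec, dotProduct_comm]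
  have h3 : (stableMatrix D.c *ᵥ v) ⬝ᵥ D.P *ᵥ v + v ⬝ᵥ D.P *ᵥ (stableMatrix D.c *ᵥ v) =
      -(v ⬝ᵥ v) := by
    have h4 : (stableMatrix D.c *ᵥ v) ⬝ᵥ D.P *ᵥ v =
        v ⬝ᵥ ((stableMatrix D.c)ᵀ * D.P) *ᵥ v := by
      rw [← Matrix.mulVec_mulVec, Matrix.dotProduct_mulVec v, Matrix.vecMul_transpose]
    rw [h4, Matrix.mulVec_mulVec, ← dotProduct_add, ← Matrix.add_mulVec, D.lyapunov]
    simp [Matrix.neg_mulVec]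
  have h5 : v ⬝ᵥ D.P *ᵥ (Gᵀ *ᵥ (e - D.σ • u)) = u ⬝ᵥ (e - D.σ • u) := by
    rw [posDef_dotProduct_mulVec_comm D.P_posDef, dotProduct_comm, h2]
  rw [h1, add_dotProduct, Matrix.mulVec_add, dotProduct_add, h2, h5]
  simp only [dotProduct_sub, dotProduct_smul, smul_eq_mul]
  linarith

/-- The normalization `1 + ν |Ω|²`. -/
def Trajectory.normalizer (D : Design n p) (S : Trajectory n p) (t : ℝ) : ℝ :=
  1 + D.ν * frobNorm (S.Ω t) ^ 2

theorem Trajectory.one_le_normalizer : 1 ≤ S.normalizer D t := by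
  have := mul_nonneg D.ν_nonneg (sq_nonneg (frobNorm (S.Ω t)))
  unfold normalizer
  linarith

theorem Trajectory.ofLp_updateLaw : (S.updateLaw D t).ofLp =
    (S.normalizer D t)⁻¹ • (D.Γ *ᵥ (S.Ω t *ᵥ S.ε t)) := rfl

namespace DynamicsAt

theorem exists_hasDerivAt_εTrue_quadForm (H : DynamicsAt φ θ D r S t) :
    ∃ V', HasDerivAt (fun s => S.εTrue θ s ⬝ᵥ D.P *ᵥ S.εTrue θ s) V' t ∧
      V' ≤ -(S.εTrue θ t ⬝ᵥ S.εTrue θ t) := by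
  refine ⟨_, hasDerivAt_quadForm D.P H.hasDerivAt_εTrue, ?_⟩
  have h := quadForm_filter_deriv (φ := φ) D (S.x t) (S.εTrue θ t) 0
  simp only [Matrix.mulVec_zero, add_zero, dotProduct_zero, mul_zero] at h
  rw [h]
  have h1 := mul_nonneg D.σ_pos.le (dotProduct_self_nonneg_real
    (regressor φ (S.x t) *ᵥ D.P *ᵥ S.εTrue θ t))
  linarith

/-- The term `-2 σ |F P v|²` absorbs the cross term with the forcing. The constant left over does
not involve `F(x)`, so the filter is bounded before anything is known about `x`. -/
theorem exists_hasDerivAt_Ω_quadForm (H : DynamicsAt φ θ D r S t) (v : Fin p → ℝ) :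
    ∃ V', HasDerivAt (fun s => ((S.Ω s)ᵀ *ᵥ v) ⬝ᵥ D.P *ᵥ ((S.Ω s)ᵀ *ᵥ v)) V' t ∧
      V' ≤ -(((S.Ω t)ᵀ *ᵥ v) ⬝ᵥ ((S.Ω t)ᵀ *ᵥ v)) + 1 / (2 * D.σ) * v ⬝ᵥ v := by
  refine ⟨_, hasDerivAt_quadForm D.P (H.hasDerivAt_Ω_transpose_mulVec v), ?_⟩
  rw [quadForm_filter_deriv]
  have h1 := two_mul_dotProduct_le_weighted
    (regressor φ (S.x t) *ᵥ D.P *ᵥ ((S.Ω t)ᵀ *ᵥ v)) v D.σ_pos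
  linarith

/-- The weight `Γ⁻¹` cancels the adaptation matrix in the update law, and `θ̃ᵀ Ω ε = ηᵀ ε`. -/
theorem hasDerivAt_θtilde_quadForm (H : DynamicsAt φ θ D r S t) :
    HasDerivAt (fun s => (θ - S.θhat s).ofLp ⬝ᵥ D.Γ⁻¹ *ᵥ (θ - S.θhat s).ofLp)
      (-((S.normalizer D t)⁻¹ * (2 * S.η θ t ⬝ᵥ S.ε t))) t := by
  refine (hasDerivAt_quadForm D.Γ⁻¹ H.hasDerivAt_θtilde).congr_deriv ?_
  have hu : IsUnit D.Γ.det := (Matrix.isUnit_iff_isUnit_det _).1 D.Γ_posDef.isUnit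
  have h1 : D.Γ⁻¹ *ᵥ (S.updateLaw D t).ofLp = (S.normalizer D t)⁻¹ • (S.Ω t *ᵥ S.ε t) := by
    rw [Trajectory.ofLp_updateLaw, Matrix.mulVec_smul, Matrix.mulVec_mulVec,
      Matrix.nonsing_inv_mul _ hu, Matrix.one_mulVec]
  have h2 : (θ - S.θhat t).ofLp ⬝ᵥ (S.Ω t *ᵥ S.ε t) = S.η θ t ⬝ᵥ S.ε t := by
    rw [Matrix.dotProduct_mulVec, ← Matrix.mulVec_transpose, Trajectory.η]
  rw [posDef_dotProduct_mulVec_comm D.Γ_posDef.inv, Matrix.mulVec_neg, neg_dotProduct,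
    dotProduct_neg, h1, dotProduct_smul, h2]
  simp only [smul_dotProduct, dotProduct_comm (S.Ω t *ᵥ S.ε t), h2, smul_eq_mul]
  ring

/-- The Lyapunov function of the estimator decreases along trajectories. -/
theorem exists_hasDerivAt_estimator (H : DynamicsAt φ θ D r S t) :
    ∃ U', HasDerivAt (fun s => (θ - S.θhat s).ofLp ⬝ᵥ D.Γ⁻¹ *ᵥ (θ - S.θhat s).ofLp
      + S.εTrue θ s ⬝ᵥ D.P *ᵥ S.εTrue θ s) U' t ∧
      U' ≤ -((S.normalizer D t)⁻¹ * S.ε t ⬝ᵥ S.ε t) := by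
  obtain ⟨V', hV, hV'⟩ := H.exists_hasDerivAt_εTrue_quadForm
  refine ⟨_, H.hasDerivAt_θtilde_quadForm.add hV, ?_⟩
  -- Then `-2 η·ε = -2|ε|² + 2 εTrue·ε ≤ -|ε|² + |εTrue|²`. The normalizer is at least `1`, so the
  -- last term is absorbed by the dissipation of the `P`-energy.
  have h1 : S.η θ t = S.ε t - S.εTrue θ t := by rw [S.ε_eq θ]; abel
  have h2 := two_mul_dotProduct_le (S.εTrue θ t) (S.ε t)
  have h3 : (1 : ℝ) ≤ S.normalizer D t := Trajectory.one_le_normalizer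
  have h4 : 0 ≤ (S.normalizer D t)⁻¹ := by positivity
  have h5 : (S.normalizer D t)⁻¹ ≤ 1 := inv_le_one_of_one_le₀ h3
  have h6 := dotProduct_self_nonneg_real (S.εTrue θ t)
  have h7 := mul_le_mul_of_nonneg_left h2 h4
  have h8 := mul_le_mul_of_nonneg_right h5 h6
  rw [h1, sub_dotProduct]
  linarith

end DynamicsAt

end Dynamics

/-! ### Uniform boundedness of the closed-loop signals -/

section Boundedness

variable {n p : ℕ} {φ : Fin n → (Fin n → ℝ) → Par p} {θ : Par p} {D : Design n p}
  {r : ℕ → ℝ → ℝ} {S : Trajectory n p} {R : ℝ}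

/-- The closed-loop state space, with the entrywise norm on the filter matrix. -/
abbrev State (n p : ℕ) := (Fin n → ℝ) × (Fin p → Fin n → ℝ) × (Fin n → ℝ) × Par p

/-- The closed-loop state. -/
def Trajectory.state (S : Trajectory n p) (t : ℝ) : State n p := (S.x t, S.Ω t, S.Ω₀ t, S.θhat t)

theorem Trajectory.IsSolution.continuousOn_state {J : Set ℝ} (h : S.IsSolution φ θ D r J) :
    ContinuousOn S.state J :=
  h.x_cont.prodMk (ContinuousOn.prodMk h.Ω_cont (h.Ω₀_cont.prodMk h.θhat_cont))

theorem continuous_frobNorm : Continuous fun M : Fin p → Fin n → ℝ => frobNorm (n := n) (p := p) M := by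
  unfold frobNorm
  fun_prop

theorem abs_entry_le_frobNorm (M : Matrix (Fin p) (Fin n) ℝ) (j : Fin p) (i : Fin n) :
    |M j i| ≤ frobNorm M := by
  refine Real.abs_le_sqrt ?_
  calc M j i ^ 2 ≤ ∑ i, M j i ^ 2 :=
        Finset.single_le_sum (f := fun i => M j i ^ 2) (fun _ _ => sq_nonneg _) (Finset.mem_univ i)
    _ ≤ ∑ j, ∑ i, M j i ^ 2 :=
        Finset.single_le_sum (f := fun j => ∑ i, M j i ^ 2)
          (fun _ _ => Finset.sum_nonneg fun _ _ => sq_nonneg _) (Finset.mem_univ j)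

theorem Trajectory.StateBound.norm_state_le {t : ℝ} (h : S.StateBound R t) : ‖S.state t‖ ≤ R := by
  have hR : 0 ≤ R := (norm_nonneg _).trans h.1
  simp only [Trajectory.state, Prod.norm_def, sup_le_iff]
  refine ⟨h.1, ?_, h.2.2.1, h.2.2.2⟩
  exact (pi_norm_le_iff_of_nonneg hR).2 fun j => (pi_norm_le_iff_of_nonneg hR).2 fun i =>
    (abs_entry_le_frobNorm _ j i).trans h.2.1

theorem IsBoundarySignal.exists_norm_refVec_le (hr : IsBoundarySignal n r) :
    ∃ M, 0 ≤ M ∧ (∀ t, 0 ≤ t → ‖refVec n r t‖ ≤ M) ∧ ∀ t, 0 ≤ t → |r n t| ≤ M := by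
  obtain ⟨M, hM⟩ := hr.bounded
  have hM0 : 0 ≤ M := (abs_nonneg _).trans (hM n le_rfl 0 le_rfl)
  exact ⟨M, hM0, fun t ht => (pi_norm_le_iff_of_nonneg hM0).2 fun k => hM k k.2.le t ht,
    fun t ht => hM n le_rfl t ht⟩

/-- A quantity is bounded along all solutions with initial state of size at most `R`. -/
def UnifBdd (φ : Fin n → (Fin n → ℝ) → Par p) (θ : Par p) (D : Design n p) (r : ℕ → ℝ → ℝ)
    (R : ℝ) {F : Type*} [NormedAddCommGroup F] (f : Trajectory n p → ℝ → F) : Prop :=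
  ∃ B, 0 ≤ B ∧ ∀ (t₀ b : ℝ) (S : Trajectory n p), 0 ≤ t₀ → t₀ ≤ b →
    S.IsSolution φ θ D r (Icc t₀ b) → S.StateBound R t₀ → ‖f S b‖ ≤ B

section UnifBdd

variable {F G : Type*} [NormedAddCommGroup F] [NormedAddCommGroup G]

theorem UnifBdd.prodMk {f : Trajectory n p → ℝ → F} {g : Trajectory n p → ℝ → G}
    (hf : UnifBdd φ θ D r R f) (hg : UnifBdd φ θ D r R g) :
    UnifBdd φ θ D r R fun S t => (f S t, g S t) := by
  obtain ⟨B, hB0, hB⟩ := hf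
  obtain ⟨C, hC0, hC⟩ := hg
  refine ⟨max B C, hB0.trans (le_max_left _ _), fun t₀ b S h1 h2 h3 h4 => ?_⟩
  exact max_le_max (hB t₀ b S h1 h2 h3 h4) (hC t₀ b S h1 h2 h3 h4)

theorem UnifBdd.comp [ProperSpace F] {f : Trajectory n p → ℝ → F} {g : F → G}
    (hf : UnifBdd φ θ D r R f) (hg : Continuous g) :
    UnifBdd φ θ D r R fun S t => g (f S t) := by
  obtain ⟨B, -, hB⟩ := hf
  obtain ⟨C, hC0, hC⟩ := exists_bound_of_continuous hg B
  exact ⟨C, hC0, fun t₀ b S h1 h2 h3 h4 => hC _ (hB t₀ b S h1 h2 h3 h4)⟩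

theorem exists_initial_bound (hr : IsBoundarySignal n r) {g : State n p × (Fin n → ℝ) → F}
    (hg : Continuous g) (R : ℝ) : ∃ B, 0 ≤ B ∧ ∀ (t₀ : ℝ) (S : Trajectory n p), 0 ≤ t₀ →
      S.StateBound R t₀ → ‖g (S.state t₀, refVec n r t₀)‖ ≤ B := by
  obtain ⟨M, -, hM, -⟩ := hr.exists_norm_refVec_le
  obtain ⟨C, hC0, hC⟩ := exists_bound_of_continuous hg (max R M)
  exact ⟨C, hC0, fun t₀ S h1 h2 => hC _ (max_le_max h2.norm_state_le (hM t₀ h1))⟩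

end UnifBdd

theorem unifBdd_refVec (hr : IsBoundarySignal n r) :
    UnifBdd φ θ D r R fun _ t => refVec n r t := by
  obtain ⟨M, hM0, hM, -⟩ := hr.exists_norm_refVec_le
  exact ⟨M, hM0, fun t₀ b _ h1 h2 _ _ => hM b (h1.trans h2)⟩

theorem continuous_εTrueFn (θ : Par p) : Continuous fun z : State n p =>
    z.1 + z.2.2.1 - (Matrix.of z.2.1)ᵀ *ᵥ θ.ofLp := by
  refine (continuous_fst.add (by fun_prop)).sub (continuous_pi fun i => ?_)
  simp only [Matrix.mulVec, dotProduct, Matrix.transpose_apply, Matrix.of_apply]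
  fun_prop

theorem continuous_transpose_mulVec : Continuous fun z : (Fin p → Fin n → ℝ) × (Fin p → ℝ) =>
    (Matrix.of z.1)ᵀ *ᵥ z.2 := by
  refine continuous_pi fun i => ?_
  simp only [Matrix.mulVec, dotProduct, Matrix.transpose_apply, Matrix.of_apply]
  fun_prop

theorem continuous_quadForm {m : Type*} [Fintype m] (Q : Matrix m m ℝ) :
    Continuous fun v : m → ℝ => v ⬝ᵥ Q *ᵥ v := by
  simp only [dotProduct, Matrix.mulVec]
  fun_prop

theorem Trajectory.IsSolution.continuousOn_εTrue {J : Set ℝ} (h : S.IsSolution φ θ D r J) :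
    ContinuousOn (S.εTrue θ) J :=
  (continuous_εTrueFn θ).comp_continuousOn h.continuousOn_state

theorem Trajectory.IsSolution.continuousOn_Ω_transpose_mulVec {J : Set ℝ}
    (h : S.IsSolution φ θ D r J) (v : Fin p → ℝ) :
    ContinuousOn (fun s => (S.Ω s)ᵀ *ᵥ v) J :=
  continuous_transpose_mulVec.comp_continuousOn (ContinuousOn.prodMk h.Ω_cont continuousOn_const)

theorem continuous_ofLp_sub (θ : Par p) : Continuous fun ϑ : Par p => (θ - ϑ).ofLp := by
  fun_prop

theorem Trajectory.IsSolution.continuousOn_θtilde {J : Set ℝ} (h : S.IsSolution φ θ D r J) :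
    ContinuousOn (fun s => (θ - S.θhat s).ofLp) J :=
  (continuous_ofLp_sub θ).comp_continuousOn h.θhat_cont

theorem Trajectory.IsSolution.continuousOn_h (hφ : IsStrictFeedback φ) (hr : IsBoundarySignal n r)
    {J : Set ℝ} (hJ : J ⊆ Ici 0) (h : S.IsSolution φ θ D r J) (i : Fin n) :
    ContinuousOn (S.h φ D r i) J :=
  ((isSmooth_virtualControl hφ.smooth _).errStep i).continuous.comp_continuousOn
    (h.x_cont.prodMk ((hr.continuousOn_refVec.mono hJ).prodMk h.θhat_cont))

/-! ### Bounds on the estimator and the filter, independent of the plant state. -/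

theorem exists_quadForm_le_sq {m : Type*} [Fintype m] [DecidableEq m] {Q : Matrix m m ℝ}
    (hQ : Q.PosDef) (C : ℝ) :
    ∃ B, 0 ≤ B ∧ ∀ v : m → ℝ, v ⬝ᵥ Q *ᵥ v ≤ C → ‖v‖ ≤ B := by
  obtain ⟨l, L, hl, -, h⟩ := exists_quadForm_bounds hQ
  refine ⟨√(C / l), Real.sqrt_nonneg _, fun v hv => Real.le_sqrt_of_sq_le ?_⟩
  rw [le_div_iff₀ hl]
  linarith [(h v).1]

theorem Trajectory.IsSolution.εTrue_quadForm_le (hr : IsBoundarySignal n r) {t₀ b : ℝ}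
    (h0 : 0 ≤ t₀) (hb : t₀ ≤ b) (hS : S.IsSolution φ θ D r (Icc t₀ b)) :
    S.εTrue θ b ⬝ᵥ D.P *ᵥ S.εTrue θ b ≤ S.εTrue θ t₀ ⬝ᵥ D.P *ᵥ S.εTrue θ t₀ := by
  refine le_of_hasDerivAt_nonpos_off_finite (f := fun s => S.εTrue θ s ⬝ᵥ D.P *ᵥ S.εTrue θ s)
    hb (hr.finite_jumps h0 b) ((continuous_quadForm D.P).comp_continuousOn hS.continuousOn_εTrue)
    fun t ht htN => ?_
  obtain ⟨V', hV, hV'⟩ := (hS.dynamicsAt hr h0 ht htN).exists_hasDerivAt_εTrue_quadForm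
  exact ⟨V', hV, hV'.trans (neg_nonpos.2 (dotProduct_self_nonneg_real _))⟩

theorem unifBdd_εTrue (hr : IsBoundarySignal n r) :
    UnifBdd φ θ D r R fun S t => S.εTrue θ t := by
  obtain ⟨C, hC0, hC⟩ := exists_initial_bound hr
    (((continuous_quadForm D.P).comp (continuous_εTrueFn θ)).comp continuous_fst) R
  obtain ⟨B, hB0, hB⟩ := exists_quadForm_le_sq D.P_posDef C
  refine ⟨B, hB0, fun t₀ b S h1 h2 h3 h4 => hB _ ?_⟩
  exact (h3.εTrue_quadForm_le hr h1 h2).trans ((le_abs_self _).trans (hC t₀ S h1 h4))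

/-- The Lyapunov function of the estimator. -/
def Trajectory.estimatorEnergy (θ : Par p) (D : Design n p) (S : Trajectory n p) (t : ℝ) : ℝ :=
  (θ - S.θhat t).ofLp ⬝ᵥ D.Γ⁻¹ *ᵥ (θ - S.θhat t).ofLp + S.εTrue θ t ⬝ᵥ D.P *ᵥ S.εTrue θ t

theorem Trajectory.IsSolution.continuousOn_estimatorEnergy {J : Set ℝ}
    (hS : S.IsSolution φ θ D r J) : ContinuousOn (S.estimatorEnergy θ D) J :=
  ((continuous_quadForm D.Γ⁻¹).comp_continuousOn hS.continuousOn_θtilde).add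
    ((continuous_quadForm D.P).comp_continuousOn hS.continuousOn_εTrue)

theorem Trajectory.IsSolution.estimatorEnergy_le (hr : IsBoundarySignal n r) {t₀ b : ℝ}
    (h0 : 0 ≤ t₀) (hb : t₀ ≤ b) (hS : S.IsSolution φ θ D r (Icc t₀ b)) :
    S.estimatorEnergy θ D b ≤ S.estimatorEnergy θ D t₀ := by
  refine le_of_hasDerivAt_nonpos_off_finite hb (hr.finite_jumps h0 b)
    hS.continuousOn_estimatorEnergy fun t ht htN => ?_
  obtain ⟨V', hV, hV'⟩ := (hS.dynamicsAt hr h0 ht htN).exists_hasDerivAt_estimator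
  refine ⟨V', hV, hV'.trans (neg_nonpos.2 (mul_nonneg (inv_nonneg.2 ?_)
    (dotProduct_self_nonneg_real _)))⟩
  exact zero_le_one.trans Trajectory.one_le_normalizer

theorem unifBdd_θtilde (hr : IsBoundarySignal n r) :
    UnifBdd φ θ D r R fun S t => (θ - S.θhat t).ofLp := by
  have hcont : Continuous fun z : State n p × (Fin n → ℝ) =>
      (θ - z.1.2.2.2).ofLp ⬝ᵥ D.Γ⁻¹ *ᵥ (θ - z.1.2.2.2).ofLp +
        (z.1.1 + z.1.2.2.1 - (Matrix.of z.1.2.1)ᵀ *ᵥ θ.ofLp) ⬝ᵥ D.P *ᵥ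
          (z.1.1 + z.1.2.2.1 - (Matrix.of z.1.2.1)ᵀ *ᵥ θ.ofLp) :=
    ((continuous_quadForm D.Γ⁻¹).comp ((continuous_ofLp_sub θ).comp (by fun_prop))).add
      (((continuous_quadForm D.P).comp (continuous_εTrueFn θ)).comp continuous_fst)
  obtain ⟨C, hC0, hC⟩ := exists_initial_bound hr hcont R
  obtain ⟨B, hB0, hB⟩ := exists_quadForm_le_sq D.Γ_posDef.inv C
  refine ⟨B, hB0, fun t₀ b S h1 h2 h3 h4 => hB _ ?_⟩
  have h5 := (h3.estimatorEnergy_le hr h1 h2).trans ((le_abs_self _).trans (hC t₀ S h1 h4))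
  obtain ⟨l, L, hl, -, hP⟩ := exists_quadForm_bounds D.P_posDef
  have h6 := (hP (S.εTrue θ b)).1
  have h7 : 0 ≤ l * ‖S.εTrue θ b‖ ^ 2 := by positivity
  unfold Trajectory.estimatorEnergy at h5
  linarith

theorem unifBdd_θhat (hr : IsBoundarySignal n r) : UnifBdd φ θ D r R fun S t => S.θhat t := by
  have h : Continuous fun v : Fin p → ℝ => θ - WithLp.toLp 2 v := by fun_prop
  simpa using (unifBdd_θtilde (θ := θ) (φ := φ) (D := D) (R := R) hr).comp h

theorem unifBdd_Ω_transpose_mulVec (hr : IsBoundarySignal n r) (v : Fin p → ℝ) :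
    UnifBdd φ θ D r R fun S t => (S.Ω t)ᵀ *ᵥ v := by
  obtain ⟨l, L, hl, hL, hP⟩ := exists_quadForm_bounds D.P_posDef
  -- The identity form compares the dot product, in which the dissipation is expressed, with the
  -- supremum norm.
  obtain ⟨l₁, L₁, hl₁, -, h1⟩ := exists_quadForm_bounds
    (Matrix.PosDef.one : (1 : Matrix (Fin n) (Fin n) ℝ).PosDef)
  have hcont : Continuous fun z : State n p × (Fin n → ℝ) =>
      ((Matrix.of z.1.2.1)ᵀ *ᵥ v) ⬝ᵥ D.P *ᵥ ((Matrix.of z.1.2.1)ᵀ *ᵥ v) :=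
    (continuous_quadForm D.P).comp (continuous_transpose_mulVec.comp
      (f := fun z : State n p × (Fin n → ℝ) => (z.1.2.1, v)) (by fun_prop))
  obtain ⟨C, hC0, hC⟩ := exists_initial_bound hr hcont R
  set e := 1 / (2 * D.σ) * v ⬝ᵥ v
  -- `C` covers the initial value. Above the other level `‖Ωᵀv‖² > e / l₁`, so the dissipation
  -- exceeds the constant forcing `e`.
  set K := max C (L * (e / l₁))
  obtain ⟨B, hB0, hB⟩ := exists_quadForm_le_sq D.P_posDef K
  refine ⟨B, hB0, fun t₀ b S h2 h3 h4 h5 => hB _ (sub_nonpos.1 ?_)⟩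
  refine nonpos_of_hasDerivAt_nonpos_of_pos
    (y := fun s => ((S.Ω s)ᵀ *ᵥ v) ⬝ᵥ D.P *ᵥ ((S.Ω s)ᵀ *ᵥ v) - K) h3 (hr.finite_jumps h2 b)
    (((continuous_quadForm D.P).comp_continuousOn (h4.continuousOn_Ω_transpose_mulVec v)).sub
      continuousOn_const)
    (sub_nonpos.2 (((le_abs_self _).trans (hC t₀ S h2 h5)).trans (le_max_left _ _)))
    fun t ht htN hpos => ?_
  obtain ⟨V', hV, hV'⟩ := (h4.dynamicsAt hr h2 ht htN).exists_hasDerivAt_Ω_quadForm v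
  refine ⟨V', hV.sub_const K, hV'.trans ?_⟩
  set y := (S.Ω t)ᵀ *ᵥ v
  have h6 : L * (e / l₁) < L * ‖y‖ ^ 2 :=
    (le_max_right _ _).trans_lt ((sub_pos.1 hpos).trans_le (hP y).2)
  have h7 : e / l₁ < ‖y‖ ^ 2 := lt_of_mul_lt_mul_left h6 hL.le
  rw [div_lt_iff₀ hl₁] at h7
  have h8 := (h1 y).1
  rw [Matrix.one_mulVec] at h8
  linarith

theorem unifBdd_Ω (hr : IsBoundarySignal n r) :
    UnifBdd (F := Fin p → Fin n → ℝ) φ θ D r R fun S t => S.Ω t := by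
  -- Testing `Ωᵀ` against the basis vectors yields the rows of `Ω`.
  choose B hB0 hB using fun j : Fin p =>
    unifBdd_Ω_transpose_mulVec (φ := φ) (θ := θ) (D := D) (R := R) hr (Pi.single j 1)
  have hsum : ∀ j, B j ≤ ∑ j, B j := fun j =>
    Finset.single_le_sum (fun j _ => hB0 j) (Finset.mem_univ j)
  have hs0 : 0 ≤ ∑ j, B j := Finset.sum_nonneg fun j _ => hB0 j
  refine ⟨∑ j, B j, hs0, fun t₀ b S h1 h2 h3 h4 => ?_⟩
  refine (pi_norm_le_iff_of_nonneg hs0).2 fun j => (hsum j).trans' ?_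
  have := hB j t₀ b S h1 h2 h3 h4
  beta_reduce at this
  rwa [Matrix.mulVec_single_one] at this

theorem unifBdd_η (hr : IsBoundarySignal n r) : UnifBdd φ θ D r R fun S t => S.η θ t :=
  ((unifBdd_Ω hr).prodMk (unifBdd_θtilde hr)).comp continuous_transpose_mulVec

theorem unifBdd_ε (hr : IsBoundarySignal n r) : UnifBdd φ θ D r R fun S t => S.ε t := by
  have h := ((unifBdd_εTrue (φ := φ) (θ := θ) (D := D) (R := R) hr).prodMk (unifBdd_η hr)).comp
    (g := fun z : (Fin n → ℝ) × (Fin n → ℝ) => z.1 + z.2) (by fun_prop)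
  simpa only [← Trajectory.ε_eq] using h

theorem continuous_updateLawFn (D : Design n p) :
    Continuous fun z : (Fin p → Fin n → ℝ) × (Fin n → ℝ) =>
      (1 + D.ν * frobNorm (n := n) (p := p) z.1 ^ 2)⁻¹ •
        WithLp.toLp 2 (D.Γ *ᵥ ((Matrix.of z.1) *ᵥ z.2)) := by
  have h1 : Continuous fun z : (Fin p → Fin n → ℝ) × (Fin n → ℝ) =>
      1 + D.ν * frobNorm (n := n) (p := p) z.1 ^ 2 :=
    continuous_const.add (continuous_const.mul ((continuous_frobNorm.comp continuous_fst).pow 2))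
  have h2 : Continuous fun z : (Fin p → Fin n → ℝ) × (Fin n → ℝ) =>
      D.Γ *ᵥ ((Matrix.of z.1) *ᵥ z.2) := by
    refine continuous_pi fun i => ?_
    simp only [Matrix.mulVec, dotProduct, Matrix.of_apply]
    fun_prop
  have h3 : Continuous fun z : (Fin p → Fin n → ℝ) × (Fin n → ℝ) =>
      (WithLp.toLp 2 (D.Γ *ᵥ ((Matrix.of z.1) *ᵥ z.2)) : Par p) :=
    (PiLp.continuous_toLp 2 _).comp h2
  refine Continuous.smul (h1.inv₀ fun z => ?_) h3
  have := mul_nonneg D.ν_nonneg (sq_nonneg (frobNorm (n := n) (p := p) z.1))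
  linarith

theorem unifBdd_updateLaw (hr : IsBoundarySignal n r) :
    UnifBdd φ θ D r R fun S t => S.updateLaw D t :=
  ((unifBdd_Ω hr).prodMk (unifBdd_ε hr)).comp (continuous_updateLawFn D)

/-- Nonlinear damping dominates the perturbation terms. -/
theorem add_le_damping_mul {c κ g a d w q s : ℝ} (hc : 0 < c) (hκ : 0 < κ) (hg : 0 < g)
    (ha : 0 ≤ a) (hd : 0 ≤ d) (hs : c + κ * w ^ 2 + g * q ^ 2 ≤ s) :
    w * a + q * d ≤ s * (a / (2 * √(c * κ)) + d / (2 * √(c * g))) := by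
  -- From `(√c - √k z)² ≥ 0` one gets `2√(ck) z ≤ c + k z²`. The two perturbation terms are compared
  -- separately with the full gain `s`, so the same `c` serves both.
  have key : ∀ {k z y b : ℝ}, 0 < k → 0 ≤ b → c + k * z ^ 2 ≤ y →
      z * b ≤ y * (b / (2 * √(c * k))) := by
    intro k z y b hk hb hy
    have h1 : 0 < √(c * k) := Real.sqrt_pos.2 (mul_pos hc hk)
    have h2 : 2 * √(c * k) * z ≤ y := by
      have h3 := sq_nonneg (√c - √k * z)
      have h4 := Real.sq_sqrt hc.le
      have h5 := Real.sq_sqrt hk.le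
      rw [Real.sqrt_mul hc.le]
      nlinarith
    have h3 := mul_le_mul_of_nonneg_right h2 hb
    rw [mul_div_assoc', le_div_iff₀ (by positivity)]
    linarith
  have h1 : 0 ≤ κ * w ^ 2 := by positivity
  have h2 : 0 ≤ g * q ^ 2 := by positivity
  have h3 := key (z := w) (y := s) hκ ha (by linarith)
  have h4 := key (z := q) (y := s) hg hd (by linarith)
  linarith

theorem abs_perturbation_le {w q u v : Par p} {c κ g a d s : ℝ} (hc : 0 < c) (hκ : 0 < κ)
    (hg : 0 < g) (hu : ‖u‖ ≤ a) (hv : ‖v‖ ≤ d) (hs : c + κ * ‖w‖ ^ 2 + g * ‖q‖ ^ 2 ≤ s) :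
    |inner ℝ w u - inner ℝ q v| ≤ s * (a / (2 * √(c * κ)) + d / (2 * √(c * g))) := by
  have h1 := (abs_real_inner_le_norm w u).trans (mul_le_mul_of_nonneg_left hu (norm_nonneg w))
  have h2 := (abs_real_inner_le_norm q v).trans (mul_le_mul_of_nonneg_left hv (norm_nonneg q))
  have h3 := add_le_damping_mul hc hκ hg ((norm_nonneg u).trans hu) ((norm_nonneg v).trans hv) hs
  exact (abs_sub _ _).trans (by linarith)

theorem Trajectory.c_le_gain (i : Fin n) (t : ℝ) : D.c i ≤ S.gain φ D r i t := by
  have h1 := D.κ_pos i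
  have h2 := D.g_pos i
  unfold gain sStep
  have h3 : 0 ≤ D.κ i * ‖wStep φ i (virtualControl φ D i.castSucc) (S.x t) (refVec n r t)
    (S.θhat t)‖ ^ 2 := by positivity
  have h4 : 0 ≤ D.g i * ‖gradPar (virtualControl φ D i.castSucc) (S.x t) (refVec n r t)
    (S.θhat t)‖ ^ 2 := by positivity
  linarith

/-- The perturbation may be unbounded a priori, but its quotient by the gain is not; the next
coordinate is divided by a gain that is at least `cᵢ`. Hence the restoring term `sᵢ hᵢ` wins outside
a fixed interval. -/
theorem unifBdd_h_of_hNext (hφ : IsStrictFeedback φ) (hr : IsBoundarySignal n r) (i : Fin n)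
    (hnext : UnifBdd φ θ D r R fun S t => S.hNext φ D r i t) :
    UnifBdd φ θ D r R fun S t => S.h φ D r i t := by
  obtain ⟨C₁, hC₁0, hC₁⟩ := hnext
  obtain ⟨d, hd0, hd⟩ := unifBdd_updateLaw (φ := φ) (θ := θ) (D := D) (R := R) hr
  obtain ⟨a, ha0, ha⟩ := (unifBdd_θhat (φ := φ) (θ := θ) (D := D) (R := R) hr).comp
    (g := fun ϑ => θ - ϑ) (by fun_prop)
  have hcont : Continuous fun z : State n p × (Fin n → ℝ) => err φ D i z.1.1 z.2 z.1.2.2.2 :=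
    ((isSmooth_virtualControl hφ.smooth _).errStep i).continuous.comp
      (f := fun z : State n p × (Fin n → ℝ) => (z.1.1, z.2, z.1.2.2.2)) (by fun_prop)
  obtain ⟨C₀, hC₀0, hC₀⟩ := exists_initial_bound hr hcont R
  have hc := D.c_pos i
  set m := a / (2 * √(D.c i * D.κ i)) + d / (2 * √(D.c i * D.g i))
  have hm0 : 0 ≤ m := by positivity
  -- Three contributions: the initial value, the perturbation relative to the gain, and the next
  -- error coordinate relative to the least possible gain.
  set K := max C₀ (m + C₁ / D.c i)
  refine ⟨K, hC₀0.trans (le_max_left _ _), fun t₀ b S h1 h2 h3 h4 => ?_⟩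
  have hinit : |S.h φ D r i t₀| ≤ K := (hC₀ t₀ S h1 h4).trans (le_max_left _ _)
  have hcontS := h3.continuousOn_h hφ hr (Icc_subset_Ici_self.trans (Ici_subset_Ici.2 h1)) i
  have hsub : ∀ {t}, t ∈ Ioo t₀ b → S.IsSolution φ θ D r (Icc t₀ t) := fun ht =>
    h3.mono (Icc_subset_Icc_right ht.2.le)
  have hest : ∀ t ∈ Ioo t₀ b, |S.hNext φ D r i t + (inner ℝ (S.w φ D r i t) (θ - S.θhat t)
      - inner ℝ (S.q φ D r i t) (S.updateLaw D t))| ≤ S.gain φ D r i t * K := by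
    intro t ht
    have h5 : |S.hNext φ D r i t| ≤ C₁ := hC₁ t₀ t S h1 ht.1.le (hsub ht) h4
    have h6 := abs_perturbation_le hc (D.κ_pos i) (D.g_pos i)
      (ha t₀ t S h1 ht.1.le (hsub ht) h4) (hd t₀ t S h1 ht.1.le (hsub ht) h4)
      (le_refl (S.gain φ D r i t))
    have h7 : D.c i ≤ S.gain φ D r i t := Trajectory.c_le_gain i t
    have h8 : D.c i * (C₁ / D.c i) ≤ S.gain φ D r i t * (C₁ / D.c i) :=
      mul_le_mul_of_nonneg_right h7 (by positivity)
    rw [mul_div_cancel₀ _ hc.ne'] at h8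
    have h9 : S.gain φ D r i t * (m + C₁ / D.c i) ≤ S.gain φ D r i t * K :=
      mul_le_mul_of_nonneg_left (le_max_right _ _) (hc.le.trans h7)
    refine (abs_add_le _ _).trans ((add_le_add h5 h6).trans ?_)
    linarith
  have hg0 : ∀ t, 0 ≤ S.gain φ D r i t := fun t => hc.le.trans (Trajectory.c_le_gain i t)
  rw [Real.norm_eq_abs, abs_le]
  constructor
  · have := nonpos_of_hasDerivAt_nonpos_of_pos (y := fun t => -S.h φ D r i t - K) h2
      (hr.finite_jumps h1 b) (hcontS.neg.sub continuousOn_const)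
      (by linarith [(abs_le.1 hinit).1]) fun t ht htN hpos => by
        refine ⟨_, ((h3.dynamicsAt hr h1 ht htN).hasDerivAt_h hφ i).neg.sub_const K, ?_⟩
        have h5 := (abs_le.1 (hest t ht)).1
        have h6 := mul_le_mul_of_nonneg_left (sub_pos.1 hpos).le (hg0 t)
        linarith
    linarith
  · have := nonpos_of_hasDerivAt_nonpos_of_pos (y := fun t => S.h φ D r i t - K) h2
      (hr.finite_jumps h1 b) (hcontS.sub continuousOn_const)
      (by linarith [(abs_le.1 hinit).2]) fun t ht htN hpos => by
        refine ⟨_, ((h3.dynamicsAt hr h1 ht htN).hasDerivAt_h hφ i).sub_const K, ?_⟩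
        have h5 := (abs_le.1 (hest t ht)).2
        have h6 := mul_le_mul_of_nonneg_left (sub_pos.1 hpos).le (hg0 t)
        linarith
    linarith

/-- Induction over the error coordinates from the last to the first. -/
theorem backward_induction {motive : Fin n → Prop}
    (step : ∀ i : Fin n, (∀ hi : (i : ℕ) + 1 < n, motive ⟨i + 1, hi⟩) → motive i) (i : Fin n) :
    motive i := by
  have key : ∀ k : ℕ, ∀ i : Fin n, n - (i : ℕ) = k → motive i := by
    intro k
    induction k with
    | zero => intro i hi; omega
    | succ k ih => exact fun i hi => step i fun hi' => ih _ (by simp only; omega)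
  exact key _ i rfl

theorem unifBdd_h (hφ : IsStrictFeedback φ) (hr : IsBoundarySignal n r) (i : Fin n) :
    UnifBdd φ θ D r R fun S t => S.h φ D r i t := by
  refine backward_induction
    (motive := fun i => UnifBdd φ θ D r R fun S t => S.h φ D r i t) (fun i ih => ?_) i
  refine unifBdd_h_of_hNext hφ hr i ?_
  by_cases hi : (i : ℕ) + 1 < n
  · simpa only [Trajectory.hNext, hi, dif_pos] using ih hi
  · exact ⟨0, le_rfl, fun t₀ b S _ _ _ _ => by simp [Trajectory.hNext, hi]⟩

theorem unifBdd_x (hφ : IsStrictFeedback φ) (hr : IsBoundarySignal n r) :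
    UnifBdd φ θ D r R fun S t => S.x t := by
  choose B hB0 hB using fun i : Fin n => unifBdd_h (θ := θ) (D := D) (R := R) hφ hr i
  have hsum : ∀ j, B j ≤ ∑ j, B j := fun j =>
    Finset.single_le_sum (fun j _ => hB0 j) (Finset.mem_univ j)
  have hs0 : 0 ≤ ∑ j, B j := Finset.sum_nonneg fun j _ => hB0 j
  obtain ⟨M, hM0, hM, -⟩ := hr.exists_norm_refVec_le
  obtain ⟨a, ha0, ha⟩ := unifBdd_θhat (φ := φ) (θ := θ) (D := D) (R := R) hr
  obtain ⟨C, hC0, hC⟩ := exists_state_bound_of_err_bound (D := D) hφ (∑ j, B j + M + a)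
  refine ⟨C, hC0, fun t₀ b S h1 h2 h3 h4 => hC _ (refVec n r b) (S.θhat b) (fun i => ?_) ?_ ?_⟩
  · exact ((hB i t₀ b S h1 h2 h3 h4).trans (hsum i)).trans (by linarith)
  · exact (hM b (h1.trans h2)).trans (by linarith)
  · exact (ha t₀ b S h1 h2 h3 h4).trans (by linarith)

theorem unifBdd_Ω₀ (hφ : IsStrictFeedback φ) (hr : IsBoundarySignal n r) :
    UnifBdd φ θ D r R fun S t => S.Ω₀ t := by
  have h := ((unifBdd_εTrue (φ := φ) (θ := θ) (D := D) (R := R) hr).prodMk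
    ((unifBdd_x hφ hr).prodMk (unifBdd_Ω_transpose_mulVec hr θ.ofLp))).comp
    (g := fun z : (Fin n → ℝ) × (Fin n → ℝ) × (Fin n → ℝ) => z.1 - z.2.1 + z.2.2) (by fun_prop)
  have h2 : ∀ (S : Trajectory n p) t, S.εTrue θ t - S.x t + (S.Ω t)ᵀ *ᵥ θ.ofLp = S.Ω₀ t := by
    intro S t
    simp only [Trajectory.εTrue]
    abel
  simpa only [h2] using h

theorem unifBdd_control (hφ : IsStrictFeedback φ) (hr : IsBoundarySignal n r) :
    UnifBdd φ θ D r R fun S t => S.control φ D r t := by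
  have h1 := ((unifBdd_x (θ := θ) (D := D) (R := R) hφ hr).prodMk ((unifBdd_refVec hr).prodMk
    (unifBdd_θhat hr))).comp
    (isSmooth_virtualControl (D := D) hφ.smooth (Fin.last n)).continuous
  have h2 : UnifBdd φ θ D r R fun _ t => r n t := by
    obtain ⟨M, hM0, -, hM⟩ := hr.exists_norm_refVec_le
    exact ⟨M, hM0, fun t₀ b _ h1 h2 _ _ => hM b (h1.trans h2)⟩
  exact (h1.prodMk h2).comp (g := fun z : ℝ × ℝ => z.1 + z.2) (by fun_prop)

/-- Global uniform boundedness of all closed-loop signals. -/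
theorem exists_signalBound (hφ : IsStrictFeedback φ) (hr : IsBoundarySignal n r) (R : ℝ) :
    ∃ B, 0 ≤ B ∧ ∀ (t₀ b : ℝ) (S : Trajectory n p), 0 ≤ t₀ → t₀ ≤ b →
      S.IsSolution φ θ D r (Icc t₀ b) → S.StateBound R t₀ → S.SignalBound φ θ D r B b := by
  obtain ⟨B₁, h₁0, h₁⟩ := unifBdd_x (θ := θ) (D := D) (R := R) hφ hr
  obtain ⟨B₂, h₂0, h₂⟩ := (unifBdd_Ω (φ := φ) (θ := θ) (D := D) (R := R) hr).comp
    continuous_frobNorm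
  obtain ⟨B₃, h₃0, h₃⟩ := unifBdd_Ω₀ (θ := θ) (D := D) (R := R) hφ hr
  obtain ⟨B₄, h₄0, h₄⟩ := unifBdd_θhat (φ := φ) (θ := θ) (D := D) (R := R) hr
  choose B₅ h₅0 h₅ using fun i : Fin n => unifBdd_h (θ := θ) (D := D) (R := R) hφ hr i
  obtain ⟨B₆, h₆0, h₆⟩ := unifBdd_ε (φ := φ) (θ := θ) (D := D) (R := R) hr
  obtain ⟨B₇, h₇0, h₇⟩ := (unifBdd_θhat (φ := φ) (θ := θ) (D := D) (R := R) hr).comp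
    (g := fun ϑ => θ - ϑ) (by fun_prop)
  obtain ⟨B₈, h₈0, h₈⟩ := unifBdd_control (θ := θ) (D := D) (R := R) hφ hr
  obtain ⟨B₉, h₉0, h₉⟩ := unifBdd_updateLaw (φ := φ) (θ := θ) (D := D) (R := R) hr
  have hsum : ∀ j, B₅ j ≤ ∑ j, B₅ j := fun j =>
    Finset.single_le_sum (fun j _ => h₅0 j) (Finset.mem_univ j)
  have hs0 : 0 ≤ ∑ j, B₅ j := Finset.sum_nonneg fun j _ => h₅0 j
  refine ⟨B₁ + B₂ + B₃ + B₄ + ∑ j, B₅ j + B₆ + B₇ + B₈ + B₉, by positivity,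
    fun t₀ b S a1 a2 a3 a4 => ⟨⟨?_, ?_, ?_, ?_⟩, fun i => ?_, ?_, ?_, ?_, ?_⟩⟩
  · exact (h₁ t₀ b S a1 a2 a3 a4).trans (by linarith)
  · exact ((le_abs_self _).trans (h₂ t₀ b S a1 a2 a3 a4)).trans (by linarith)
  · exact (h₃ t₀ b S a1 a2 a3 a4).trans (by linarith)
  · exact (h₄ t₀ b S a1 a2 a3 a4).trans (by linarith)
  · exact ((h₅ i t₀ b S a1 a2 a3 a4).trans (hsum i)).trans (by linarith)
  · exact (h₆ t₀ b S a1 a2 a3 a4).trans (by linarith)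
  · exact (h₇ t₀ b S a1 a2 a3 a4).trans (by linarith)
  · exact (h₈ t₀ b S a1 a2 a3 a4).trans (by linarith)
  · exact (h₉ t₀ b S a1 a2 a3 a4).trans (by linarith)

end Boundedness

end AdaptiveOverride

end

/-! ### Global existence from a priori bounds -/

/-- A bump function equal to `1` on the ball of radius `R` makes the field compactly supported and
`C¹`, hence bounded and globally Lipschitz, without changing it on that ball. -/
theorem exists_truncated_solution {P E : Type*} [NormedAddCommGroup P] [NormedSpace ℝ P]
    [FiniteDimensional ℝ P] [NormedAddCommGroup E] [NormedSpace ℝ E] [FiniteDimensional ℝ E]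
    {Ψ : P × E → E} (hΨ : ContDiff ℝ 1 Ψ) {ρ : ℝ → P} (hρ : Continuous ρ) (t₀ : ℝ) (z₀ : E)
    {R : ℝ} (hR : 0 < R) :
    ∃ Z : ℝ → E, Z t₀ = z₀ ∧ ContinuousOn Z (Ici t₀) ∧ ∀ t, t₀ ≤ t → ‖(ρ t, Z t)‖ ≤ R →
      HasDerivWithinAt Z (Ψ (ρ t, Z t)) (Ici t₀) t := by
  let χ : ContDiffBump (0 : P × E) := ⟨R, R + 1, hR, by linarith⟩
  have hsupp : HasCompactSupport fun y => χ y • Ψ y := χ.hasCompactSupport.smul_right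
  have hsmooth : ContDiff ℝ 1 fun y => χ y • Ψ y := χ.contDiff.smul hΨ
  obtain ⟨K, hK⟩ := hsmooth.lipschitzWith_of_hasCompactSupport hsupp one_ne_zero
  obtain ⟨L, hL⟩ := hsupp.exists_bound_of_continuous hsmooth.continuous
  have : CompleteSpace E := FiniteDimensional.complete ℝ E
  obtain ⟨Z, hZ0, hZ⟩ := exists_forall_hasDerivWithinAt_Ici_of_lipschitz
    (v := fun t z => χ (ρ t, z) • Ψ (ρ t, z)) (K := K * 1) (L := L.toNNReal) t₀ z₀
    (fun t => hK.comp (LipschitzWith.prodMk_left (ρ t)))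
    (fun z => hsmooth.continuous.comp (hρ.prodMk continuous_const))
    (fun t z => (hL (ρ t, z)).trans (Real.le_coe_toNNReal L))
  refine ⟨Z, hZ0, fun t ht => (hZ t ht).continuousWithinAt, fun t ht hRt => ?_⟩
  have h := hZ t ht
  rwa [χ.one_of_mem_closedBall (by simpa using hRt), one_smul] at h

/-- Truncate beyond the a priori bound. Before the first time at which the norm reaches `R > C`, the
truncated curve solves the original equation, so its norm is at most `C`. By continuity this
persists at that time, a contradiction. -/
theorem exists_global_solution_of_bound {P E : Type*} [NormedAddCommGroup P] [NormedSpace ℝ P]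
    [FiniteDimensional ℝ P] [NormedAddCommGroup E] [NormedSpace ℝ E] [FiniteDimensional ℝ E]
    {Ψ : P × E → E} (hΨ : ContDiff ℝ 1 Ψ) {ρ : ℝ → P} (hρ : Continuous ρ) {t₀ M C : ℝ} (z₀ : E)
    (hM : ∀ t, ‖ρ t‖ ≤ M)
    (hbound : ∀ (b : ℝ) (Z : ℝ → E), t₀ ≤ b → Z t₀ = z₀ →
      (∀ t ∈ Icc t₀ b, HasDerivWithinAt Z (Ψ (ρ t, Z t)) (Icc t₀ b) t) → ‖Z b‖ ≤ C) :
    ∃ Z : ℝ → E, Z t₀ = z₀ ∧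
      ∀ t, t₀ ≤ t → HasDerivWithinAt Z (Ψ (ρ t, Z t)) (Ici t₀) t := by
  have hM0 : 0 ≤ M := (norm_nonneg _).trans (hM 0)
  set R := max C ‖z₀‖ + 1 with hRdef
  have hR0 : 0 ≤ max C ‖z₀‖ := (norm_nonneg _).trans (le_max_right _ _)
  obtain ⟨Z, hZ0, hZc, hZ⟩ := exists_truncated_solution hΨ hρ t₀ z₀ (R := max M R)
    (lt_max_of_lt_right (by positivity))
  have hpair : ∀ t, ‖Z t‖ ≤ R → ‖(ρ t, Z t)‖ ≤ max M R := fun t ht => max_le_max (hM t) ht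
  have key : ∀ t, t₀ ≤ t → ‖Z t‖ ≤ R := by
    intro t₁ ht₁
    by_contra! hlt
    set K := Icc t₀ t₁ ∩ (fun t => ‖Z t‖) ⁻¹' Ici R
    have hc : ContinuousOn (fun t => ‖Z t‖) (Icc t₀ t₁) :=
      (hZc.mono Icc_subset_Ici_self).norm
    have hKc : IsCompact K := isCompact_Icc.of_isClosed_subset
      (hc.preimage_isClosed_of_isClosed isClosed_Icc isClosed_Ici) inter_subset_left
    have hτ : sInf K ∈ K := hKc.sInf_mem ⟨t₁, right_mem_Icc.2 ht₁, hlt.le⟩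
    set τ := sInf K
    have hτR : R ≤ ‖Z τ‖ := hτ.2
    have hτ0 : t₀ < τ := by
      refine lt_of_le_of_ne hτ.1.1 fun h => ?_
      rw [← h, hZ0] at hτR
      linarith [le_max_right C ‖z₀‖]
    have hless : ∀ t ∈ Ico t₀ τ, ‖Z t‖ < R := by
      intro t ht
      by_contra! hle
      exact absurd (csInf_le hKc.bddBelow (⟨⟨ht.1, ht.2.le.trans hτ.1.2⟩, hle⟩ : t ∈ K))
        (not_le.2 ht.2)
    have hC : ∀ t ∈ Ico t₀ τ, ‖Z t‖ ≤ C := fun t ht =>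
      hbound t Z ht.1 hZ0 fun s hs =>
        (hZ s hs.1 (hpair s (hless s ⟨hs.1, hs.2.trans_lt ht.2⟩).le)).mono Icc_subset_Ici_self
    have hlim : Tendsto (fun t => ‖Z t‖) (𝓝[Ico t₀ τ] τ) (𝓝 ‖Z τ‖) :=
      ((hZc τ hτ.1.1).mono Ico_subset_Ici_self).norm
    have hne : (𝓝[Ico t₀ τ] τ).NeBot := by
      rw [← mem_closure_iff_nhdsWithin_neBot, closure_Ico hτ0.ne]
      exact right_mem_Icc.2 hτ0.le
    have := le_of_tendsto hlim (eventually_mem_nhdsWithin.mono hC)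
    linarith [le_max_left C ‖z₀‖]
  exact ⟨Z, hZ0, fun t ht => hZ t ht (hpair t (key t ht))⟩

noncomputable section

namespace AdaptiveOverride

/-! ### Global existence for the closed loop -/

section Existence

variable {n p : ℕ} {φ : Fin n → (Fin n → ℝ) → Par p} {θ : Par p} {D : Design n p}
  {r : ℕ → ℝ → ℝ} {S : Trajectory n p}

/-- The closed-loop vector field without the feedforward term `r⁽ⁿ⁾`. -/
def closedLoopField (φ : Fin n → (Fin n → ℝ) → Par p) (θ : Par p) (D : Design n p)
    (y : (Fin n → ℝ) × State n p) : State n p :=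
  let x := y.2.1
  let Ω : Matrix (Fin p) (Fin n) ℝ := Matrix.of y.2.2.1
  let v := shiftField x (virtualControl φ D (Fin.last n) x y.1 y.2.2.2.2)
  (v + (regressor φ x)ᵀ *ᵥ θ.ofLp,
    fun j i => (filterMatrix φ D x * Ωᵀ + (regressor φ x)ᵀ) i j,
    filterMatrix φ D x *ᵥ (y.2.2.2.1 + x) - v,
    (1 + D.ν * frobNorm Ω ^ 2)⁻¹ •
      WithLp.toLp 2 (D.Γ *ᵥ (Ω *ᵥ (x + y.2.2.2.1 - Ωᵀ *ᵥ y.2.2.2.2.ofLp))))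

theorem frobNorm_sq (M : Matrix (Fin p) (Fin n) ℝ) : frobNorm M ^ 2 = ∑ j, ∑ i, M j i ^ 2 :=
  Real.sq_sqrt (Finset.sum_nonneg fun _ _ => Finset.sum_nonneg fun _ _ => sq_nonneg _)

theorem contDiff_closedLoopField (hφ : IsStrictFeedback φ) :
    ContDiff ℝ ∞ (closedLoopField φ θ D) := by
  have hF : ∀ i j, ContDiff ℝ ∞ fun y : (Fin n → ℝ) × State n p => φ i y.2.1 j := fun i j =>
    contDiff_euclidean.1 ((hφ.smooth i).comp
      (contDiff_fst.comp contDiff_snd : ContDiff ℝ ∞ fun y : (Fin n → ℝ) × State n p => y.2.1)) j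
  have hA : ∀ i k, ContDiff ℝ ∞ fun y : (Fin n → ℝ) × State n p => filterMatrix φ D y.2.1 i k := by
    intro i k
    simp only [filterMatrix, Matrix.sub_apply, Matrix.smul_apply, Matrix.mul_apply,
      Matrix.transpose_apply, regressor, Matrix.of_apply, smul_eq_mul]
    exact contDiff_const.sub (contDiff_const.mul (ContDiff.sum fun l _ =>
      (ContDiff.sum fun j _ => (hF i j).mul (hF l j)).mul contDiff_const))
  have hα : ContDiff ℝ ∞ fun y : (Fin n → ℝ) × State n p =>
      virtualControl φ D (Fin.last n) y.2.1 y.1 y.2.2.2.2 :=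
    ContDiff.comp (isSmooth_virtualControl (D := D) hφ.smooth (Fin.last n))
      (f := fun y : (Fin n → ℝ) × State n p => (y.2.1, y.1, y.2.2.2.2)) (by fun_prop)
  have hv : ∀ i, ContDiff ℝ ∞ fun y : (Fin n → ℝ) × State n p =>
      shiftField y.2.1 (virtualControl φ D (Fin.last n) y.2.1 y.1 y.2.2.2.2) i := by
    intro i
    by_cases hi : (i : ℕ) + 1 < n
    · simp only [shiftField, hi, dif_pos]
      fun_prop
    · simpa only [shiftField, hi, dif_neg, not_false_eq_true] using hα
  refine ContDiff.prodMk ?_ (ContDiff.prodMk ?_ (ContDiff.prodMk ?_ ?_))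
  · refine contDiff_pi.2 fun i => ?_
    simp only [Pi.add_apply, Matrix.mulVec, dotProduct, Matrix.transpose_apply, regressor,
      Matrix.of_apply]
    exact (hv i).add (ContDiff.sum fun j _ => (hF i j).mul contDiff_const)
  · refine contDiff_pi.2 fun j => contDiff_pi.2 fun i => ?_
    simp only [Matrix.add_apply, Matrix.mul_apply, Matrix.transpose_apply, regressor,
      Matrix.of_apply]
    exact (ContDiff.sum fun k _ => (hA i k).mul (by fun_prop)).add (hF i j)
  · refine contDiff_pi.2 fun i => ?_
    simp only [Pi.sub_apply, Matrix.mulVec, dotProduct, Pi.add_apply]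
    exact (ContDiff.sum fun k _ => (hA i k).mul (by fun_prop)).sub (hv i)
  · have h1 : ContDiff ℝ ∞ fun y : (Fin n → ℝ) × State n p =>
        1 + D.ν * frobNorm (Matrix.of y.2.2.1) ^ 2 := by
      simp only [frobNorm_sq, Matrix.of_apply]
      fun_prop
    have h2 : ContDiff ℝ ∞ fun y : (Fin n → ℝ) × State n p =>
        D.Γ *ᵥ (Matrix.of y.2.2.1 *ᵥ
          (y.2.1 + y.2.2.2.1 - (Matrix.of y.2.2.1)ᵀ *ᵥ y.2.2.2.2.ofLp)) := by
      refine contDiff_pi.2 fun j => ?_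
      simp only [Matrix.mulVec, dotProduct, Matrix.of_apply, Pi.sub_apply, Pi.add_apply,
        Matrix.transpose_apply]
      fun_prop
    have h3 : ContDiff ℝ ∞ (WithLp.toLp 2 : (Fin p → ℝ) → Par p) := PiLp.contDiff_toLp
    refine (h1.inv fun y => ?_).smul (h3.comp h2)
    have := mul_nonneg D.ν_nonneg (sq_nonneg (frobNorm (n := n) (p := p) (Matrix.of y.2.2.1)))
    exact ne_of_gt (by linarith)

/-- The direction in the state space along which the control acts. -/
def inputDirection (n p : ℕ) : State n p :=
  (fun i => if (i : ℕ) + 1 < n then 0 else 1, 0, fun i => if (i : ℕ) + 1 < n then 0 else -1, 0)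

theorem norm_inputDirection_le : ‖inputDirection n p‖ ≤ 1 := by
  simp only [inputDirection, Prod.norm_def, sup_le_iff, norm_zero, zero_le_one, true_and, and_true]
  constructor
  · exact (pi_norm_le_iff_of_nonneg zero_le_one).2 fun i => by split_ifs <;> simp
  · exact (pi_norm_le_iff_of_nonneg zero_le_one).2 fun i => by split_ifs <;> simp

/-- The trajectory with given state. -/
def trajectoryOf (z : ℝ → State n p) : Trajectory n p where
  x t := (z t).1
  Ω t := Matrix.of (z t).2.1
  Ω₀ t := (z t).2.2.1
  θhat t := (z t).2.2.2

/-- The control enters affinely, so the discontinuous `r⁽ⁿ⁾` can be isolated as a multiple of a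
constant direction and later removed by a change of variables. -/
theorem isSolution_trajectoryOf {z : ℝ → State n p} {J : Set ℝ} (hc : ContinuousOn z J)
    (hz : ∀ t ∈ J, ContinuousWithinAt (r n) (Ici 0) t → HasDerivWithinAt z
      (closedLoopField φ θ D (refVec n r t, z t) + r n t • inputDirection n p) J t) :
    (trajectoryOf z).IsSolution φ θ D r J := by
  have hshift : ∀ (x : Fin n → ℝ) (u v : ℝ) (i : Fin n),
      shiftField x (u + v) i = shiftField x u i + v * if (i : ℕ) + 1 < n then 0 else 1 := by
    intro x u v i
    by_cases hi : (i : ℕ) + 1 < n <;> simp [shiftField, hi]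
  refine
    { x_cont := continuous_fst.comp_continuousOn hc
      Ω_cont := (continuous_fst.comp continuous_snd).comp_continuousOn hc
      Ω₀_cont := (continuous_fst.comp (continuous_snd.comp continuous_snd)).comp_continuousOn hc
      θhat_cont := (continuous_snd.comp (continuous_snd.comp continuous_snd)).comp_continuousOn hc
      plant := fun t ht htc => ?_
      filter := fun t ht htc i j => ?_
      filter₀ := fun t ht htc => ?_
      update := fun t ht htc => ?_ }
  · have h := (ContinuousLinearMap.fst ℝ (Fin n → ℝ) ((Fin p → Fin n → ℝ) × (Fin n → ℝ) ×
      Par p)).hasFDerivAt.comp_hasDerivWithinAt t (hz t ht htc)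
    refine h.congr_deriv (funext fun i => ?_)
    simp only [closedLoopField, inputDirection, Trajectory.control, trajectoryOf, hshift,
      ContinuousLinearMap.coe_fst', Prod.fst_add, Prod.smul_fst, Pi.add_apply, Pi.smul_apply,
      smul_eq_mul]
    ring
  · have h := ((ContinuousLinearMap.fst ℝ (Fin p → Fin n → ℝ) ((Fin n → ℝ) × Par p)).comp
      (ContinuousLinearMap.snd ℝ (Fin n → ℝ) ((Fin p → Fin n → ℝ) × (Fin n → ℝ) ×
      Par p))).hasFDerivAt.comp_hasDerivWithinAt t (hz t ht htc)
    refine ((hasDerivWithinAt_pi.1 (hasDerivWithinAt_pi.1 h j)) i).congr_deriv ?_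
    simp [closedLoopField, inputDirection, trajectoryOf]
  · have h := ((ContinuousLinearMap.fst ℝ (Fin n → ℝ) (Par p)).comp
      ((ContinuousLinearMap.snd ℝ (Fin p → Fin n → ℝ) ((Fin n → ℝ) × Par p)).comp
      (ContinuousLinearMap.snd ℝ (Fin n → ℝ) ((Fin p → Fin n → ℝ) × (Fin n → ℝ) ×
      Par p)))).hasFDerivAt.comp_hasDerivWithinAt t (hz t ht htc)
    refine h.congr_deriv (funext fun i => ?_)
    have h1 := hshift (z t).1 (virtualControl φ D (Fin.last n) (z t).1 (refVec n r t)
      (z t).2.2.2) (r n t) i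
    simp only [Trajectory.control, trajectoryOf, Pi.sub_apply, h1]
    by_cases hi : (i : ℕ) + 1 < n
    · simp [closedLoopField, inputDirection, hi]
    · simp [closedLoopField, inputDirection, hi]
      ring
  · have h := ((ContinuousLinearMap.snd ℝ (Fin n → ℝ) (Par p)).comp
      ((ContinuousLinearMap.snd ℝ (Fin p → Fin n → ℝ) ((Fin n → ℝ) × Par p)).comp
      (ContinuousLinearMap.snd ℝ (Fin n → ℝ) ((Fin p → Fin n → ℝ) × (Fin n → ℝ) ×
      Par p)))).hasFDerivAt.comp_hasDerivWithinAt t (hz t ht htc)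
    refine h.congr_deriv ?_
    simp only [closedLoopField, inputDirection, ContinuousLinearMap.coe_comp, Function.comp,
      ContinuousLinearMap.coe_snd', Prod.snd_add, Prod.smul_snd, smul_zero, add_zero]
    rfl

/-- Global existence of closed-loop solutions. -/
theorem exists_isSolution_Ici (hn : 1 ≤ n) (hφ : IsStrictFeedback φ) (hr : IsBoundarySignal n r)
    {t₀ : ℝ} (ht₀ : 0 ≤ t₀) (x₀ : Fin n → ℝ) (M₀ : Matrix (Fin p) (Fin n) ℝ) (z₀ : Fin n → ℝ)
    (ϑ₀ : Par p) : ∃ S : Trajectory n p, S.IsSolution φ θ D r (Ici t₀) ∧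
      S.x t₀ = x₀ ∧ S.Ω t₀ = M₀ ∧ S.Ω₀ t₀ = z₀ ∧ S.θhat t₀ = ϑ₀ := by
  set l : Fin n := ⟨n - 1, by omega⟩
  set e := inputDirection n p
  set y₀ : State n p := (x₀, M₀, z₀, ϑ₀)
  -- Freezing the reference at negative times makes it continuous and bounded on the whole line.
  set ρ : ℝ → Fin n → ℝ := fun t => refVec n r (max t 0)
  have hρc : Continuous ρ := hr.continuousOn_refVec.comp_continuous (by fun_prop)
    fun t => le_max_right t 0
  have hρt : ∀ t, 0 ≤ t → ρ t = refVec n r t := fun t ht => by simp [ρ, ht]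
  obtain ⟨M, hM0, hM, -⟩ := hr.exists_norm_refVec_le
  -- This is the field for `Z = z - r⁽ⁿ⁻¹⁾ e`. Since `r⁽ⁿ⁾` is the derivative of `r⁽ⁿ⁻¹⁾` away from
  -- jumps, the substitution removes it. What remains depends on time only through the continuous
  -- `ρ`, and classical solutions exist across the jumps.
  set Ψ : (Fin n → ℝ) × State n p → State n p := fun y =>
    closedLoopField φ θ D (y.1, y.2 + y.1 l • e)
  have hΨ : ContDiff ℝ 1 Ψ := by
    have h : ContDiff ℝ ∞ Ψ := (contDiff_closedLoopField hφ).comp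
      (f := fun y : (Fin n → ℝ) × State n p => (y.1, y.2 + y.1 l • e)) (by fun_prop)
    exact h.of_le (by exact_mod_cast le_top)
  set lift : (ℝ → State n p) → ℝ → State n p := fun Z t => Z t + r (n - 1) t • e
  have hsol : ∀ (J : Set ℝ) (Z : ℝ → State n p), J ⊆ Ici 0 →
      (∀ t ∈ J, HasDerivWithinAt Z (Ψ (ρ t, Z t)) J t) →
      (trajectoryOf (lift Z)).IsSolution φ θ D r J := by
    intro J Z hJ hZ
    refine isSolution_trajectoryOf ?_ fun t ht htc => ?_
    · exact ContinuousOn.add (fun t ht => (hZ t ht).continuousWithinAt)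
        ((hr.continuous_pred.mono hJ).smul continuousOn_const)
    · have h1 := (hr.hasDeriv_last t (hJ ht) htc).mono hJ
      refine ((hZ t ht).add (h1.smul_const e)).congr_deriv ?_
      simp only [Ψ, hρt t (hJ ht)]
      rfl
  set Z₀ := y₀ - r (n - 1) t₀ • e with hZ₀
  have hstate : ∀ Z : ℝ → State n p, (trajectoryOf (lift Z)).state = lift Z := fun Z => rfl
  have hinit : ∀ Z : ℝ → State n p, Z t₀ = Z₀ → lift Z t₀ = y₀ := fun Z hZ => by
    simp only [lift, hZ, hZ₀, sub_add_cancel]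
  set R := ‖x₀‖ + frobNorm M₀ + ‖z₀‖ + ‖ϑ₀‖
  have hf0 : 0 ≤ frobNorm M₀ := Real.sqrt_nonneg _
  obtain ⟨B, hB0, hB⟩ := exists_signalBound (θ := θ) (D := D) hφ hr R
  -- The bound `B` controls the original state, and undoing the shift by `r⁽ⁿ⁻¹⁾ e` costs at most
  -- `M`.
  obtain ⟨Z, hZ0, hZ⟩ := exists_global_solution_of_bound (t₀ := t₀) (M := M) (C := B + M) hΨ hρc Z₀
    (fun t => hM _ (le_max_right t 0)) fun b Z hb hZ0 hZ => by
      have h1 := hB t₀ b _ ht₀ hb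
        (hsol _ Z (Icc_subset_Ici_self.trans (Ici_subset_Ici.2 ht₀)) hZ) (by
          have h2 := hinit Z hZ0
          simp only [Trajectory.StateBound, trajectoryOf, h2]
          refine ⟨?_, ?_, ?_, ?_⟩
          · change ‖x₀‖ ≤ R
            linarith [norm_nonneg z₀, norm_nonneg ϑ₀]
          · change frobNorm M₀ ≤ R
            linarith [norm_nonneg z₀, norm_nonneg ϑ₀, norm_nonneg x₀]
          · change ‖z₀‖ ≤ R
            linarith [norm_nonneg x₀, norm_nonneg ϑ₀]
          · change ‖ϑ₀‖ ≤ R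
            linarith [norm_nonneg x₀, norm_nonneg z₀])
      have h3 := h1.1.norm_state_le
      rw [hstate] at h3
      have h4 : Z b = lift Z b - r (n - 1) b • e := by simp only [lift, add_sub_cancel_right]
      have h5 : ‖r (n - 1) b • e‖ ≤ M := by
        rw [norm_smul]
        have h6 : ‖r (n - 1) b‖ ≤ M := (norm_le_pi_norm (refVec n r b) l).trans
          (hM b (ht₀.trans hb))
        calc ‖r (n - 1) b‖ * ‖e‖ ≤ M * 1 :=
              mul_le_mul h6 norm_inputDirection_le (norm_nonneg _) hM0
          _ = M := mul_one M
      rw [h4]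
      exact (norm_sub_le _ _).trans (add_le_add h3 h5)
  have h2 := hinit Z hZ0
  refine ⟨trajectoryOf (lift Z), hsol _ Z (Ici_subset_Ici.2 ht₀) hZ, ?_, ?_, ?_, ?_⟩ <;>
    simp only [trajectoryOf, h2] <;> rfl

end Existence

/-! ### Asymptotic tracking -/

section Tracking

/-- Uniform continuity on a compact product. The factor `z` need not converge; boundedness suffices.
-/
theorem tendsto_zero_of_bounded {X Y F : Type*} [NormedAddCommGroup X] [ProperSpace X]
    [NormedAddCommGroup Y] [ProperSpace Y] [NormedAddCommGroup F] {f : X × Y → F}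
    (hf : Continuous f) (hf0 : ∀ x, f (x, 0) = 0) {z : ℝ → X} {y : ℝ → Y} {B t₀ : ℝ}
    (hz : ∀ t, t₀ ≤ t → ‖z t‖ ≤ B) (hy : Tendsto y atTop (𝓝 0)) :
    Tendsto (fun t => f (z t, y t)) atTop (𝓝 0) := by
  have hK : IsCompact (Metric.closedBall (0 : X) B ×ˢ Metric.closedBall (0 : Y) 1) :=
    (isCompact_closedBall _ _).prod (isCompact_closedBall _ _)
  have huc := Metric.uniformContinuousOn_iff.1
    (hK.uniformContinuousOn_of_continuous hf.continuousOn)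
  rw [Metric.tendsto_nhds]
  intro δ hδ
  obtain ⟨d, hd, h⟩ := huc δ hδ
  filter_upwards [eventually_ge_atTop t₀, Metric.tendsto_nhds.1 hy d hd,
    Metric.tendsto_nhds.1 hy 1 one_pos] with t h1 h2 h3
  have hzt : z t ∈ Metric.closedBall (0 : X) B := by simpa using hz t h1
  have := h (z t, y t) ⟨hzt, Metric.mem_closedBall.2 h3.le⟩ (z t, 0) ⟨hzt, by simp⟩
    (by simpa [Prod.dist_eq, hd] using h2)
  rwa [hf0] at this

/-- If a nonnegative energy `G` satisfies `G' ≤ -k f²`, and `f` is Lipschitz and bounded, then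
`f → 0`. -/
theorem tendsto_zero_of_energy {G f : ℝ → ℝ} {N : Set ℝ} {t₀ k L C : ℝ}
    (hN : ∀ a T, t₀ ≤ a → (N ∩ Icc a T).Finite) (hG : ContinuousOn G (Ici t₀))
    (hG0 : ∀ t, 0 ≤ G t) (hk : 0 < k)
    (hd : ∀ t, t₀ < t → t ∉ N → ∃ G', HasDerivAt G G' t ∧ G' ≤ -(k * f t ^ 2))
    (hL : ∀ s t, t₀ ≤ s → s ≤ t → |f t - f s| ≤ L * (t - s)) (hC : ∀ t, t₀ ≤ t → |f t| ≤ C) :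
    Tendsto f atTop (𝓝 0) := by
  have hanti : AntitoneOn G (Ici t₀) := by
    intro a ha b _ hab
    refine le_of_hasDerivAt_nonpos_off_finite hab (hN a b ha)
      (hG.mono (Icc_subset_Ici_self.trans (Ici_subset_Ici.2 ha))) fun t ht htN => ?_
    obtain ⟨G', h1, h2⟩ := hd t (lt_of_le_of_lt ha ht.1) htN
    have : 0 ≤ k * f t ^ 2 := by positivity
    exact ⟨G', h1, h2.trans (by linarith)⟩
  have hlim : ∃ l, Tendsto G atTop (𝓝 l) := by
    -- Monotonicity is known only from `t₀` on; the maximum extends it to the whole line.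
    have h1 : Antitone fun t => G (max t t₀) := fun a b hab =>
      hanti (le_max_right a t₀) (le_max_right b t₀) (max_le_max_right t₀ hab)
    have h2 := tendsto_atTop_ciInf h1 ⟨0, by rintro _ ⟨t, rfl⟩; exact hG0 _⟩
    refine ⟨_, h2.congr' ?_⟩
    filter_upwards [eventually_ge_atTop t₀] with t ht
    rw [max_eq_left ht]
  obtain ⟨l, hl⟩ := hlim
  have hC0 : 0 ≤ C := (abs_nonneg _).trans (hC t₀ le_rfl)
  rw [Metric.tendsto_nhds]
  intro δ hδ
  -- `f²` inherits the Lipschitz constant `2 C L` by factoring the difference of squares.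
  have hev := eventually_le_of_deriv_le_sub (a := fun _ => 0) (b := fun t => k * f t ^ 2)
    (L := k * (2 * C * L)) (fun T => hN t₀ T le_rfl) hG hl tendsto_const_nhds
    (fun s t hs hst => by
      have h1 : k * f t ^ 2 - k * f s ^ 2 = k * ((f t + f s) * (f t - f s)) := by ring
      have h2 : |f t + f s| ≤ 2 * C :=
        (abs_add_le _ _).trans (by linarith [hC t (hs.trans hst), hC s hs])
      rw [h1, abs_mul, abs_mul, abs_of_pos hk, mul_assoc, mul_assoc (2 * C)]
      exact mul_le_mul_of_nonneg_left
        (mul_le_mul h2 (hL s t hs hst) (abs_nonneg _) (by positivity)) hk.le)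
    (fun t ht htN => by simpa using hd t ht htN)
    (show 0 < k * (δ / 2) ^ 2 by positivity)
  filter_upwards [hev] with t ht
  have h1 : f t ^ 2 ≤ (δ / 2) ^ 2 := le_of_mul_le_mul_left ht hk
  have h2 := abs_le_of_sq_le_sq h1 (by positivity)
  rw [Real.dist_eq, sub_zero]
  linarith

variable {n p : ℕ} {φ : Fin n → (Fin n → ℝ) → Par p} {θ : Par p} {D : Design n p}
  {r : ℕ → ℝ → ℝ} {S : Trajectory n p} {t₀ : ℝ}

/-- The closed-loop state together with the control and the reference. -/
def Trajectory.signals (φ : Fin n → (Fin n → ℝ) → Par p) (D : Design n p) (r : ℕ → ℝ → ℝ)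
    (S : Trajectory n p) (t : ℝ) : State n p × ℝ × (Fin n → ℝ) :=
  (S.state t, S.control φ D r t, refVec n r t)

theorem Trajectory.IsSolution.exists_norm_signals_le (hφ : IsStrictFeedback φ)
    (hr : IsBoundarySignal n r) (ht₀ : 0 ≤ t₀) (hS : S.IsSolution φ θ D r (Ici t₀)) :
    ∃ B, ∀ t, t₀ ≤ t → ‖S.signals φ D r t‖ ≤ B := by
  have hf0 : 0 ≤ frobNorm (S.Ω t₀) := Real.sqrt_nonneg _
  obtain ⟨B, -, hB⟩ := exists_signalBound (θ := θ) (D := D) hφ hr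
    (‖S.x t₀‖ + frobNorm (S.Ω t₀) + ‖S.Ω₀ t₀‖ + ‖S.θhat t₀‖)
  obtain ⟨M, -, hM, -⟩ := hr.exists_norm_refVec_le
  refine ⟨max B M, fun t ht => ?_⟩
  have h := hB t₀ t S ht₀ ht (hS.mono Icc_subset_Ici_self) (by
    have h1 := norm_nonneg (S.x t₀)
    have h2 := norm_nonneg (S.Ω₀ t₀)
    have h3 := norm_nonneg (S.θhat t₀)
    exact ⟨by linarith, by linarith, by linarith, by linarith⟩)
  simp only [Trajectory.signals, Prod.norm_def (x := (S.state t, _)), sup_le_iff, Prod.norm_def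
    (x := (S.control φ D r t, refVec n r t))]
  exact ⟨h.1.norm_state_le.trans (le_max_left _ _), h.2.2.2.2.1.trans (le_max_left _ _),
    (hM t (ht₀.trans ht)).trans (le_max_right _ _)⟩

theorem Trajectory.IsSolution.dynamicsAt_of_lt (hr : IsBoundarySignal n r) (ht₀ : 0 ≤ t₀)
    (hS : S.IsSolution φ θ D r (Ici t₀)) {t : ℝ} (ht : t₀ < t) (htN : t ∉ jumps n r) :
    DynamicsAt φ θ D r S t :=
  (hS.mono (Icc_subset_Ici_self : Icc t₀ (t + 1) ⊆ Ici t₀)).dynamicsAt hr ht₀ ⟨ht, by linarith⟩ htN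

/-- A function whose derivative is a continuous function of the closed-loop signals is
Lipschitz. -/
theorem Trajectory.IsSolution.exists_lipschitz (hφ : IsStrictFeedback φ)
    (hr : IsBoundarySignal n r) (ht₀ : 0 ≤ t₀) (hS : S.IsSolution φ θ D r (Ici t₀)) {f : ℝ → ℝ}
    {g : State n p × ℝ × (Fin n → ℝ) → ℝ} (hg : Continuous g) (hf : ContinuousOn f (Ici t₀))
    (hd : ∀ t, DynamicsAt φ θ D r S t → HasDerivAt f (g (S.signals φ D r t)) t) :
    ∃ L, ∀ s t, t₀ ≤ s → s ≤ t → |f t - f s| ≤ L * (t - s) := by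
  obtain ⟨B, hB⟩ := hS.exists_norm_signals_le hφ hr ht₀
  obtain ⟨C, -, hC⟩ := exists_bound_of_continuous hg B
  refine ⟨C, fun s t hs hst => abs_sub_le_of_hasDerivAt_off_finite hst
    (hr.finite_jumps (ht₀.trans hs) t) (hf.mono (Icc_subset_Ici_self.trans (Ici_subset_Ici.2 hs)))
    fun u hu huN => ⟨_, hd u (hS.dynamicsAt_of_lt hr ht₀ (hs.trans_lt hu.1) huN), ?_⟩⟩
  exact hC _ (hB u (hs.trans hu.1.le))

theorem continuous_regressor (hφ : IsStrictFeedback φ) : Continuous (regressor φ) :=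
  continuous_matrix fun j i => (EuclideanSpace.proj j : Par p →L[ℝ] ℝ).continuous.comp
    (hφ.smooth i).continuous

theorem continuous_filterMatrix (hφ : IsStrictFeedback φ) : Continuous (filterMatrix φ D) := by
  unfold filterMatrix
  have h := continuous_regressor hφ
  exact continuous_const.sub
    (((h.matrix_transpose.matrix_mul h).matrix_mul continuous_const).const_smul D.σ)

theorem continuous_εTrue_deriv (hφ : IsStrictFeedback φ) :
    Continuous fun z : State n p => filterMatrix φ D z.1 *ᵥ
      (z.1 + z.2.2.1 - (Matrix.of z.2.1)ᵀ *ᵥ θ.ofLp) :=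
  ((continuous_filterMatrix hφ).comp continuous_fst).matrix_mulVec (continuous_εTrueFn θ)

theorem continuous_η (θ : Par p) :
    Continuous fun z : State n p => (Matrix.of z.2.1)ᵀ *ᵥ (θ - z.2.2.2).ofLp :=
  continuous_transpose_mulVec.comp (f := fun z : State n p => (z.2.1, (θ - z.2.2.2).ofLp))
    (by fun_prop)

/-- The update law as a function of the closed-loop state. -/
def stateUpdate (D : Design n p) (z : State n p) : Par p :=
  (1 + D.ν * frobNorm (n := n) (p := p) z.2.1 ^ 2)⁻¹ • WithLp.toLp 2 (D.Γ *ᵥ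
    ((Matrix.of z.2.1) *ᵥ (z.1 + z.2.2.1 - (Matrix.of z.2.1)ᵀ *ᵥ z.2.2.2.ofLp)))

theorem continuous_stateUpdate (D : Design n p) : Continuous (stateUpdate D) := by
  have h : Continuous fun z : State n p =>
      z.1 + z.2.2.1 - (Matrix.of z.2.1)ᵀ *ᵥ z.2.2.2.ofLp :=
    (continuous_fst.add (by fun_prop)).sub (continuous_transpose_mulVec.comp
      (f := fun z : State n p => (z.2.1, z.2.2.2.ofLp)) (by fun_prop))
  exact (continuous_updateLawFn D).comp (f := fun z : State n p =>
    (z.2.1, z.1 + z.2.2.1 - (Matrix.of z.2.1)ᵀ *ᵥ z.2.2.2.ofLp))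
    ((continuous_fst.comp continuous_snd).prodMk h)

theorem continuous_η_deriv (hφ : IsStrictFeedback φ) :
    Continuous fun z : State n p => filterMatrix φ D z.1 *ᵥ
      ((Matrix.of z.2.1)ᵀ *ᵥ (θ - z.2.2.2).ofLp) + (regressor φ z.1)ᵀ *ᵥ (θ - z.2.2.2).ofLp
      - (Matrix.of z.2.1)ᵀ *ᵥ (stateUpdate D z).ofLp := by
  refine ((((continuous_filterMatrix hφ).comp continuous_fst).matrix_mulVec (continuous_η θ)).add
    ((((continuous_regressor hφ).comp continuous_fst).matrix_transpose).matrix_mulVec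
      (by fun_prop))).sub ?_
  exact continuous_transpose_mulVec.comp
    (f := fun z : State n p => (z.2.1, (stateUpdate D z).ofLp))
    ((continuous_fst.comp continuous_snd).prodMk
      ((PiLp.continuous_ofLp 2 _).comp (continuous_stateUpdate D)))

theorem Trajectory.IsSolution.continuousOn_η {J : Set ℝ} (hS : S.IsSolution φ θ D r J) :
    ContinuousOn (S.η θ) J := (continuous_η θ).comp_continuousOn hS.continuousOn_state

theorem Trajectory.IsSolution.exists_abs_le (hφ : IsStrictFeedback φ)
    (hr : IsBoundarySignal n r) (ht₀ : 0 ≤ t₀) (hS : S.IsSolution φ θ D r (Ici t₀))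
    {g : State n p → ℝ} (hg : Continuous g) : ∃ C, ∀ t, t₀ ≤ t → |g (S.state t)| ≤ C := by
  obtain ⟨B, hB⟩ := hS.exists_norm_signals_le hφ hr ht₀
  obtain ⟨C, -, hC⟩ := exists_bound_of_continuous
    (hg.comp (continuous_fst : Continuous fun y : State n p × ℝ × (Fin n → ℝ) => y.1)) B
  exact ⟨C, fun t ht => hC (S.signals φ D r t) (hB t ht)⟩

/-! ### Convergence of the estimation errors, the perturbations and the tracking error. -/

theorem Trajectory.IsSolution.tendsto_εTrue (hφ : IsStrictFeedback φ)
    (hr : IsBoundarySignal n r) (ht₀ : 0 ≤ t₀) (hS : S.IsSolution φ θ D r (Ici t₀)) :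
    Tendsto (S.εTrue θ) atTop (𝓝 0) := by
  refine tendsto_pi_nhds.2 fun i => ?_
  obtain ⟨l, L, hl, -, hP⟩ := exists_quadForm_bounds D.P_posDef
  obtain ⟨K, hK⟩ := hS.exists_lipschitz hφ hr ht₀ (f := fun t => S.εTrue θ t i)
    (((continuous_apply i).comp (continuous_εTrue_deriv (D := D) (θ := θ) hφ)).comp continuous_fst)
    ((continuous_apply i).comp_continuousOn hS.continuousOn_εTrue)
    fun t H => hasDerivAt_pi.1 H.hasDerivAt_εTrue i
  obtain ⟨C, hC⟩ := hS.exists_abs_le hφ hr ht₀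
    ((continuous_apply i).comp (continuous_εTrueFn θ))
  refine tendsto_zero_of_energy (k := 1) (fun a T ha => hr.finite_jumps (ht₀.trans ha) T)
    ((continuous_quadForm D.P).comp_continuousOn hS.continuousOn_εTrue)
    (fun t => (by positivity : 0 ≤ l * ‖S.εTrue θ t‖ ^ 2).trans (hP _).1) one_pos
    (fun t ht htN => ?_) hK hC
  obtain ⟨V', h1, h2⟩ :=
    (hS.dynamicsAt_of_lt hr ht₀ ht htN).exists_hasDerivAt_εTrue_quadForm
  refine ⟨V', h1, h2.trans ?_⟩
  have h3 : S.εTrue θ t i * S.εTrue θ t i ≤ S.εTrue θ t ⬝ᵥ S.εTrue θ t :=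
    Finset.single_le_sum (f := fun i => S.εTrue θ t i * S.εTrue θ t i)
      (fun _ _ => mul_self_nonneg _) (Finset.mem_univ i)
  linarith [sq (S.εTrue θ t i)]

theorem Trajectory.IsSolution.tendsto_ε (hφ : IsStrictFeedback φ)
    (hr : IsBoundarySignal n r) (ht₀ : 0 ≤ t₀) (hS : S.IsSolution φ θ D r (Ici t₀)) :
    Tendsto S.ε atTop (𝓝 0) := by
  refine tendsto_pi_nhds.2 fun i => ?_
  obtain ⟨l, L, hl, -, hP⟩ := exists_quadForm_bounds D.P_posDef
  obtain ⟨l', L', hl', -, hΓ⟩ := exists_quadForm_bounds D.Γ_posDef.inv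
  have hε : S.ε = fun t => S.εTrue θ t + S.η θ t := funext fun t => S.ε_eq θ t
  obtain ⟨K, hK⟩ := hS.exists_lipschitz hφ hr ht₀ (f := fun t => S.ε t i)
    (((continuous_apply i).comp ((continuous_εTrue_deriv (D := D) (θ := θ) hφ).add
      (continuous_η_deriv (D := D) (θ := θ) hφ))).comp continuous_fst)
    (by
      rw [hε]
      exact (continuous_apply i).comp_continuousOn
        (hS.continuousOn_εTrue.add hS.continuousOn_η))
    fun t H => by
      rw [hε]
      exact hasDerivAt_pi.1 (H.hasDerivAt_εTrue.add H.hasDerivAt_η) i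
  obtain ⟨C, hC⟩ := hS.exists_abs_le hφ hr ht₀
    ((continuous_apply i).comp ((continuous_εTrueFn θ).add (continuous_η θ)))
  -- `Ω` is bounded along the solution, so the normalizer is too, and the estimator energy
  -- dissipates at least `Q⁻¹ |ε|²`.
  obtain ⟨Q, hQ⟩ := hS.exists_abs_le hφ hr ht₀ (g := fun z => 1 + D.ν * frobNorm (n := n) (p := p)
    z.2.1 ^ 2) (continuous_const.add (continuous_const.mul ((continuous_frobNorm.comp
      (continuous_fst.comp continuous_snd)).pow 2)))
  have hQ1 : ∀ t, t₀ ≤ t → S.normalizer D t ≤ Q := fun t ht => (le_abs_self _).trans (hQ t ht)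
  have hQ0 : 0 < Q := zero_lt_one.trans_le (Trajectory.one_le_normalizer.trans (hQ1 t₀ le_rfl))
  refine tendsto_zero_of_energy (k := Q⁻¹) (fun a T ha => hr.finite_jumps (ht₀.trans ha) T)
    (hS.continuousOn_estimatorEnergy)
    (fun t => add_nonneg ((by positivity : 0 ≤ l' * ‖(θ - S.θhat t).ofLp‖ ^ 2).trans (hΓ _).1)
      ((by positivity : 0 ≤ l * ‖S.εTrue θ t‖ ^ 2).trans (hP _).1)) (inv_pos.2 hQ0)
    (fun t ht htN => ?_) hK (fun t ht => by rw [S.ε_eq θ]; exact hC t ht)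
  obtain ⟨V', h1, h2⟩ := (hS.dynamicsAt_of_lt hr ht₀ ht htN).exists_hasDerivAt_estimator
  refine ⟨V', h1, h2.trans (neg_le_neg ?_)⟩
  have h3 : S.ε t i ^ 2 ≤ S.ε t ⬝ᵥ S.ε t := by
    rw [sq]
    exact Finset.single_le_sum (f := fun i => S.ε t i * S.ε t i)
      (fun _ _ => mul_self_nonneg _) (Finset.mem_univ i)
  have h4 : (0 : ℝ) < S.normalizer D t := zero_lt_one.trans_le Trajectory.one_le_normalizer
  exact mul_le_mul (inv_anti₀ h4 (hQ1 t ht.le)) h3 (sq_nonneg _) (inv_nonneg.2 h4.le)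

theorem Trajectory.IsSolution.tendsto_η (hφ : IsStrictFeedback φ)
    (hr : IsBoundarySignal n r) (ht₀ : 0 ≤ t₀) (hS : S.IsSolution φ θ D r (Ici t₀)) :
    Tendsto (S.η θ) atTop (𝓝 0) := by
  have h := (hS.tendsto_ε hφ hr ht₀).sub (hS.tendsto_εTrue hφ hr ht₀)
  rw [sub_zero] at h
  exact h.congr fun t => by rw [S.ε_eq θ, add_sub_cancel_left]

theorem Trajectory.IsSolution.exists_norm_state_le (hφ : IsStrictFeedback φ)
    (hr : IsBoundarySignal n r) (ht₀ : 0 ≤ t₀) (hS : S.IsSolution φ θ D r (Ici t₀)) :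
    ∃ B, ∀ t, t₀ ≤ t → ‖S.state t‖ ≤ B := by
  obtain ⟨B, hB⟩ := hS.exists_norm_signals_le hφ hr ht₀
  exact ⟨B, fun t ht => (norm_fst_le _).trans (hB t ht)⟩

theorem Trajectory.IsSolution.tendsto_updateLaw (hφ : IsStrictFeedback φ)
    (hr : IsBoundarySignal n r) (ht₀ : 0 ≤ t₀) (hS : S.IsSolution φ θ D r (Ici t₀)) :
    Tendsto (S.updateLaw D) atTop (𝓝 0) := by
  obtain ⟨B, hB⟩ := hS.exists_norm_state_le hφ hr ht₀
  exact tendsto_zero_of_bounded (continuous_updateLawFn D) (fun x => by simp)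
    (z := fun t => (S.Ω t : Fin p → Fin n → ℝ)) (t₀ := t₀)
    (fun t ht => ((norm_fst_le _).trans (norm_snd_le (S.state t))).trans (hB t ht))
    (hS.tendsto_ε hφ hr ht₀)

/-- Here `ηᵢ → 0`, and its derivative is `φᵢᵀθ̃` plus terms that vanish with `η` and the update
rate. As `φᵢᵀθ̃` is Lipschitz in time, Barbalat's argument forces it to zero; no persistence of
excitation is involved. -/
theorem Trajectory.IsSolution.tendsto_inner_regressor (hφ : IsStrictFeedback φ)
    (hr : IsBoundarySignal n r) (ht₀ : 0 ≤ t₀) (hS : S.IsSolution φ θ D r (Ici t₀)) (i : Fin n) :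
    Tendsto (fun t => inner ℝ (φ i (S.x t)) (θ - S.θhat t)) atTop (𝓝 0) := by
  obtain ⟨B, hB⟩ := hS.exists_norm_state_le hφ hr ht₀
  have ha : Tendsto (fun t => (filterMatrix φ D (S.x t) *ᵥ S.η θ t
      - (S.Ω t)ᵀ *ᵥ (S.updateLaw D t).ofLp) i) atTop (𝓝 0) := by
    have hc : Continuous fun q : State n p × (Fin n → ℝ) × Par p =>
        filterMatrix φ D q.1.1 *ᵥ q.2.1 - (Matrix.of q.1.2.1)ᵀ *ᵥ q.2.2.ofLp := by
      refine Continuous.sub ?_ ?_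
      · exact ((continuous_filterMatrix hφ).comp (by fun_prop)).matrix_mulVec (by fun_prop)
      · exact continuous_transpose_mulVec.comp
          (f := fun q : State n p × (Fin n → ℝ) × Par p => (q.1.2.1, q.2.2.ofLp)) (by fun_prop)
    have h := tendsto_zero_of_bounded hc (fun x => by simp) (z := S.state)
      (y := fun t => (S.η θ t, S.updateLaw D t)) hB
      ((hS.tendsto_η hφ hr ht₀).prodMk_nhds (hS.tendsto_updateLaw hφ hr ht₀))
    exact tendsto_pi_nhds.1 h i
  -- The time derivative of `φᵢᵀθ̃` contains the control, which jumps with `r⁽ⁿ⁾`. It is continuous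
  -- in the signals with the control as a separate argument, and boundedness of the signals then
  -- gives a Lipschitz constant.
  have hsmooth : Continuous fun z : State n p × ℝ × (Fin n → ℝ) =>
      inner ℝ (fderiv ℝ (φ i) z.1.1 (shiftField z.1.1 z.2.1 + (regressor φ z.1.1)ᵀ *ᵥ θ.ofLp))
        (θ - z.1.2.2.2) - inner ℝ (φ i z.1.1) (stateUpdate D z.1) := by
    refine Continuous.sub (Continuous.inner (Continuous.clm_apply ?_ (Continuous.add ?_ ?_))
      (by fun_prop)) (Continuous.inner ?_ ((continuous_stateUpdate D).comp continuous_fst))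
    · exact ((hφ.smooth i).continuous_fderiv (by simp)).comp (by fun_prop)
    · refine continuous_pi fun j => ?_
      by_cases hj : (j : ℕ) + 1 < n
      · simp only [shiftField, hj, dif_pos]
        fun_prop
      · simp only [shiftField, hj, dif_neg, not_false_eq_true]
        fun_prop
    · exact ((continuous_regressor hφ).comp
        (continuous_fst.comp continuous_fst)).matrix_transpose.matrix_mulVec continuous_const
    · exact (hφ.smooth i).continuous.comp (by fun_prop)
  have hcont : ContinuousOn (fun t => inner ℝ (φ i (S.x t)) (θ - S.θhat t)) (Ici t₀) :=
    ((hφ.smooth i).continuous.comp_continuousOn hS.x_cont).inner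
      (continuousOn_const.sub hS.θhat_cont)
  obtain ⟨L, hL⟩ := hS.exists_lipschitz hφ hr ht₀ hsmooth hcont fun t H => by
    have h1 : HasDerivAt (fun t => φ i (S.x t)) _ t :=
      (((hφ.smooth i).differentiable (by simp) (S.x t)).hasFDerivAt).comp_hasDerivAt t H.plant
    refine (h1.inner ℝ (H.update.const_sub θ)).congr_deriv ?_
    rw [inner_neg_right, add_comm, sub_eq_add_neg]
    rfl
  have ha' := ha.neg
  rw [neg_zero] at ha'
  have hη := tendsto_pi_nhds.1 (hS.tendsto_η hφ hr ht₀) i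
  have hηc : ContinuousOn (fun t => S.η θ t i) (Ici t₀) :=
    (continuous_apply i).comp_continuousOn hS.continuousOn_η
  have hderiv : ∀ t, t₀ < t → t ∉ jumps n r → HasDerivAt (fun t => S.η θ t i)
      ((filterMatrix φ D (S.x t) *ᵥ S.η θ t - (S.Ω t)ᵀ *ᵥ (S.updateLaw D t).ofLp) i
        + inner ℝ (φ i (S.x t)) (θ - S.θhat t)) t := fun t ht htN => by
    refine (hasDerivAt_pi.1 (hS.dynamicsAt_of_lt hr ht₀ ht htN).hasDerivAt_η i).congr_deriv ?_
    rw [← regressor_transpose_mulVec]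
    simp only [Pi.sub_apply, Pi.add_apply]
    ring
  rw [Metric.tendsto_nhds]
  intro δ hδ
  -- The Barbalat lemma is one-sided, so `-ηᵢ` yields the upper estimate of `φᵢᵀθ̃` and `ηᵢ` the
  -- lower one.
  have h1 := eventually_le_of_deriv_le_sub (G := fun t => -S.η θ t i)
    (fun T => hr.finite_jumps ht₀ T) hηc.neg hη.neg
    ha' hL (fun t ht htN => ⟨_, (hderiv t ht htN).neg, by linarith⟩)
    (half_pos hδ)
  have h2 := eventually_le_of_deriv_le_sub (L := L)
    (b := fun t => -inner ℝ (φ i (S.x t)) (θ - S.θhat t))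
    (fun T => hr.finite_jumps ht₀ T) hηc hη ha
    (fun s t hs hst => by rw [neg_sub_neg, abs_sub_comm]; exact hL s t hs hst)
    (fun t ht htN => ⟨_, hderiv t ht htN, by linarith⟩) (half_pos hδ)
  filter_upwards [h1, h2] with t h1 h2
  rw [Real.dist_eq, sub_zero, abs_lt]
  constructor <;> linarith

/-- `wᵢ` is a combination of the `φⱼ` with coefficients bounded along the solution, so the limits of
the individual `φⱼᵀθ̃` and of the update rate suffice. -/
theorem Trajectory.IsSolution.tendsto_perturbation (hφ : IsStrictFeedback φ)
    (hr : IsBoundarySignal n r) (ht₀ : 0 ≤ t₀) (hS : S.IsSolution φ θ D r (Ici t₀)) (i : Fin n) :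
    Tendsto (fun t => inner ℝ (S.w φ D r i t) (θ - S.θhat t)
      - inner ℝ (S.q φ D r i t) (S.updateLaw D t)) atTop (𝓝 0) := by
  obtain ⟨B, hB⟩ := hS.exists_norm_signals_le hφ hr ht₀
  set a := virtualControl φ D i.castSucc
  have ha : IsSmooth a := isSmooth_virtualControl hφ.smooth _
  have hc : Continuous fun z : State n p × ℝ × (Fin n → ℝ) => (z.1.1, z.2.2, z.1.2.2.2) := by
    fun_prop
  have hy : Tendsto (fun t => ((fun j => inner ℝ (φ j (S.x t)) (θ - S.θhat t) : Fin n → ℝ),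
      S.updateLaw D t)) atTop (𝓝 0) := by
    have h1 : Tendsto (fun t => (fun j => inner ℝ (φ j (S.x t)) (θ - S.θhat t) : Fin n → ℝ))
        atTop (𝓝 0) := tendsto_pi_nhds.2 fun j => hS.tendsto_inner_regressor hφ hr ht₀ j
    exact h1.prodMk_nhds (hS.tendsto_updateLaw hφ hr ht₀)
  have h := tendsto_zero_of_bounded (X := State n p × ℝ × (Fin n → ℝ)) (Y := (Fin n → ℝ) × Par p)
    (f := fun q => q.2.1 i - ∑ j ∈ Finset.Iio i,
      partialX a j q.1.1.1 q.1.2.2 q.1.1.2.2.2 * q.2.1 j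
      - inner ℝ (gradPar a q.1.1.1 q.1.2.2 q.1.1.2.2.2) q.2.2)
    (((by fun_prop : Continuous _).sub (continuous_finsetSum _ fun j _ =>
      ((ha.partialX j).continuous.comp (hc.comp continuous_fst)).mul (by fun_prop))).sub
      ((ha.gradPar.continuous.comp (hc.comp continuous_fst)).inner (by fun_prop)))
    (fun x => by simp) hB hy
  refine h.congr fun t => ?_
  simp only [Trajectory.w, Trajectory.q, wStep, inner_sub_left, sum_inner, inner_smul_left]
  rfl

/-- From the last coordinate backward, each equation is a damped scalar equation whose forcing, the
next coordinate plus the perturbation, tends to zero. -/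
theorem Trajectory.IsSolution.tendsto_h (hφ : IsStrictFeedback φ)
    (hr : IsBoundarySignal n r) (ht₀ : 0 ≤ t₀) (hS : S.IsSolution φ θ D r (Ici t₀)) (i : Fin n) :
    Tendsto (S.h φ D r i) atTop (𝓝 0) := by
  refine backward_induction (motive := fun i => Tendsto (S.h φ D r i) atTop (𝓝 0))
    (fun i ih => ?_) i
  have hnext : Tendsto (S.hNext φ D r i) atTop (𝓝 0) := by
    by_cases hi : (i : ℕ) + 1 < n
    · refine (ih hi).congr fun t => ?_
      simp [Trajectory.hNext, hi]
    · refine tendsto_const_nhds.congr fun t => ?_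
      simp [Trajectory.hNext, hi]
  have he := hnext.add (hS.tendsto_perturbation hφ hr ht₀ i)
  rw [add_zero] at he
  refine tendsto_zero_of_damped (s := S.gain φ D r i) (fun T => hr.finite_jumps ht₀ T)
    (hS.continuousOn_h hφ hr (Ici_subset_Ici.2 ht₀) i) (D.c_pos i)
    (fun t _ => Trajectory.c_le_gain i t) (fun t ht htN => ?_) he
  refine ((hS.dynamicsAt_of_lt hr ht₀ ht htN).hasDerivAt_h hφ i).congr_deriv ?_
  ring

theorem Trajectory.h_zero (hn : 1 ≤ n) (t : ℝ) :
    S.h φ D r ⟨0, hn⟩ t = S.x t ⟨0, hn⟩ - r 0 t := by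
  have h : virtualControl φ D (Fin.castSucc ⟨0, hn⟩) = fun _ _ _ => 0 := rfl
  simp only [Trajectory.h, err, errStep, h, refVec, sub_zero]

end Tracking

/-! ### Explicit bounds on the first error coordinate -/

section ExplicitBounds

/-- The geometric bound `m (1 + c⁻¹ + ⋯ + c^{-(j-1)})`. -/
def geomBound (m c : ℝ) (j : ℕ) : ℝ := m * ∑ k ∈ Finset.range j, c⁻¹ ^ k

theorem geomBound_succ (m c : ℝ) (j : ℕ) : geomBound m c (j + 1) = m + c⁻¹ * geomBound m c j := by
  simp only [geomBound, geom_sum_succ]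
  ring

theorem geomBound_nonneg {m c : ℝ} (hm : 0 ≤ m) (hc : 0 < c) (j : ℕ) : 0 ≤ geomBound m c j :=
  mul_nonneg hm (Finset.sum_nonneg fun _ _ => by positivity)

theorem geomFactor_eq_geom_sum {n : ℕ} (hn : 1 ≤ n) {c : ℝ} (hc : 0 < c) :
    geomFactor n c = ∑ k ∈ Finset.range n, c⁻¹ ^ k := by
  by_cases h1 : c = 1
  · simp [geomFactor, h1]
  · obtain ⟨k, rfl⟩ : ∃ k, n = k + 1 := ⟨n - 1, by omega⟩
    have h2 : c - 1 ≠ 0 := sub_ne_zero.2 h1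
    simp only [geomFactor, h1, if_false, Nat.add_sub_cancel]
    induction k with
    | zero => simp [h2]
    | succ k ih =>
      rw [geom_sum_succ, ← ih (by omega)]
      have h3 : c ^ k ≠ 0 := (pow_pos hc k).ne'
      field_simp
      ring

/-- The partial exponential sum `∑_{l<j} tˡ/l! a_{i+l}`. -/
def expSum (a : ℕ → ℝ) (j i : ℕ) (t : ℝ) : ℝ :=
  ∑ l ∈ Finset.range j, t ^ l / (Nat.factorial l : ℝ) * a (i + l)

theorem expSum_nonneg {a : ℕ → ℝ} (ha : ∀ k, 0 ≤ a k) (j i : ℕ) {t : ℝ} (ht : 0 ≤ t) :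
    0 ≤ expSum a j i t :=
  Finset.sum_nonneg fun l _ => mul_nonneg (by positivity) (ha _)

theorem expSum_succ_zero (a : ℕ → ℝ) (j i : ℕ) : expSum a (j + 1) i 0 = a i := by
  simp [expSum, Finset.sum_range_succ']

/-- This makes `e^{-ct} expSum a (n - i) i t` the exact solution of the linear cascade `yᵢ' = -c yᵢ
+ yᵢ₊₁` with `yᵢ(0) = aᵢ`, against which `hᵢ` is compared. -/
theorem hasDerivAt_expSum (a : ℕ → ℝ) (j i : ℕ) (t : ℝ) :
    HasDerivAt (expSum a (j + 1) i) (expSum a j (i + 1) t) t := by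
  have h1 : expSum a (j + 1) i = fun t => ∑ l ∈ Finset.range j,
      t ^ (l + 1) / (Nat.factorial (l + 1) : ℝ) * a (i + (l + 1)) + a i := by
    funext t
    simp [expSum, Finset.sum_range_succ']
  rw [h1]
  refine (HasDerivAt.fun_sum fun l _ => ?_).add_const (a i)
  have h2 := ((hasDerivAt_pow (l + 1) t).div_const (Nat.factorial (l + 1) : ℝ)).mul_const
    (a (i + (l + 1)))
  refine h2.congr_deriv ?_
  rw [Nat.factorial_succ, Nat.add_sub_cancel, show i + 1 + l = i + (l + 1) by omega]
  have h3 : (Nat.factorial l : ℝ) ≠ 0 := by positivity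
  have h4 : ((l + 1 : ℕ) : ℝ) ≠ 0 := by positivity
  push_cast at *
  field_simp

theorem norm_toLp_mulVec_le {m k : ℕ} (M : Matrix (Fin m) (Fin k) ℝ) (v : Fin k → ℝ) :
    ‖(WithLp.toLp 2 (M *ᵥ v) : EuclideanSpace ℝ (Fin m))‖ ≤
      frobNorm M * ‖(WithLp.toLp 2 v : EuclideanSpace ℝ (Fin k))‖ := by
  refine le_of_sq_le_sq ?_ (mul_nonneg (Real.sqrt_nonneg _) (norm_nonneg _))
  rw [mul_pow, frobNorm_sq, EuclideanSpace.norm_sq_eq, EuclideanSpace.norm_sq_eq, Finset.sum_mul]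
  refine Finset.sum_le_sum fun j _ => ?_
  simp only [Real.norm_eq_abs, sq_abs]
  exact Finset.sum_mul_sq_le_sq_mul_sq Finset.univ (fun i => M j i) v

theorem frobNorm_transpose {m k : ℕ} (M : Matrix (Fin m) (Fin k) ℝ) :
    frobNorm Mᵀ = frobNorm M := by
  simp only [frobNorm, Matrix.transpose_apply]
  rw [Finset.sum_comm]

variable {n p : ℕ} {φ : Fin n → (Fin n → ℝ) → Par p} {θ : Par p} {D : Design n p}
  {r : ℕ → ℝ → ℝ} {S : Trajectory n p}

/-! ### Estimates under the special filter initialization, and the comparison bounds. -/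

theorem Trajectory.IsSolution.εTrue_eq_zero (hr : IsBoundarySignal n r)
    (hS : S.IsSolution φ θ D r (Ici 0)) (hΩ : S.Ω 0 = 0) (hΩ₀ : S.Ω₀ 0 = -S.x 0) {t : ℝ}
    (ht : 0 ≤ t) : S.εTrue θ t = 0 := by
  have h0 : S.εTrue θ 0 = 0 := by simp [Trajectory.εTrue, hΩ, hΩ₀]
  have h1 := (hS.mono (Icc_subset_Ici_self : Icc 0 t ⊆ Ici 0)).εTrue_quadForm_le hr le_rfl ht
  obtain ⟨l, L, hl, -, hP⟩ := exists_quadForm_bounds D.P_posDef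
  have h2 := (hP (S.εTrue θ t)).1
  rw [h0, zero_dotProduct] at h1
  have h3 : ‖S.εTrue θ t‖ ^ 2 ≤ 0 := by
    by_contra! h
    have := mul_pos hl h
    linarith
  simpa using h3.antisymm (sq_nonneg _)

/-- With `εTrue = 0` and scalar `Γ`, the estimator energy is just `γ⁻¹ |θ̃|²`. -/
theorem Trajectory.IsSolution.norm_θtilde_le (hr : IsBoundarySignal n r) {γ : ℝ} (hγ : 0 < γ)
    (hΓ : D.Γ = γ • (1 : Matrix (Fin p) (Fin p) ℝ)) (hS : S.IsSolution φ θ D r (Ici 0))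
    (hΩ : S.Ω 0 = 0) (hΩ₀ : S.Ω₀ 0 = -S.x 0) {t : ℝ} (ht : 0 ≤ t) :
    ‖θ - S.θhat t‖ ≤ ‖θ - S.θhat 0‖ := by
  have h1 := (hS.mono (Icc_subset_Ici_self : Icc 0 t ⊆ Ici 0)).estimatorEnergy_le hr le_rfl ht
  have hinv : D.Γ⁻¹ = γ⁻¹ • (1 : Matrix (Fin p) (Fin p) ℝ) := by
    refine Matrix.inv_eq_left_inv ?_
    rw [hΓ]
    simp [smul_smul, hγ.ne']
  have hq : ∀ v : Par p, v.ofLp ⬝ᵥ D.Γ⁻¹ *ᵥ v.ofLp = γ⁻¹ * ‖v‖ ^ 2 := fun v => by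
    rw [hinv, Matrix.smul_mulVec, Matrix.one_mulVec, dotProduct_smul, ← inner_eq_dotProduct,
      real_inner_self_eq_norm_sq, smul_eq_mul]
  simp only [Trajectory.estimatorEnergy, hS.εTrue_eq_zero hr hΩ hΩ₀ ht,
    hS.εTrue_eq_zero hr hΩ hΩ₀ le_rfl, zero_dotProduct, add_zero, hq] at h1
  exact le_of_sq_le_sq (le_of_mul_le_mul_left h1 (inv_pos.2 hγ)) (norm_nonneg _)

/-- Now `ε = Ωᵀθ̃`, so the unnormalized update is at most `γ |Ω|² |θ̃|`, while the normalizer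
exceeds `ν |Ω|²`. -/
theorem Trajectory.IsSolution.norm_updateLaw_le (hr : IsBoundarySignal n r) {γ : ℝ} (hγ : 0 < γ)
    (hΓ : D.Γ = γ • (1 : Matrix (Fin p) (Fin p) ℝ)) (hν : 0 < D.ν)
    (hS : S.IsSolution φ θ D r (Ici 0)) (hΩ : S.Ω 0 = 0) (hΩ₀ : S.Ω₀ 0 = -S.x 0) {t : ℝ}
    (ht : 0 ≤ t) : ‖S.updateLaw D t‖ ≤ γ / D.ν * ‖θ - S.θhat 0‖ := by
  have hε : S.ε t = (S.Ω t)ᵀ *ᵥ (θ - S.θhat t).ofLp := by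
    rw [S.ε_eq θ, hS.εTrue_eq_zero hr hΩ hΩ₀ ht, zero_add, Trajectory.η]
  have h1 : S.updateLaw D t = (S.normalizer D t)⁻¹ • γ •
      (WithLp.toLp 2 (S.Ω t *ᵥ ((S.Ω t)ᵀ *ᵥ (θ - S.θhat t).ofLp)) : Par p) := by
    simp only [Trajectory.updateLaw, Trajectory.normalizer, hε, hΓ, Matrix.smul_mulVec,
      Matrix.one_mulVec, WithLp.toLp_smul]
  have hN : (0 : ℝ) < S.normalizer D t := zero_lt_one.trans_le Trajectory.one_le_normalizer
  have hF : 0 ≤ frobNorm (S.Ω t) := Real.sqrt_nonneg _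
  have h2 := norm_toLp_mulVec_le (S.Ω t) ((S.Ω t)ᵀ *ᵥ (θ - S.θhat t).ofLp)
  have h3 := norm_toLp_mulVec_le (S.Ω t)ᵀ (θ - S.θhat t).ofLp
  rw [frobNorm_transpose] at h3
  have h4 := hS.norm_θtilde_le hr hγ hΓ hΩ hΩ₀ ht
  have h5 := h2.trans (mul_le_mul_of_nonneg_left (h3.trans (mul_le_mul_of_nonneg_left h4 hF)) hF)
  rw [h1, norm_smul, norm_smul, Real.norm_of_nonneg (inv_nonneg.2 hN.le),
    Real.norm_of_nonneg hγ.le, inv_mul_le_iff₀ hN]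
  refine (mul_le_mul_of_nonneg_left h5 hγ.le).trans ?_
  have h6 : S.normalizer D t * (γ / D.ν * ‖θ - S.θhat 0‖) =
      γ / D.ν * ‖θ - S.θhat 0‖ + γ * (frobNorm (S.Ω t) *
        (frobNorm (S.Ω t) * ‖θ - S.θhat 0‖)) := by
    simp only [Trajectory.normalizer]
    field_simp
  rw [h6]
  have : 0 ≤ γ / D.ν * ‖θ - S.θhat 0‖ := by positivity
  linarith

/-- At time `0` one has `hᵢ₊₁ = bᵢ + sᵢ hᵢ` with `sᵢ ≥ cᵢ`. The gain choice says `bᵢ + cᵢ hᵢ ≥ 0`,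
also when `hᵢ = 0`, so nonnegativity propagates upward from `h₁`. -/
theorem h_initial_nonneg (hn : 1 ≤ n)
    (hgain : GainChoice φ D (S.x 0) (refVec n r 0) (S.θhat 0))
    (h0 : 0 ≤ S.h φ D r ⟨0, hn⟩ 0) (i : Fin n) : 0 ≤ S.h φ D r i 0 := by
  have key : ∀ k : ℕ, ∀ hk : k < n, 0 ≤ S.h φ D r ⟨k, hk⟩ 0 := by
    intro k
    induction k with
    | zero => exact fun _ => h0
    | succ k ih =>
      intro hk
      set i : Fin n := ⟨k, by omega⟩
      have hi : (i : ℕ) + 1 < n := hk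
      have hh : 0 ≤ err φ D i (S.x 0) (refVec n r 0) (S.θhat 0) := ih (by omega)
      have hc : D.c i ≤ sStep φ D i (virtualControl φ D i.castSucc) (S.x 0) (refVec n r 0)
        (S.θhat 0) := Trajectory.c_le_gain (r := r) i 0
      have hnext : S.h φ D r ⟨k + 1, hk⟩ 0 =
          gainBracket φ D i hi (S.x 0) (refVec n r 0) (S.θhat 0)
          + sStep φ D i (virtualControl φ D i.castSucc) (S.x 0) (refVec n r 0) (S.θhat 0)
            * err φ D i (S.x 0) (refVec n r 0) (S.θhat 0) := by
        have h1 : S.h φ D r ⟨k + 1, hk⟩ 0 = S.x 0 ⟨k + 1, hk⟩ -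
          virtualControl φ D i.succ (S.x 0) (refVec n r 0) (S.θhat 0)
            - refVec n r 0 ⟨k + 1, hk⟩ := rfl
        rw [h1, virtualControl_succ]
        simp only [gainBracket, i]
        ring
      rw [hnext]
      obtain ⟨hg1, hg2⟩ := hgain i hi
      set b := gainBracket φ D i hi (S.x 0) (refVec n r 0) (S.θhat 0) with hb
      set e := err φ D i (S.x 0) (refVec n r 0) (S.θhat 0) with he
      rcases hh.eq_or_lt with h | h
      · rw [← h, mul_zero, add_zero]
        exact hg2 h.symm
      · have h2 := (le_max_left _ _).trans (hg1 h.ne')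
        simp only [gainLowerBound, ← hb, ← he] at h2
        have h3 : -e⁻¹ * b * e ≤ D.c i * e := mul_le_mul_of_nonneg_right h2 h.le
        have h4 : -e⁻¹ * b * e = -b := by field_simp
        have h5 := mul_le_mul_of_nonneg_right hc h.le
        linarith
  exact key i i.2

theorem Design.cMin_le (i : Fin n) : D.cMin ≤ D.c i := ciInf_le (finite_range _).bddBelow i

theorem Design.κMin_le (i : Fin n) : D.κMin ≤ D.κ i := ciInf_le (finite_range _).bddBelow i

theorem Design.gMin_le {i : Fin n} (hi : 0 < (i : ℕ)) : D.gMin ≤ D.g i :=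
  ciInf_le (f := fun i : {i : Fin n // 0 < (i : ℕ)} => D.g i) (finite_range _).bddBelow ⟨i, hi⟩

theorem Design.cMin_pos (hn : 1 ≤ n) : 0 < D.cMin := by
  have : Nonempty (Fin n) := ⟨⟨0, hn⟩⟩
  obtain ⟨i, hi⟩ := exists_eq_ciInf_of_finite (f := D.c)
  exact (D.c_pos i).trans_eq hi

theorem Design.κMin_pos (hn : 1 ≤ n) : 0 < D.κMin := by
  have : Nonempty (Fin n) := ⟨⟨0, hn⟩⟩
  obtain ⟨i, hi⟩ := exists_eq_ciInf_of_finite (f := D.κ)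
  exact (D.κ_pos i).trans_eq hi

theorem Design.gMin_pos (hn : 1 < n) : 0 < D.gMin := by
  have : Nonempty {i : Fin n // 0 < (i : ℕ)} := ⟨⟨⟨1, hn⟩, Nat.one_pos⟩⟩
  obtain ⟨i, hi⟩ := exists_eq_ciInf_of_finite (f := fun i : {i : Fin n // 0 < (i : ℕ)} => D.g i)
  exact (D.g_pos i).trans_eq hi

/-- The bound on a perturbation relative to the nonlinear gain. -/
def perturbationLevel (D : Design n p) (γ e : ℝ) : ℝ :=
  1 / 2 * (1 / √(D.cMin * D.κMin) + if n = 1 then 0 else γ / (D.ν * √(D.cMin * D.gMin))) * e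

theorem perturbationLevel_nonneg {γ e : ℝ} (hγ : 0 < γ) (hν : 0 < D.ν) (he : 0 ≤ e) :
    0 ≤ perturbationLevel D γ e := by
  unfold perturbationLevel
  split_ifs <;> positivity

theorem violationBound_eq (hn : 1 ≤ n) (γ e : ℝ) :
    violationBound D γ e = geomBound (perturbationLevel D γ e) D.cMin n := by
  simp only [violationBound, geomBound, perturbationLevel,
    geomFactor_eq_geom_sum hn (Design.cMin_pos hn)]
  ring

theorem Trajectory.abs_perturbation_le_gain (hn : 1 ≤ n) {γ e t : ℝ} (hγ : 0 < γ)
    (hν : 0 < D.ν) (h1 : ‖θ - S.θhat t‖ ≤ e) (h2 : ‖S.updateLaw D t‖ ≤ γ / D.ν * e) (i : Fin n) :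
    |inner ℝ (S.w φ D r i t) (θ - S.θhat t) - inner ℝ (S.q φ D r i t) (S.updateLaw D t)| ≤
      S.gain φ D r i t * perturbationLevel D γ e := by
  have he : 0 ≤ e := (norm_nonneg _).trans h1
  have hc : 0 < D.cMin := Design.cMin_pos hn
  have hκ : 0 < D.κMin := Design.κMin_pos hn
  have hgain : S.gain φ D r i t =
      D.c i + D.κ i * ‖S.w φ D r i t‖ ^ 2 + D.g i * ‖S.q φ D r i t‖ ^ 2 := rfl
  have h3 := Design.cMin_le (D := D) i
  have h4 := mul_le_mul_of_nonneg_right (Design.κMin_le (D := D) i)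
    (sq_nonneg ‖S.w φ D r i t‖)
  have hg0 : 0 ≤ S.gain φ D r i t := (D.c_pos i).le.trans (Trajectory.c_le_gain i t)
  by_cases hi : 0 < (i : ℕ)
  · have hn1 : 1 < n := by omega
    have hg : 0 < D.gMin := Design.gMin_pos hn1
    have h5 := mul_le_mul_of_nonneg_right (Design.gMin_le (D := D) hi)
      (sq_nonneg ‖S.q φ D r i t‖)
    refine (abs_perturbation_le hc hκ hg h1 h2 (s := S.gain φ D r i t)
      (by rw [hgain]; linarith)).trans_eq ?_
    simp only [perturbationLevel, hn1.ne', if_false]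
    congr 1
    have h6 : √(D.cMin * D.κMin) ≠ 0 := (Real.sqrt_pos.2 (mul_pos hc hκ)).ne'
    have h7 : √(D.cMin * D.gMin) ≠ 0 := (Real.sqrt_pos.2 (mul_pos hc hg)).ne'
    field_simp
  · have hi0 : i = ⟨0, hn⟩ := Fin.ext (by simpa using hi)
    have hq : S.q φ D r i t = 0 := by
      have h5 : virtualControl φ D i.castSucc = fun _ _ _ => 0 := by rw [hi0]; rfl
      simp [Trajectory.q, gradPar, h5, gradient]
    have h6 := abs_perturbation_le (w := S.w φ D r i t) (q := S.q φ D r i t) (v := 0) (d := 0)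
      hc hκ (D.g_pos i) h1 (by simp) (s := S.gain φ D r i t) (by rw [hgain]; linarith)
    rw [inner_zero_right] at h6
    rw [hq, inner_zero_left]
    refine h6.trans (mul_le_mul_of_nonneg_left ?_ hg0)
    have h7 : perturbationLevel D γ e = e / (2 * √(D.cMin * D.κMin)) +
        1 / 2 * (if n = 1 then 0 else γ / (D.ν * √(D.cMin * D.gMin))) * e := by
      unfold perturbationLevel
      have h8 : √(D.cMin * D.κMin) ≠ 0 := (Real.sqrt_pos.2 (mul_pos hc hκ)).ne'
      field_simp
    have h8 : 0 ≤ 1 / 2 * (if n = 1 then 0 else γ / (D.ν * √(D.cMin * D.gMin))) * e := by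
      split_ifs <;> positivity
    rw [h7, zero_div]
    linarith

/-- Two-sided bounds on all error coordinates, given the relative size `m` of the perturbations. -/
theorem Trajectory.IsSolution.h_bounds (hn : 1 ≤ n) (hφ : IsStrictFeedback φ)
    (hr : IsBoundarySignal n r) (hS : S.IsSolution φ θ D r (Ici 0)) {m : ℝ} (hm : 0 ≤ m)
    (hpert : ∀ i t, 0 ≤ t → |inner ℝ (S.w φ D r i t) (θ - S.θhat t)
      - inner ℝ (S.q φ D r i t) (S.updateLaw D t)| ≤ S.gain φ D r i t * m)
    {a : ℕ → ℝ} (ha : ∀ k, 0 ≤ a k) (hinit : ∀ i : Fin n, S.h φ D r i 0 = a i) (i : Fin n) :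
    ∀ t, 0 ≤ t → -geomBound m D.cMin (n - i) ≤ S.h φ D r i t ∧
      S.h φ D r i t ≤ Real.exp (-D.cMin * t) * expSum a (n - i) i t
        + geomBound m D.cMin (n - i) := by
  have hc : 0 < D.cMin := Design.cMin_pos hn
  set c := D.cMin
  refine backward_induction (motive := fun i => ∀ t, 0 ≤ t → -geomBound m c (n - i) ≤
    S.h φ D r i t ∧ S.h φ D r i t ≤ Real.exp (-c * t) * expSum a (n - i) i t
      + geomBound m c (n - i)) (fun i ih => ?_) i
  obtain ⟨j, hj⟩ : ∃ j, n - (i : ℕ) = j + 1 := ⟨n - i - 1, by omega⟩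
  rw [hj]
  have hnext : ∀ t, 0 ≤ t → -geomBound m c j ≤ S.hNext φ D r i t ∧
      S.hNext φ D r i t ≤ Real.exp (-c * t) * expSum a j (i + 1) t + geomBound m c j := by
    intro t ht
    by_cases hi : (i : ℕ) + 1 < n
    · have h := ih hi t ht
      have hj' : n - ((i : ℕ) + 1) = j := by omega
      simp only [hj'] at h
      simpa only [Trajectory.hNext, hi, dif_pos] using h
    · have hj' : j = 0 := by omega
      subst hj'
      simp [Trajectory.hNext, hi, geomBound, expSum]
  intro t ht
  have hcont := (hS.continuousOn_h hφ hr subset_rfl i).mono (Icc_subset_Ici_self : Icc 0 t ⊆ Ici 0)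
  have hM := geomBound_nonneg hm hc j
  have hMs := geomBound_succ m c j
  have hMs0 := geomBound_nonneg hm hc (j + 1)
  -- The recursion `M_{j+1} = m + c⁻¹ M_j` is made for this: a gain of at least `c` turns `c⁻¹ M_j`
  -- into at least `M_j`, which covers the next coordinate, while the summand `m` covers the
  -- perturbation.
  have hgainM : ∀ s, geomBound m c j + S.gain φ D r i s * m ≤
      S.gain φ D r i s * geomBound m c (j + 1) := by
    intro s
    have h1 : c ≤ S.gain φ D r i s := (Design.cMin_le i).trans (Trajectory.c_le_gain i s)
    have h2 := mul_le_mul_of_nonneg_right h1 (mul_nonneg (inv_nonneg.2 hc.le) hM)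
    rw [mul_inv_cancel_left₀ hc.ne'] at h2
    rw [hMs]
    linarith
  have hg0 : ∀ s, 0 ≤ S.gain φ D r i s := fun s =>
    (D.c_pos i).le.trans (Trajectory.c_le_gain i s)
  constructor
  · have := nonpos_of_hasDerivAt_nonpos_of_pos
      (y := fun s => -S.h φ D r i s - geomBound m c (j + 1)) ht (hr.finite_jumps le_rfl t)
      (hcont.neg.sub continuousOn_const)
      (by
        have h1 := hinit i
        have h2 := ha i
        linarith) fun s hs hsN hpos => by
        refine ⟨_, ((hS.dynamicsAt_of_lt hr le_rfl hs.1 hsN).hasDerivAt_h hφ i).neg.sub_const _, ?_⟩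
        have h1 := (abs_le.1 (hpert i s hs.1.le)).1
        have h2 := (hnext s hs.1.le).1
        have h3 := hgainM s
        have h4 := mul_nonneg (hg0 s) hpos.le
        linarith
    linarith
  -- The linear cascade's solution is subtracted as well. Its inflow matches the transient part of
  -- `hNext`, and its own decay rate `c` is dominated by the gain because it is nonnegative; here `a
  -- ≥ 0` is needed.
  · have hET : ∀ s, HasDerivAt (fun s => Real.exp (-c * s) * expSum a (j + 1) i s)
        (-c * (Real.exp (-c * s) * expSum a (j + 1) i s)
          + Real.exp (-c * s) * expSum a j (i + 1) s) s := by
      intro s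
      have h1 : HasDerivAt (fun s => Real.exp (-c * s)) (Real.exp (-c * s) * (-c * 1)) s :=
        ((hasDerivAt_id s).const_mul (-c)).exp
      refine (h1.mul (hasDerivAt_expSum a j i s)).congr_deriv ?_
      ring
    have := nonpos_of_hasDerivAt_nonpos_of_pos
      (y := fun s => S.h φ D r i s - geomBound m c (j + 1)
        - Real.exp (-c * s) * expSum a (j + 1) i s) ht (hr.finite_jumps le_rfl t)
      ((hcont.sub continuousOn_const).sub fun s _ =>
        (hET s).continuousAt.continuousWithinAt)
      (by
        simp only [hinit i, expSum_succ_zero, mul_zero, Real.exp_zero, one_mul]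
        linarith) fun s hs hsN hpos => by
        refine ⟨_, (((hS.dynamicsAt_of_lt hr le_rfl hs.1 hsN).hasDerivAt_h hφ i).sub_const _).sub
          (hET s), ?_⟩
        have h1 := (abs_le.1 (hpert i s hs.1.le)).2
        have h2 := (hnext s hs.1.le).2
        have h3 := hgainM s
        have h4 := mul_nonneg (hg0 s) hpos.le
        have h5 : 0 ≤ Real.exp (-c * s) * expSum a (j + 1) i s :=
          mul_nonneg (Real.exp_nonneg _) (expSum_nonneg ha _ _ hs.1.le)
        have h6 : c * (Real.exp (-c * s) * expSum a (j + 1) i s) ≤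
            S.gain φ D r i s * (Real.exp (-c * s) * expSum a (j + 1) i s) :=
          mul_le_mul_of_nonneg_right ((Design.cMin_le i).trans (Trajectory.c_le_gain i s)) h5
        linarith
    linarith

end ExplicitBounds

end AdaptiveOverride

end

/-! ### Assembly of the two assertions. -/

theorem theorem4 {n p : ℕ} (hn : 1 ≤ n) (φ : Fin n → (Fin n → ℝ) → Par p)
    (hφ : IsStrictFeedback φ) (θ : Par p) (r : ℕ → ℝ → ℝ) (hr : IsBoundarySignal n r)
    (D : Design n p) :
    -- (i) global existence, global uniform boundedness of all signals, asymptotic tracking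
    ((∀ t₀ : ℝ, 0 ≤ t₀ → ∀ (x₀ : Fin n → ℝ) (M₀ : Matrix (Fin p) (Fin n) ℝ) (z₀ : Fin n → ℝ)
        (ϑ₀ : Par p), ∃ S : Trajectory n p, S.IsSolution φ θ D r (Set.Ici t₀) ∧
          S.x t₀ = x₀ ∧ S.Ω t₀ = M₀ ∧ S.Ω₀ t₀ = z₀ ∧ S.θhat t₀ = ϑ₀) ∧
      (∀ R : ℝ, ∃ B : ℝ, ∀ t₀ : ℝ, 0 ≤ t₀ → ∀ J : Set ℝ, IsLeast J t₀ → J.OrdConnected →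
        ∀ S : Trajectory n p, S.IsSolution φ θ D r J → S.StateBound R t₀ →
          ∀ t ∈ J, S.SignalBound φ θ D r B t) ∧
      (∀ t₀ : ℝ, 0 ≤ t₀ → ∀ S : Trajectory n p, S.IsSolution φ θ D r (Set.Ici t₀) →
        Filter.Tendsto (fun t => S.x t ⟨0, hn⟩ - r 0 t) Filter.atTop (nhds 0))) ∧
    -- (ii) bounds on the first barrier function
    (∀ γ : ℝ, 0 < γ → D.Γ = γ • (1 : Matrix (Fin p) (Fin p) ℝ) → 0 < D.ν →
      ∀ S : Trajectory n p, S.IsSolution φ θ D r (Set.Ici 0) →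
        GainChoice φ D (S.x 0) (refVec n r 0) (S.θhat 0) →
        0 ≤ S.x 0 ⟨0, hn⟩ - r 0 0 → S.Ω 0 = 0 → S.Ω₀ 0 = -S.x 0 →
        ∀ t : ℝ, 0 ≤ t →
          -violationBound D γ ‖θ - S.θhat 0‖ ≤ S.x t ⟨0, hn⟩ - r 0 t ∧
          S.x t ⟨0, hn⟩ - r 0 t ≤
            Real.exp (-D.cMin * t) *
                ∑ i : Fin n, t ^ (i : ℕ) / (Nat.factorial (i : ℕ) : ℝ) * S.h φ D r i 0
              + violationBound D γ ‖θ - S.θhat 0‖) := by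
  refine ⟨⟨fun t₀ ht₀ x₀ M₀ z₀ ϑ₀ => exists_isSolution_Ici hn hφ hr ht₀ x₀ M₀ z₀ ϑ₀, fun R => ?_,
    fun t₀ ht₀ S hS => ?_⟩, fun γ hγ hΓ hν S hS hgain h0 hΩ hΩ₀ t ht => ?_⟩
  · obtain ⟨B, -, hB⟩ := exists_signalBound (θ := θ) (D := D) hφ hr R
    -- An order-connected set with least element `t₀` contains `[t₀, t]` for each of its points `t`,
    -- so the bound at the right end of a compact interval applies.
    exact ⟨B, fun t₀ ht₀ J hJ hJc S hS hR t ht =>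
      hB t₀ t S ht₀ (hJ.2 ht) (hS.mono (hJc.out hJ.1 ht)) hR⟩
  · exact (hS.tendsto_h hφ hr ht₀ ⟨0, hn⟩).congr fun t => Trajectory.h_zero hn t
  · have hinit := h_initial_nonneg (r := r) hn hgain (by rwa [Trajectory.h_zero])
    -- Padding with zeros beyond index `n` lets the exponential sums run over natural-number
    -- indices.
    set a : ℕ → ℝ := fun k => if hk : k < n then S.h φ D r ⟨k, hk⟩ 0 else 0 with ha_def
    have ha : ∀ k, 0 ≤ a k := fun k => by
      simp only [ha_def]
      split_ifs
      exacts [hinit _, le_rfl]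
    have hai : ∀ i : Fin n, S.h φ D r i 0 = a i := fun i => by simp [ha_def]
    have h := hS.h_bounds hn hφ hr (perturbationLevel_nonneg hγ hν (norm_nonneg (θ - S.θhat 0)))
      (fun i t ht => Trajectory.abs_perturbation_le_gain hn hγ hν
        (hS.norm_θtilde_le hr hγ hΓ hΩ hΩ₀ ht) (hS.norm_updateLaw_le hr hγ hΓ hν hΩ hΩ₀ ht) i)
      ha hai ⟨0, hn⟩ t ht
    rw [Trajectory.h_zero, Nat.sub_zero, ← violationBound_eq hn] at h
    have hsum : expSum a n 0 t =
        ∑ i : Fin n, t ^ (i : ℕ) / (Nat.factorial (i : ℕ) : ℝ) * S.h φ D r i 0 := by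
      rw [expSum, Finset.sum_range]
      simp only [zero_add, hai]
    rwa [hsum] at h
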